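/- **Setting.** Fix $n\ge 2$ asynchronous processes $p_1,\dots,p_n$. A distributed alphabet consists of disjoint invocation alphabets $\Sigma_i^{<}$ and response alphabets $\Sigma_i^{>}$, one pair per process. $\Sigma^\omega$ is the set of well-formed $\omega$-words: each local word $x|i$ is infinite and alternates invocations and responses, starting with an invocation. A language is a set $L\subseteq\Sigma^\omega$. The $k$-th invocation and the $k$-th response of $p_i$ form its $k$-th operation; an operation precedes another in $x$ if its response appears before the other's invocation, and two operations are concurrent if neither precedes the other. An algorithm $V$ gives each process a (possibly infinite) state machine that repeats forever: pick nondeterministically an invocation $v\in\Sigma_i^{<}$; run a wait-free block of atomic operations on the shared memory; send $v$ to the timed adversary $A^\tau$; receive a pair $(w,\mathit{view})$ with $w\in\Sigma_i^{>}$ from $A^\tau$; run a second wait-free block, which ends by reporting YES or NO. The shared memory consists of objects whose types belong to a fixed collection $\mathcal P$ that contains all read/write registers (and possibly stronger objects). On receiving $v$, $A^\tau$ adds $v$, marked so as to be unique, to the set of invocations of $p_i$, writes this set to entry $i$ of a shared array, sends $v$ to a black-box adversary, receives an arbitrary response $w$, takes an atomic snapshot of the array, and returns $w$ together with the union (the view)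 of all entries. The input $x(E)$ of an execution $E$ is the word of the invocations sent to and the responses received from $A^\tau$, ignoring views and marks. $E\equiv E'$ means that every process passes through the same sequence of local states in $E$ and $E'$. Let $\mathrm{view}_1\subset \mathrm{view}_2\subset\cdots$ be the distinct views in $E$, and $\mathrm{view}_0=\emptyset$; a sketch $x^{\sim}(E)$ is any word obtained by appending, for $k=1,2,\dots$, first the invocations in $\mathrm{view}_k\setminus \mathrm{view}_{k-1}$ in any order, then the responses of the operations with view $\mathrm{view}_k$ in any order. $\mathrm{NO}(E,p)$ is the number of times that $p$ reports NO in $E$. All executions below are fair and failure-free (every process takes infinitely many steps). $V$ *predictively strongly decides* $L$ if for every execution $E$: - if $x(E)\in L$, then either $\mathrm{NO}(E,p)=0$ for all $p$, or $\mathrm{NO}(E,p)>0$ for some $p$ and some sketch $x^\sim(E)$ satisfies $x^{\sim}(E)\notin L$ and $x(E')=x^\sim(E)$ for some execution $E'\equiv E$ of $V$; - if $x(E)\notin L$, then $\mathrm{NO}(E,p)>0$ for some $p$. $V$ *predictively weakly decides* $L$ if for every execution $E$: - if $x(E)\in L$, then either $\mathrm{NO}(E,p)<\infty$ for all $p$,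 or $\mathrm{NO}(E,p)=\infty$ for some $p$ and some sketch $x^\sim(E)$ satisfies $x^{\sim}(E)\notin L$ and $x(E')=x^\sim(E)$ for some execution $E'\equiv E$ of $V$; - if $x(E)\notin L$, then $\mathrm{NO}(E,p)=\infty$ for all $p$. $\mathsf{PSD}$ and $\mathsf{PWD}$ are the classes of languages (over all distributed alphabets for $n$ processes) for which an algorithm exists that predictively strongly, respectively weakly, decides them. For the counter, with invocations $inc$, $read$ for each process and responses $ack$ and $c\in\mathbb N$, the language $\mathrm{SEC\_COUNT}$ consists of the well-formed words in which every $inc$ is answered by $ack$, every $read$ is answered by a number, and: (1) every $read$ returns at least the number of preceding $inc$ operations of the same process; (2) every $read$ returns at least the value returned by the previous $read$ of the same process; (3) there are only finitely many $inc$ operations, and eventually all operations are $read$ operations that return their total number; (4) every $read$ returns at most the number of $inc$ operations that precede it or are concurrent to it. **Theorem.** For every $n\ge2$ and every such $\mathcal P$, $\mathsf{PSD}\subsetneq\mathsf{PWD}$. Moreover, $\mathrm{SEC\_COUNT}\in\mathsf{PWD}$ and $\mathrm{SEC\_COUNT}\notin\mathsf{PSD}$. -/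

import Mathlib

namespace DRV

/-! ### Distributed alphabets, words and languages -/

/-- A distributed alphabet for `n` processes: an invocation alphabet and a response alphabet per
process. All of these are made disjoint by the type `Symbol` below. -/
structure DistAlphabet (n : ℕ) where
  Inv : Fin n → Type
  Resp : Fin n → Type

/-- The symbols of the alphabet `A`. -/
inductive Symbol {n : ℕ} (A : DistAlphabet n) : Type
  | inv (i : Fin n) (v : A.Inv i)
  | resp (i : Fin n) (w : A.Resp i)

/-- The process to whose local alphabet a symbol belongs. -/
def Symbol.proc {n : ℕ} {A : DistAlphabet n} : Symbol A → Fin n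
  | .inv i _ => i
  | .resp i _ => i

/-- Being an invocation symbol. -/
def Symbol.IsInv {n : ℕ} {A : DistAlphabet n} : Symbol A → Prop
  | .inv _ _ => True
  | .resp _ _ => False

/-- `ω`-words over `A`. -/
abbrev Word {n : ℕ} (A : DistAlphabet n) : Type := ℕ → Symbol A

/-- Well-formed words: every local word is infinite, and it alternates invocations and responses,
starting with an invocation (a symbol is an invocation exactly when the number of earlier symbols of
the same process is even). That every initial part of a local word lies in a finite prefix is
automatic for words indexed by `ℕ`. -/
def WellFormed {n : ℕ} {A : DistAlphabet n} (x : Word A) : Prop :=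
  (∀ i, {t | (x t).proc = i}.Infinite) ∧
    ∀ t, (x t).IsInv ↔ Even (Nat.count (fun s => (x s).proc = (x t).proc) t)

/-- A pair `(i, k)` stands for the `k`-th operation (counted from `0`) of process `i`. -/
abbrev OpId (n : ℕ) : Type := Fin n × ℕ

/-- Position in `x` of the invocation symbol of an operation. -/
noncomputable def invPos {n : ℕ} {A : DistAlphabet n} (x : Word A) (o : OpId n) : ℕ :=
  Nat.nth (fun t => ∃ v, x t = .inv o.1 v) o.2

/-- Position in `x` of the response symbol of an operation. -/
noncomputable def respPos {n : ℕ} {A : DistAlphabet n} (x : Word A) (o : OpId n) : ℕ :=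
  Nat.nth (fun t => ∃ w, x t = .resp o.1 w) o.2

/-- `o` precedes `o'` in `x`. -/
def Precedes {n : ℕ} {A : DistAlphabet n} (x : Word A) (o o' : OpId n) : Prop :=
  respPos x o < invPos x o'

/-- `o` and `o'` are concurrent in `x`. -/
def Concurrent {n : ℕ} {A : DistAlphabet n} (x : Word A) (o o' : OpId n) : Prop :=
  ¬ Precedes x o o' ∧ ¬ Precedes x o' o

/-! ### The strongly-eventual consistent counter -/

/-- Invocations of the counter. -/
inductive CounterInv : Type
  | inc
  | read

/-- Responses of the counter: `ack` answers `inc`, `val c` answers `read`. -/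
inductive CounterResp : Type
  | ack
  | val (c : ℕ)

/-- The alphabet of the counter. -/
def counterAlphabet (n : ℕ) : DistAlphabet n where
  Inv _ := CounterInv
  Resp _ := CounterResp

section Counter

variable {n : ℕ}

/-- Position `t` of `x` holds an invocation of `inc`. -/
def IncAt (x : Word (counterAlphabet n)) (t : ℕ) : Prop :=
  ∃ i, x t = .inv i CounterInv.inc

/-- Operation `o` of `x` is an `inc`. -/
def IsInc (x : Word (counterAlphabet n)) (o : OpId n) : Prop :=
  x (invPos x o) = .inv o.1 CounterInv.inc

/-- Operation `o` of `x` is a `read`. -/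
def IsRead (x : Word (counterAlphabet n)) (o : OpId n) : Prop :=
  x (invPos x o) = .inv o.1 CounterInv.read

/-- Operation `o` of `x` is a `read` that returns `c`. -/
def ReadReturns (x : Word (counterAlphabet n)) (o : OpId n) (c : ℕ) : Prop :=
  IsRead x o ∧ x (respPos x o) = .resp o.1 (CounterResp.val c)

/-- Weakly-eventual consistent histories of the counter. -/
structure WeaklyEventual (x : Word (counterAlphabet n)) : Prop where
  inc_ack : ∀ o, IsInc x o → x (respPos x o) = .resp o.1 CounterResp.ack
  read_val : ∀ o, IsRead x o → ∃ c, ReadReturns x o c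
  /-- A read returns at least the number of preceding increments of the same process. -/
  own_incs : ∀ o c, ReadReturns x o c →
    {o' : OpId n | o'.1 = o.1 ∧ IsInc x o' ∧ Precedes x o' o}.ncard ≤ c
  /-- A read returns at least what the previous read of the same process returned. -/
  monotone_reads : ∀ (i : Fin n) (k l c d : ℕ), k < l →
    (∀ m, k < m → m < l → ¬ IsRead x (i, m)) →
    ReadReturns x (i, k) c → ReadReturns x (i, l) d → c ≤ d
  /-- Eventually there are only reads, -/
  finitely_many_incs : {t | IncAt x t}.Finite
  /-- and after any prefix (of length `m`) followed by reads only, eventually all operations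
  return the number of increments in that prefix. -/
  convergence : ∀ m, (∀ t, m ≤ t → ¬ IncAt x t) →
    ∃ m', ∀ o, m' ≤ invPos x o → ReadReturns x o {t | t < m ∧ IncAt x t}.ncard

/-- Strongly-eventual consistent histories of the counter. -/
structure StronglyEventual (x : Word (counterAlphabet n)) : Prop extends WeaklyEventual x where
  /-- A read returns at most the number of increments that precede it or are concurrent to it. -/
  real_time : ∀ o c, ReadReturns x o c →
    c ≤ {o' : OpId n | IsInc x o' ∧ (Precedes x o' o ∨ Concurrent x o' o)}.ncard

end Counter

/-- Distributed languages over arbitrary alphabets for `n` processes (being a subset of the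
well-formed words is imposed where this type is used). -/
abbrev Lang (n : ℕ) : Type 1 := Σ A : DistAlphabet n, Set (Word A)

/-- The language `SEC_COUNT` for `n` processes. -/
def secCount (n : ℕ) : Lang n :=
  ⟨counterAlphabet n, {x | WellFormed x ∧ StronglyEventual x}⟩

/-! ### Shared memory -/

/-- A type of shared objects that are accessed by atomic operations. -/
structure SharedObject where
  State : Type
  Op : Type
  Res : Type
  apply : State → Op → State × Res

/-- The read/write register with values in `α`: `none` reads, `some a` writes `a`. -/
def register (α : Type) : SharedObject where
  State := α
  Op := Option α
  Res := Option α
  apply s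
    | none => (s, some s)
    | some a => (a, none)

/-! ### Algorithms -/

/-- An invocation marked with its process and with its index among the invocations of that process,
so that marked invocations occur at most once. -/
abbrev Marked {n : ℕ} (A : DistAlphabet n) : Type := Σ i : Fin n, ℕ × A.Inv i

/-- Views: sets of (marked) invocations. -/
abbrev View {n : ℕ} (A : DistAlphabet n) : Type := Set (Marked A)

/-- The values that are reported. -/
inductive Report : Type
  | yes
  | no

/-- What to do next inside a block of code: apply an atomic operation to one of the shared objects
and go on with a state that depends on the result, or finish the block with a value. -/
inductive Instr {ι : Type} (obj : ι → SharedObject) (σ β : Type) : Type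
  | access (c : ι) (op : (obj c).Op) (next : (obj c).Res → σ)
  | finish (b : β)

/-- A distributed algorithm for `n` processes that interacts with the timed adversary over the
alphabet `A` and uses shared objects of the types in `P`. Each process repeats forever: pick an
invocation (`pick`), run the block `pre`, send the invocation to the timed adversary, receive a
response and a view from it (`receive`), run the block `post`, which ends with a report. -/
structure Algorithm {n : ℕ} (P : Set SharedObject) (A : DistAlphabet n) where
  Cell : Type
  obj : Cell → SharedObject
  obj_mem : ∀ c, obj c ∈ P
  memStart : ∀ c, (obj c).State
  State : Fin n → Type
  start : ∀ i, State i
  pick : ∀ i, State i → A.Inv i → State i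
  pre : ∀ i, State i → Instr obj (State i) Unit
  receive : ∀ i, State i → A.Resp i → View A → State i
  post : ∀ i, State i → Instr obj (State i) (Report × State i)

/-- The point of its loop at which a process is, with the current values of `vᵢ`, `wᵢ`, `viewᵢ`. -/
inductive Phase {n : ℕ} (A : DistAlphabet n) (i : Fin n) : Type
  /-- about to pick an invocation -/
  | choose
  /-- in the block before the interaction, or about to send `v` to the timed adversary -/
  | before (v : A.Inv i)
  /-- `v` was sent to the timed adversary, which has not announced it yet -/
  | invoked (v : A.Inv i)
  /-- `v` is announced, but not yet sent to the underlying adversary -/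
  | announced (v : A.Inv i)
  /-- `v` was sent to the underlying adversary -/
  | forwarded (v : A.Inv i)
  /-- the underlying adversary has replied `w` -/
  | replied (v : A.Inv i) (w : A.Resp i)
  /-- the snapshot was taken, with union `S` -/
  | viewed (v : A.Inv i) (w : A.Resp i) (S : View A)
  /-- in the block after the interaction, or about to report -/
  | after

/-- The events of an execution. Invocation and response events (those of the interaction with the
timed adversary) and reports are visible; all other steps of process `i` are `internal i`. The
number `k` is the index of the operation among the operations of process `i`. -/
inductive Event {n : ℕ} (A : DistAlphabet n) : Type
  | internal (i : Fin n)
  | invoke (i : Fin n) (k : ℕ) (v : A.Inv i)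
  | respond (i : Fin n) (k : ℕ) (w : A.Resp i) (S : View A)
  | report (i : Fin n) (b : Report)

/-- The process that performs an event. -/
def Event.proc {n : ℕ} {A : DistAlphabet n} : Event A → Fin n
  | .internal i => i
  | .invoke i _ _ => i
  | .respond i _ _ _ => i
  | .report i _ => i

/-- The input symbol of an event, if it has one; views are ignored. -/
def Event.symbol {n : ℕ} {A : DistAlphabet n} : Event A → Option (Symbol A)
  | .internal _ => none
  | .invoke i _ v => some (.inv i v)
  | .respond i _ w _ => some (.resp i w)
  | .report _ _ => none

section Executions

variable {n : ℕ} {P : Set SharedObject} {A : DistAlphabet n}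

/-- The local state of a process, including the local variables of the timed adversary: the set
`sent` of its invocations so far, and the number `count` of its completed operations. -/
structure LocalState (V : Algorithm P A) (i : Fin n) where
  code : V.State i
  phase : Phase A i
  sent : View A
  count : ℕ

/-- A configuration: the local states, the shared memory of the algorithm, and the shared array
in which the timed adversary announces invocations. -/
structure Config (V : Algorithm P A) where
  loc : ∀ i, LocalState V i
  mem : ∀ c, (V.obj c).State
  ann : Fin n → View A

/-- The initial configuration. -/
def Config.initial (V : Algorithm P A) : Config V where
  loc i := { code := V.start i, phase := .choose, sent := ∅, count := 0 }
  mem := V.memStart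
  ann _ := ∅

/-- Replace the local state of process `i`. -/
def Config.setLoc {V : Algorithm P A} (C : Config V) (i : Fin n) (l : LocalState V i) : Config V :=
  { C with loc := Function.update C.loc i l }

open Classical in
/-- Apply the operation `op` to the shared object `c`. -/
noncomputable def Config.applyOp {V : Algorithm P A} (C : Config V) (c : V.Cell)
    (op : (V.obj c).Op) : Config V :=
  { C with mem := Function.update C.mem c ((V.obj c).apply (C.mem c) op).1 }

/-- The result of applying the operation `op` to the shared object `c`. -/
def Config.result {V : Algorithm P A} (C : Config V) (c : V.Cell) (op : (V.obj c).Op) :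
    (V.obj c).Res :=
  ((V.obj c).apply (C.mem c) op).2

/-- The steps of an algorithm that interacts with the timed adversary. -/
inductive Step (V : Algorithm P A) : Config V → Event A → Config V → Prop
  /-- Pick an arbitrary invocation. -/
  | pick (C : Config V) (i : Fin n) (v : A.Inv i) :
      (C.loc i).phase = .choose →
      Step V C (.internal i)
        (C.setLoc i { C.loc i with code := V.pick i (C.loc i).code v, phase := .before v })
  /-- Access the shared memory before the interaction. -/
  | preAccess (C : Config V) (i : Fin n) (v : A.Inv i) (c : V.Cell) (op : (V.obj c).Op)
      (next : (V.obj c).Res → V.State i) :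
      (C.loc i).phase = .before v → V.pre i (C.loc i).code = .access c op next →
      Step V C (.internal i)
        ((C.applyOp c op).setLoc i { C.loc i with code := next (C.result c op) })
  /-- Send the invocation to the timed adversary, which records it in its local variable. -/
  | invoke (C : Config V) (i : Fin n) (v : A.Inv i) :
      (C.loc i).phase = .before v → V.pre i (C.loc i).code = .finish () →
      Step V C (.invoke i (C.loc i).count v)
        (C.setLoc i { C.loc i with
          phase := .invoked v
          sent := (C.loc i).sent ∪ {⟨i, (C.loc i).count, v⟩} })
  /-- The timed adversary writes the recorded invocations to its shared array. -/
  | announce (C : Config V) (i : Fin n) (v : A.Inv i) :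
      (C.loc i).phase = .invoked v →
      Step V C (.internal i)
        ({ C with ann := Function.update C.ann i (C.loc i).sent }.setLoc i
          { C.loc i with phase := .announced v })
  /-- The timed adversary sends the invocation to the underlying adversary. -/
  | forward (C : Config V) (i : Fin n) (v : A.Inv i) :
      (C.loc i).phase = .announced v →
      Step V C (.internal i) (C.setLoc i { C.loc i with phase := .forwarded v })
  /-- The underlying adversary replies with an arbitrary response. -/
  | reply (C : Config V) (i : Fin n) (v : A.Inv i) (w : A.Resp i) :
      (C.loc i).phase = .forwarded v →
      Step V C (.internal i) (C.setLoc i { C.loc i with phase := .replied v w })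
  /-- The timed adversary takes an atomic snapshot of its shared array. -/
  | snapshot (C : Config V) (i : Fin n) (v : A.Inv i) (w : A.Resp i) :
      (C.loc i).phase = .replied v w →
      Step V C (.internal i) (C.setLoc i { C.loc i with phase := .viewed v w (⋃ j, C.ann j) })
  /-- Receive the response and the view from the timed adversary. -/
  | respond (C : Config V) (i : Fin n) (v : A.Inv i) (w : A.Resp i) (S : View A) :
      (C.loc i).phase = .viewed v w S →
      Step V C (.respond i (C.loc i).count w S)
        (C.setLoc i { C.loc i with
          code := V.receive i (C.loc i).code w S
          phase := .after
          count := (C.loc i).count + 1 })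
  /-- Access the shared memory after the interaction. -/
  | postAccess (C : Config V) (i : Fin n) (c : V.Cell) (op : (V.obj c).Op)
      (next : (V.obj c).Res → V.State i) :
      (C.loc i).phase = .after → V.post i (C.loc i).code = .access c op next →
      Step V C (.internal i)
        ((C.applyOp c op).setLoc i { C.loc i with code := next (C.result c op) })
  /-- Report a value and start the next iteration. -/
  | report (C : Config V) (i : Fin n) (b : Report) (s : V.State i) :
      (C.loc i).phase = .after → V.post i (C.loc i).code = .finish (b, s) →
      Step V C (.report i b) (C.setLoc i { C.loc i with code := s, phase := .choose })

/-- (Infinite) executions. A process that takes only finitely many steps has crashed. -/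
structure Execution (V : Algorithm P A) where
  conf : ℕ → Config V
  event : ℕ → Event A
  conf_zero : conf 0 = Config.initial V
  step : ∀ t, Step V (conf t) (event t) (conf (t + 1))

variable {V : Algorithm P A}

/-- The times at which process `p` takes a step. -/
def Execution.stepTimes (E : Execution V) (p : Fin n) : Set ℕ := {t | (E.event t).proc = p}

/-- Fair failure-free executions. -/
def Execution.Fair (E : Execution V) : Prop := ∀ p, (E.stepTimes p).Infinite

/-- `x` is the input of `E`: the word of the symbols of its invocation and response events. -/
def Execution.HasInput (E : Execution V) (x : Word A) : Prop :=
  ∀ k, (E.event (Nat.nth (fun t => (E.event t).symbol.isSome) k)).symbol = some (x k)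

/-- The number of times that `p` reports `no` in `E`. -/
noncomputable def Execution.numNo (E : Execution V) (p : Fin n) : ℕ∞ :=
  {t | E.event t = .report p .no}.encard

/-- The local state of `p` just before its `k`-th step (counted from `0`). -/
noncomputable def Execution.localSeq (E : Execution V) (p : Fin n) (k : ℕ) : LocalState V p :=
  (E.conf (Nat.nth (fun t => t ∈ E.stepTimes p) k)).loc p

/-- Indistinguishable (fair) executions: every process passes through the same sequence of local
states in both. -/
def Execution.Indist (E E' : Execution V) : Prop := ∀ p k, E.localSeq p k = E'.localSeq p k

/-- `r = ⟨i, k, w⟩` is the response to the `k`-th operation of process `i` in `E`, and that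
operation has view `S`. -/
def Execution.Responds (E : Execution V) (r : Σ i : Fin n, ℕ × A.Resp i) (S : View A) : Prop :=
  ∃ t, E.event t = .respond r.1 r.2.1 r.2.2 S

/-- `y` is a sketch of `E`, that is, a word in the class of words constructed from the views of `E`
as follows. Let `u 0 ⊂ u 1 ⊂ ...` be the distinct views in `E`. For `k = 0, 1, ...` append first
the invocations in `u k` that are in no earlier view, in any order (list `I k`), and then the
responses of the operations whose view is `u k`, in any order (list `R k`). -/
def Execution.IsSketch (E : Execution V) (y : Word A) : Prop :=
  ∃ (u : ℕ → View A) (I : ℕ → List (Marked A)) (R : ℕ → List (Σ i : Fin n, ℕ × A.Resp i)),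
    StrictMono u ∧ Set.range u = {S | ∃ r, E.Responds r S} ∧
    (∀ k, (I k).Nodup ∧ ∀ a, a ∈ I k ↔ a ∈ u k ∧ ∀ j < k, a ∉ u j) ∧
    (∀ k, (R k).Nodup ∧ ∀ r, r ∈ R k ↔ E.Responds r (u k)) ∧
    ∀ (K m : ℕ) (s : Symbol A),
      ((List.range K).flatMap fun k =>
        (I k).map (fun a => Symbol.inv a.1 a.2.2) ++
          (R k).map (fun r => Symbol.resp r.1 r.2.2))[m]? = some s → y m = s

/-- The blocks of code are wait-free: in every execution, whatever the other processes do (they may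
crash), a process that takes infinitely many steps completes infinitely many iterations. -/
def Algorithm.WaitFree (V : Algorithm P A) : Prop :=
  ∀ (E : Execution V) (p : Fin n), (E.stepTimes p).Infinite →
    {t | ∃ b, E.event t = .report p b}.Infinite

/-- The justification of a wrong verdict in `E`: a sketch of `E` is not in `L`, and it is the input
of an execution that is indistinguishable from `E`. -/
def Execution.Justified (E : Execution V) (L : Set (Word A)) : Prop :=
  ∃ y, E.IsSketch y ∧ y ∉ L ∧ ∃ E' : Execution V, E'.Fair ∧ E'.Indist E ∧ E'.HasInput y

/-- `V` predictively strongly decides `L` against the timed adversary. -/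
def Algorithm.PredStronglyDecides (V : Algorithm P A) (L : Set (Word A)) : Prop :=
  ∀ E : Execution V, E.Fair → ∃ x, E.HasInput x ∧
    (x ∈ L → (∀ p, E.numNo p = 0) ∨ ((∃ p, 0 < E.numNo p) ∧ E.Justified L)) ∧
    (x ∉ L → ∃ p, 0 < E.numNo p)

/-- `V` predictively weakly decides `L` against the timed adversary. -/
def Algorithm.PredWeaklyDecides (V : Algorithm P A) (L : Set (Word A)) : Prop :=
  ∀ E : Execution V, E.Fair → ∃ x, E.HasInput x ∧
    (x ∈ L → (∀ p, E.numNo p < ⊤) ∨ ((∃ p, E.numNo p = ⊤) ∧ E.Justified L)) ∧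
    (x ∉ L → ∀ p, E.numNo p = ⊤)

end Executions

/-- The class of predictively strongly decidable languages, for `n` processes that communicate
through shared objects of the types in `P`. -/
def PSD (n : ℕ) (P : Set SharedObject) : Set (Lang n) :=
  {L | (∀ x ∈ L.2, WellFormed x) ∧
    ∃ V : Algorithm P L.1, V.WaitFree ∧ V.PredStronglyDecides L.2}

/-- The class of predictively weakly decidable languages, for `n` processes that communicate
through shared objects of the types in `P`. -/
def PWD (n : ℕ) (P : Set SharedObject) : Set (Lang n) :=
  {L | (∀ x ∈ L.2, WellFormed x) ∧
    ∃ V : Algorithm P L.1, V.WaitFree ∧ V.PredWeaklyDecides L.2}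

end DRV

/-!
What an algorithm can know about its input is the set of *entries* of the execution: who performed
which operation, its response, and its view. Two facts make this precise. The sketches of an
execution are exactly the well-formed words whose entries, when the view of an operation consists of
the invocations that come before its response, are those of the execution
(`Execution.IsSketch.hasEntries`, `Execution.isSketch_of_hasEntries`). And each of these words is
the input of an indistinguishable execution (`Execution.exists_indist_of_hasEntries`): steps of the
code stay where they are relative to each other, and the steps of the interaction with the timed
adversary are moved to where the word wants them. Hence justifying a verdict `no` means exhibiting a
word outside of the language that has the entries of the execution.

For weak decisions there is a universal algorithm, the `collector`. With registers, every process
learns all entries in the limit, and it reports a function of what it knew at the previous report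
and of what it knows now. So weak decidability follows from a rule on finite sets of entries that
says `no` infinitely often when the input is not in the language, and finitely often when all words
with the given entries are in the language (`mem_PWD_of_rule`).

A strong decider yields such a rule. When it says `no`, some word with the same entries is not in
the language. Its first `no`, in an execution that runs the operations of a word one symbol at a
time, depends on a finite part of the word only. This finite part can be put in front of any word
that has the same entries for the operations concerned, without changing the entries of the latter
(`exists_merge`). So some finite set of entries already refutes the language, and reporting `no` as
soon as the known entries are refuting is a correct rule (`PSD_subset_PWD`).

The counter separates the classes. Its language is determined by a safety part, violations of which
show in finitely many entries, and by convergence, violations of which show in infinitely many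
operations that are not reads returning the current number of increments; this gives a rule
(`secCount_mem_PWD`). It is not strongly decidable: after a `no` on the history that consists of
increments only, the processes can go on with reads that return the total number of increments, and
then all words with the same entries are in the language (`secCount_notMem_PSD`).
-/

namespace DRV

/-! ### Enumerations of the natural numbers -/

/-- An infinite type whose elements carry distinct keys, with finitely many keys below each, is
enumerated by `ℕ` in the order of the keys. -/
theorem exists_rank {α ι : Type*} [Infinite α] [LinearOrder ι] (key : α → ι)
    (hinj : Function.Injective key) (hfin : ∀ a, {b | key b < key a}.Finite) :
    ∃ e : α ≃ ℕ, (∀ a b, e a < e b ↔ key a < key b) ∧ ∀ a, e a = {b | key b < key a}.ncard := by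
  set r : α → ℕ := fun a => {b | key b < key a}.ncard with hr
  have hlt : ∀ a b, key a < key b → r a < r b := by
    intro a b hab
    refine Set.ncard_lt_ncard ⟨fun c hc => lt_trans hc hab, fun h => ?_⟩ (hfin b)
    exact lt_irrefl _ (h (show key a < key b from hab))
  have hiff : ∀ a b, r a < r b ↔ key a < key b := by
    intro a b
    refine ⟨fun h => ?_, hlt a b⟩
    by_contra hn
    rcases (not_lt.1 hn).lt_or_eq with h' | h'
    · exact absurd (hlt _ _ h') (by omega)
    · rw [hinj h'] at h; exact lt_irrefl _ h
  have hri : Function.Injective r := by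
    intro a b hab
    by_contra hne
    rcases lt_or_gt_of_ne (fun h => hne (hinj h)) with h | h
    · exact absurd (hlt _ _ h) (by omega)
    · exact absurd (hlt _ _ h) (by omega)
  have hrs : Function.Surjective r := by
    intro N
    obtain ⟨_, ⟨a, rfl⟩, ha⟩ := (Set.infinite_range_of_injective hri).exists_gt N
    -- `r` maps the `r a` elements below `a` injectively into, hence onto, the numbers below `r a`.
    have hsub : r '' {b | key b < key a} = Set.Iio (r a) := by
      refine Set.eq_of_subset_of_ncard_le ?_ ?_ (Set.finite_Iio _)
      · rintro _ ⟨b, hb, rfl⟩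
        exact hlt b a hb
      · rw [Set.ncard_image_of_injective _ hri, Set.ncard_eq_toFinset_card']
        simp [hr]
    obtain ⟨b, -, hb⟩ : N ∈ r '' {b | key b < key a} := by rw [hsub]; exact ha
    exact ⟨b, hb⟩
  exact ⟨Equiv.ofBijective r ⟨hri, hrs⟩, hiff, fun a => rfl⟩

theorem nth_eq_of_strictMono {p : ℕ → Prop} {f : ℕ → ℕ} (hf : StrictMono f)
    (hr : ∀ t, p t ↔ ∃ k, f k = t) (k : ℕ) : Nat.nth p k = f k := by
  have hset : Set.ofPred p = Set.range f := by
    ext t; exact hr t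
  have hinf : (Set.ofPred p).Infinite := by
    rw [hset]; exact Set.infinite_range_of_injective hf.injective
  have := (StrictMono.range_inj (Nat.nth_strictMono hinf) hf).1
    (by rw [Nat.range_nth_of_infinite hinf, hset])
  rw [this]

/-- Strictly increasing sequences of times, one per process, such that no time is used by two
processes. -/
structure Interleaving {n : ℕ} (κ : Fin n → ℕ → ℕ) : Prop where
  mono : ∀ i, StrictMono (κ i)
  inj : ∀ i i' j j', κ i j = κ i' j' → i = i'

namespace Interleaving

variable {n : ℕ} {κ : Fin n → ℕ → ℕ}

theorem injective (h : Interleaving κ) : Function.Injective fun a : Fin n × ℕ => κ a.1 a.2 := by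
  rintro ⟨i, j⟩ ⟨i', j'⟩ hab
  obtain rfl : i = i' := h.inj _ _ _ _ hab
  rw [show j = j' from (h.mono i).injective hab]

theorem eq_iff (h : Interleaving κ) {i i' : Fin n} {j j' : ℕ} :
    κ i j = κ i' j' ↔ i = i' ∧ j = j' := by
  constructor
  · intro hab
    have := h.injective (a₁ := (i, j)) (a₂ := (i', j')) hab
    simpa using this
  · rintro ⟨rfl, rfl⟩; rfl

theorem finite_lt (h : Interleaving κ) (N : ℕ) : {a : Fin n × ℕ | κ a.1 a.2 < N}.Finite := by
  refine (Set.finite_univ.prod (Set.finite_Iio N)).subset ?_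
  rintro ⟨i, j⟩ (hij : κ i j < N)
  exact ⟨Set.mem_univ _, lt_of_le_of_lt (h.mono i).le_apply hij⟩

/-- Two interleavings order the pairs `(i, j)` in the same way. -/
def SameOrder (κ κ' : Fin n → ℕ → ℕ) : Prop :=
  ∀ i j i' j', κ i j < κ i' j' ↔ κ' i j < κ' i' j'

/-- Pairs with distinct keys that increase along each process are enumerated without gaps in the
order of their keys. -/
theorem exists_of_key [NeZero n] {ι : Type*} [LinearOrder ι] (key : Fin n → ℕ → ι)
    (hmono : ∀ i, StrictMono (key i)) (hinj : ∀ i i' j j', key i j = key i' j' → i = i')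
    (hfin : ∀ i j, {b : Fin n × ℕ | key b.1 b.2 < key i j}.Finite) :
    ∃ P : Fin n → ℕ → ℕ, Interleaving P ∧ (∀ t, ∃ i j, P i j = t) ∧
      (∀ i j i' j', P i j < P i' j' ↔ key i j < key i' j') ∧
      ∀ i j, P i j = {b : Fin n × ℕ | key b.1 b.2 < key i j}.ncard := by
  obtain ⟨e, he, hn⟩ := exists_rank (fun a : Fin n × ℕ => key a.1 a.2)
    (by
      rintro ⟨i, j⟩ ⟨i', j'⟩ hab
      obtain rfl : i = i' := hinj _ _ _ _ hab
      rw [show j = j' from (hmono i).injective hab])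
    (fun a => hfin a.1 a.2)
  refine ⟨fun i j => e (i, j), ⟨fun i j j' h => (he _ _).2 (hmono i h), fun i i' j j' h => ?_⟩,
    fun t => ⟨(e.symm t).1, (e.symm t).2, by simp⟩, fun i j i' j' => he _ _, fun i j => hn _⟩
  have := e.injective h
  simp at this
  exact this.1

/-- The times of an interleaving can be renumbered without gaps. -/
theorem exists_compress [NeZero n] (h : Interleaving κ) :
    ∃ P : Fin n → ℕ → ℕ, Interleaving P ∧ (∀ t, ∃ i j, P i j = t) ∧ SameOrder P κ := by
  obtain ⟨P, h1, h2, h3, -⟩ := exists_of_key κ h.mono h.inj (fun i j => h.finite_lt _)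
  exact ⟨P, h1, h2, h3⟩

end Interleaving

/-! ### Well-formed words and their entries -/

section Words

variable {n : ℕ} {A : DistAlphabet n}

/-- The `k`-th operation of process `i` in the word `y` has invocation `v i k` at position
`P i (2 * k)` and response `w i k` at position `P i (2 * k + 1)`. -/
structure Presents (y : Word A) (P : Fin n → ℕ → ℕ) (v : ∀ i, ℕ → A.Inv i)
    (w : ∀ i, ℕ → A.Resp i) : Prop where
  il : Interleaving P
  surj : ∀ t, ∃ i j, P i j = t
  inv : ∀ i k, y (P i (2 * k)) = .inv i (v i k)
  resp : ∀ i k, y (P i (2 * k + 1)) = .resp i (w i k)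

/-- The order of operations that matters for views: the invocation of `a` comes before the response
of `b`. -/
def Sees (P : Fin n → ℕ → ℕ) (a b : OpId n) : Prop := P a.1 (2 * a.2) < P b.1 (2 * b.2 + 1)

/-- A response, with the process and the index of its operation, and the view of that operation. -/
abbrev Entry (A : DistAlphabet n) : Type := (Σ i : Fin n, ℕ × A.Resp i) × View A

/-- The entry of the operation `o`, where `r a o` says that `a` is in the view of `o`. -/
def entry (v : ∀ i, ℕ → A.Inv i) (w : ∀ i, ℕ → A.Resp i) (r : OpId n → OpId n → Prop)
    (o : OpId n) : Entry A :=
  (⟨o.1, o.2, w o.1 o.2⟩, {m | ∃ a, r a o ∧ m = ⟨a.1, a.2, v a.1 a.2⟩})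

/-- The entries of all operations. -/
def entries (v : ∀ i, ℕ → A.Inv i) (w : ∀ i, ℕ → A.Resp i) (r : OpId n → OpId n → Prop) :
    Set (Entry A) :=
  Set.range (entry v w r)

theorem mark_mem_entry {v : ∀ i, ℕ → A.Inv i} {w : ∀ i, ℕ → A.Resp i} {r : OpId n → OpId n → Prop}
    {o : OpId n} {i : Fin n} {k : ℕ} {b : A.Inv i} :
    (⟨i, k, b⟩ : Marked A) ∈ (entry v w r o).2 ↔ r (i, k) o ∧ b = v i k := by
  constructor
  · rintro ⟨⟨i', k'⟩, hr, h⟩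
    simp only [Sigma.mk.injEq] at h
    obtain ⟨rfl, h⟩ := h
    simp only [heq_eq_eq, Prod.mk.injEq] at h
    obtain ⟨rfl, rfl⟩ := h
    exact ⟨hr, rfl⟩
  · rintro ⟨hr, rfl⟩
    exact ⟨(i, k), hr, rfl⟩

theorem entry_eq_of_mem_entries {v v' : ∀ i, ℕ → A.Inv i} {w w' : ∀ i, ℕ → A.Resp i}
    {r r' : OpId n → OpId n → Prop} {o : OpId n} (h : entry v w r o ∈ entries v' w' r') :
    entry v' w' r' o = entry v w r o := by
  obtain ⟨o', h⟩ := h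
  have h1 := congrArg Prod.fst h
  obtain ⟨i, k⟩ := o
  obtain ⟨i', k'⟩ := o'
  simp only [entry, Sigma.mk.injEq] at h1
  obtain ⟨rfl, h1⟩ := h1
  simp only [heq_eq_eq, Prod.mk.injEq] at h1
  obtain ⟨rfl, -⟩ := h1
  exact h

theorem resp_eq_of_entry_eq {v v' : ∀ i, ℕ → A.Inv i} {w w' : ∀ i, ℕ → A.Resp i}
    {r r' : OpId n → OpId n → Prop} {o : OpId n} (h : entry v' w' r' o = entry v w r o) :
    w' o.1 o.2 = w o.1 o.2 := by
  have h1 := congrArg Prod.fst h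
  simpa [entry] using h1

theorem rel_iff_of_entry_eq {v v' : ∀ i, ℕ → A.Inv i} {w w' : ∀ i, ℕ → A.Resp i}
    {r r' : OpId n → OpId n → Prop} {o : OpId n} (h : entry v' w' r' o = entry v w r o)
    (a : OpId n) : r' a o ↔ r a o := by
  constructor
  · intro ha
    have : (⟨a.1, a.2, v' a.1 a.2⟩ : Marked A) ∈ (entry v' w' r' o).2 := ⟨a, ha, rfl⟩
    rw [h, mark_mem_entry] at this
    exact this.1
  · intro ha
    have : (⟨a.1, a.2, v a.1 a.2⟩ : Marked A) ∈ (entry v w r o).2 := ⟨a, ha, rfl⟩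
    rw [← h, mark_mem_entry] at this
    exact this.1

theorem inv_eq_of_entry_eq {v v' : ∀ i, ℕ → A.Inv i} {w w' : ∀ i, ℕ → A.Resp i}
    {r r' : OpId n → OpId n → Prop} {o a : OpId n} (h : entry v' w' r' o = entry v w r o)
    (ha : r a o) : v' a.1 a.2 = v a.1 a.2 := by
  have : (⟨a.1, a.2, v a.1 a.2⟩ : Marked A) ∈ (entry v w r o).2 := ⟨a, ha, rfl⟩
  rw [← h, mark_mem_entry] at this
  exact this.2.symm

/-- The entries determine the invocations, the responses and the views. -/
theorem entries_inj {v v' : ∀ i, ℕ → A.Inv i} {w w' : ∀ i, ℕ → A.Resp i}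
    {r r' : OpId n → OpId n → Prop} (hr : ∀ o, r o o) (h : entries v' w' r' = entries v w r) :
    v' = v ∧ w' = w ∧ r' = r := by
  have he : ∀ o, entry v' w' r' o = entry v w r o := fun o =>
    entry_eq_of_mem_entries (by rw [h]; exact ⟨o, rfl⟩)
  refine ⟨?_, ?_, ?_⟩
  · funext i k; exact inv_eq_of_entry_eq (he (i, k)) (hr (i, k))
  · funext i k; exact resp_eq_of_entry_eq (he (i, k))
  · funext a o; exact propext (rel_iff_of_entry_eq (he o) a)

/-- `z` is a well-formed word whose operations have the entries `D`, when the view of an operation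
consists of the invocations that come before its response. -/
def HasEntries (z : Word A) (D : Set (Entry A)) : Prop :=
  ∃ P v w, Presents z P v w ∧ D = entries v w (Sees P)

theorem Sees.refl {P : Fin n → ℕ → ℕ} (h : Interleaving P) (o : OpId n) : Sees P o o :=
  h.mono _ (by omega)

theorem Sees.trans_le {P : Fin n → ℕ → ℕ} (h : Interleaving P) {a : OpId n} {i : Fin n} {k l : ℕ}
    (ha : Sees P a (i, k)) (hkl : k ≤ l) : Sees P a (i, l) :=
  lt_of_lt_of_le ha ((h.mono i).monotone (by simp; omega))

theorem HasEntries.presents {z : Word A} {v : ∀ i, ℕ → A.Inv i} {w : ∀ i, ℕ → A.Resp i}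
    {r : OpId n → OpId n → Prop} (h : HasEntries z (entries v w r)) :
    ∃ P, Presents z P v w ∧ Sees P = r := by
  obtain ⟨P, v', w', h1, h2⟩ := h
  obtain ⟨rfl, rfl, rfl⟩ := entries_inj (Sees.refl h1.il) h2
  exact ⟨P, h1, rfl⟩

namespace Presents

variable {y : Word A} {P : Fin n → ℕ → ℕ} {v : ∀ i, ℕ → A.Inv i} {w : ∀ i, ℕ → A.Resp i}

theorem proc_eq (h : Presents y P v w) (i : Fin n) (j : ℕ) : (y (P i j)).proc = i := by
  obtain ⟨k, rfl | rfl⟩ := Nat.even_or_odd' j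
  · rw [h.inv]; rfl
  · rw [h.resp]; rfl

theorem proc_iff (h : Presents y P v w) (i : Fin n) (t : ℕ) :
    (y t).proc = i ↔ ∃ j, P i j = t := by
  constructor
  · rintro rfl
    obtain ⟨i, j, rfl⟩ := h.surj t
    exact ⟨j, by rw [h.proc_eq]⟩
  · rintro ⟨j, rfl⟩; exact h.proc_eq i j

theorem count_eq (h : Presents y P v w) (i : Fin n) (j : ℕ) :
    Nat.count (fun s => (y s).proc = i) (P i j) = j := by
  have hn := nth_eq_of_strictMono (h.il.mono i) (h.proc_iff i)
  rw [← hn j, Nat.count_nth_of_infinite]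
  have : Set.ofPred (fun s => (y s).proc = i) = Set.range (P i) := by
    ext t; exact h.proc_iff i t
  rw [this]
  exact Set.infinite_range_of_injective (h.il.mono i).injective

theorem wellFormed (h : Presents y P v w) : WellFormed y := by
  refine ⟨fun i => ?_, fun t => ?_⟩
  · have : {t | (y t).proc = i} = Set.range (P i) := by
      ext t; exact h.proc_iff i t
    rw [this]
    exact Set.infinite_range_of_injective (h.il.mono i).injective
  · obtain ⟨i, j, rfl⟩ := h.surj t
    rw [h.proc_eq, h.count_eq]
    obtain ⟨k, rfl | rfl⟩ := Nat.even_or_odd' j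
    · rw [h.inv]; simp [Symbol.IsInv]
    · rw [h.resp]; simp [Symbol.IsInv]

theorem inv_iff (h : Presents y P v w) (i : Fin n) (t : ℕ) :
    (∃ b, y t = .inv i b) ↔ ∃ k, P i (2 * k) = t := by
  constructor
  · rintro ⟨b, hb⟩
    obtain ⟨j, rfl⟩ := (h.proc_iff i t).1 (by rw [hb]; rfl)
    obtain ⟨k, rfl | rfl⟩ := Nat.even_or_odd' j
    · exact ⟨k, rfl⟩
    · rw [h.resp] at hb; cases hb
  · rintro ⟨k, rfl⟩; exact ⟨_, h.inv i k⟩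

theorem resp_iff (h : Presents y P v w) (i : Fin n) (t : ℕ) :
    (∃ b, y t = .resp i b) ↔ ∃ k, P i (2 * k + 1) = t := by
  constructor
  · rintro ⟨b, hb⟩
    obtain ⟨j, rfl⟩ := (h.proc_iff i t).1 (by rw [hb]; rfl)
    obtain ⟨k, rfl | rfl⟩ := Nat.even_or_odd' j
    · rw [h.inv] at hb; cases hb
    · exact ⟨k, rfl⟩
  · rintro ⟨k, rfl⟩; exact ⟨_, h.resp i k⟩

theorem invPos_eq (h : Presents y P v w) (o : OpId n) : invPos y o = P o.1 (2 * o.2) :=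
  nth_eq_of_strictMono (f := fun k => P o.1 (2 * k)) (fun a b hab => h.il.mono _ (by omega))
    (h.inv_iff o.1) o.2

theorem respPos_eq (h : Presents y P v w) (o : OpId n) : respPos y o = P o.1 (2 * o.2 + 1) :=
  nth_eq_of_strictMono (f := fun k => P o.1 (2 * k + 1)) (fun a b hab => h.il.mono _ (by omega))
    (h.resp_iff o.1) o.2

end Presents

/-- Any positions, invocations and responses are those of some word. -/
theorem exists_presents {P : Fin n → ℕ → ℕ} (h : Interleaving P) (hs : ∀ t, ∃ i j, P i j = t)
    (v : ∀ i, ℕ → A.Inv i) (w : ∀ i, ℕ → A.Resp i) : ∃ y : Word A, Presents y P v w := by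
  choose p q hpq using hs
  have hp : ∀ i j, p (P i j) = i ∧ q (P i j) = j := fun i j => h.eq_iff.1 (hpq (P i j))
  refine ⟨fun t => if q t % 2 = 0 then .inv (p t) (v (p t) (q t / 2))
    else .resp (p t) (w (p t) (q t / 2)), h, fun t => ⟨_, _, hpq t⟩, fun i k => ?_, fun i k => ?_⟩
  · obtain ⟨h1, h2⟩ := hp i (2 * k)
    rw [h2, h1]; simp
  · obtain ⟨h1, h2⟩ := hp i (2 * k + 1)
    rw [h2, h1]
    simp only [Nat.mul_add_mod_self_left, Nat.mod_succ, one_ne_zero, if_false]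
    congr 2; omega

/-- A word `z` whose entries include those of the first operations of `y` can be reordered, without
changing its entries, so that it begins like `y`. -/
theorem exists_merge [NeZero n] {y z : Word A} {P Q : Fin n → ℕ → ℕ} {v v' : ∀ i, ℕ → A.Inv i}
    {w w' : ∀ i, ℕ → A.Resp i} (hy : Presents y P v w) (hz : Presents z Q v' w') (m : ℕ)
    (hD : ∀ o : OpId n, o.2 ≤ m → entry v w (Sees P) o ∈ entries v' w' (Sees Q)) :
    ∃ (z' : Word A) (R : Fin n → ℕ → ℕ), Presents z' R v' w' ∧ Sees R = Sees Q ∧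
      ∀ t < m, z' t = y t := by
  have hE : ∀ o : OpId n, o.2 ≤ m → entry v' w' (Sees Q) o = entry v w (Sees P) o :=
    fun o ho => entry_eq_of_mem_entries (hD o ho)
  -- the symbols at the first `m` positions of `y` in their order there, then all others in their
  -- order in `z`
  set key : Fin n → ℕ → ℕ ×ₗ ℕ := fun i j =>
    if P i j < m then toLex (0, P i j) else toLex (1, Q i j) with hkey
  have key_early : ∀ {i j}, P i j < m → key i j = toLex (0, P i j) := fun h => if_pos h
  have key_late : ∀ {i j}, ¬ P i j < m → key i j = toLex (1, Q i j) := fun h => if_neg h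
  have hlt : ∀ i j i' j', key i j < key i' j' ↔
      (P i j < m ∧ (P i' j' < m → P i j < P i' j')) ∨ (¬ P i j < m ∧ ¬ P i' j' < m ∧
        Q i j < Q i' j') := by
    intro i j i' j'
    by_cases h1 : P i j < m <;> by_cases h2 : P i' j' < m <;>
      simp [hkey, h1, h2, Prod.Lex.toLex_lt_toLex]
  have hmono : ∀ i, StrictMono (key i) := by
    intro i j j' hj
    have h1 := hy.il.mono i hj
    have h2 := hz.il.mono i hj
    rw [hlt]
    by_cases h : P i j < m
    · exact Or.inl ⟨h, fun _ => h1⟩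
    · exact Or.inr ⟨h, by omega, h2⟩
  have hinj : ∀ i i' j j', key i j = key i' j' → i = i' := by
    intro i i' j j' h
    by_cases h1 : P i j < m <;> by_cases h2 : P i' j' < m <;> simp [hkey, h1, h2] at h
    · exact hy.il.inj _ _ _ _ h
    · exact hz.il.inj _ _ _ _ h
  have hfin : ∀ i j, {b : Fin n × ℕ | key b.1 b.2 < key i j}.Finite := by
    intro i j
    refine ((hy.il.finite_lt m).union (hz.il.finite_lt (Q i j))).subset ?_
    intro b hb
    rcases (hlt _ _ _ _).1 hb with h | h
    · exact Or.inl h.1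
    · exact Or.inr h.2.2
  obtain ⟨R, hR, hRs, hRlt, hRn⟩ := Interleaving.exists_of_key key hmono hinj hfin
  obtain ⟨z', hz'⟩ := exists_presents hR hRs v' w'
  have hRP : ∀ i j, P i j < m → R i j = P i j := by
    intro i j h
    rw [hRn]
    have : (fun b : Fin n × ℕ => P b.1 b.2) '' {b : Fin n × ℕ | key b.1 b.2 < key i j}
        = Set.Iio (P i j) := by
      ext t
      constructor
      · rintro ⟨b, hb, rfl⟩
        rcases (hlt _ _ _ _).1 hb with h' | h'
        · exact h'.2 h
        · exact absurd h h'.2.1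
      · intro ht
        obtain ⟨i', j', rfl⟩ := hy.surj t
        exact ⟨(i', j'), (hlt _ _ _ _).2 (Or.inl ⟨lt_trans ht h, fun _ => ht⟩), rfl⟩
    rw [← Set.ncard_image_of_injective _ hy.il.injective, this, Set.ncard_eq_toFinset_card']
    simp
  have hle : ∀ i j, j ≤ P i j := fun i j => (hy.il.mono i).le_apply
  refine ⟨z', R, hz', ?_, ?_⟩
  · funext a o
    obtain ⟨j, l⟩ := a
    obtain ⟨i, k⟩ := o
    apply propext
    show R j (2 * l) < R i (2 * k + 1) ↔ _
    rw [hRlt, hlt]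
    by_cases ho : P i (2 * k + 1) < m
    -- both orders are those of `y`, because the entry of `(i, k)` is the same in `y` and `z`
    · have hk : k ≤ m := by have := hle i (2 * k + 1); omega
      rw [rel_iff_of_entry_eq (hE (i, k) hk) (j, l)]
      show _ ↔ P j (2 * l) < P i (2 * k + 1)
      simp only [ho, not_true_eq_false, false_and, and_false, or_false]
      constructor
      · rintro ⟨-, h⟩; exact h trivial
      · intro h; exact ⟨by omega, fun _ => h⟩
    · by_cases ha : P j (2 * l) < m
      · simp only [ha, ho, false_imp_iff, and_true, true_iff, true_or]
        -- in `y`, the operation `(j, l)` is seen by an early operation of process `i`, hence in `z`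
        have hsee : Sees P (j, l) (i, min k m) := by
          show P j (2 * l) < P i (2 * min k m + 1)
          rcases le_total k m with h | h
          · rw [min_eq_left h]; omega
          · rw [min_eq_right h]; have := hle i (2 * m + 1); omega
        have := (rel_iff_of_entry_eq (hE (i, min k m) (min_le_right _ _)) (j, l)).2 hsee
        exact Sees.trans_le hz.il this (min_le_left _ _)
      · simp [ha, ho, Sees]
  · intro t ht
    obtain ⟨i, j, rfl⟩ := hy.surj t
    rw [← hRP i j ht]
    obtain ⟨k, rfl | rfl⟩ := Nat.even_or_odd' j
    · have hk : k ≤ m := by have := hle i (2 * k); omega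
      rw [hz'.inv, hRP _ _ ht, hy.inv]
      congr 1
      exact inv_eq_of_entry_eq (hE (i, k) hk) (Sees.refl hy.il _)
    · have hk : k ≤ m := by have := hle i (2 * k + 1); omega
      rw [hz'.resp, hRP _ _ ht, hy.resp]
      congr 1
      exact resp_eq_of_entry_eq (hE (i, k) hk)

end Words

/-! ### Levels: the progress of a process in its interaction with the timed adversary -/

section Levels

variable {n : ℕ} {P : Set SharedObject} {A : DistAlphabet n}

/-- How far the current interaction with the timed adversary has come: not started, sent,
announced, snapshot taken. -/
def Phase.stage {i : Fin n} : Phase A i → ℕ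
  | .choose => 0
  | .before _ => 0
  | .invoked _ => 1
  | .announced _ => 2
  | .forwarded _ => 2
  | .replied _ _ => 2
  | .viewed _ _ _ => 3
  | .after => 0

theorem Phase.stage_lt {i : Fin n} (p : Phase A i) : p.stage < 4 := by
  cases p <;> simp [Phase.stage]

variable {V : Algorithm P A}

/-- The number of invocations, announcements, snapshots and responses of a process so far. -/
def LocalState.level {i : Fin n} (l : LocalState V i) : ℕ := 4 * l.count + l.phase.stage

/-- What a step of process `i` does to its interaction with the timed adversary. Here `l` and `l'`
are the local states before and after the step, `a` and `a'` are the contents of entry `i` of the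
array of announcements, and `U` is the union of all entries. -/
inductive StepKind (i : Fin n) (l l' : LocalState V i) (a a' U : View A) : Event A → Prop
  | code (e : Event A) (hp : e.proc = i) (hs : e.symbol = none) (h0 : l.phase.stage = 0)
      (h1 : l'.phase.stage = 0) (hc : l'.count = l.count) (hsent : l'.sent = l.sent) (ha : a' = a) :
      StepKind i l l' a a' U e
  | wait (h0 : l.phase.stage = 2) (h1 : l'.phase.stage = 2) (hc : l'.count = l.count)
      (hsent : l'.sent = l.sent) (ha : a' = a) : StepKind i l l' a a' U (.internal i)
  | invoke (v : A.Inv i) (h0 : l.phase = .before v) (h1 : l'.phase.stage = 1)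
      (hc : l'.count = l.count) (hsent : l'.sent = l.sent ∪ {⟨i, l.count, v⟩}) (ha : a' = a) :
      StepKind i l l' a a' U (.invoke i l.count v)
  | announce (h0 : l.phase.stage = 1) (h1 : l'.phase.stage = 2)
      (hc : l'.count = l.count) (hsent : l'.sent = l.sent) (ha : a' = l.sent) :
      StepKind i l l' a a' U (.internal i)
  | snapshot (v : A.Inv i) (w : A.Resp i) (h0 : l.phase = .replied v w)
      (h1 : l'.phase = .viewed v w U) (hc : l'.count = l.count) (hsent : l'.sent = l.sent)
      (ha : a' = a) : StepKind i l l' a a' U (.internal i)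
  | respond (v : A.Inv i) (w : A.Resp i) (S : View A) (h0 : l.phase = .viewed v w S)
      (h1 : l'.phase.stage = 0) (hc : l'.count = l.count + 1) (hsent : l'.sent = l.sent)
      (ha : a' = a) : StepKind i l l' a a' U (.respond i l.count w S)

theorem Step.kind {C C' : Config V} {e : Event A} (h : Step V C e C') :
    StepKind e.proc (C.loc e.proc) (C'.loc e.proc) (C.ann e.proc) (C'.ann e.proc) (⋃ j, C.ann j)
      e := by
  cases h with
  | pick i v h =>
    exact .code _ rfl rfl (congrArg Phase.stage h) (by simp [Event.proc, Config.setLoc, Phase.stage])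
      (by simp [Event.proc, Config.setLoc]) (by simp [Event.proc, Config.setLoc]) rfl
  | preAccess i v c op next h h' =>
    exact .code _ rfl rfl (congrArg Phase.stage h)
      (by simp [Event.proc, Config.setLoc, Config.applyOp, h, Phase.stage])
      (by simp [Event.proc, Config.setLoc, Config.applyOp])
      (by simp [Event.proc, Config.setLoc, Config.applyOp]) rfl
  | invoke i v h h' =>
    exact .invoke v h (by simp [Event.proc, Config.setLoc, Phase.stage])
      (by simp [Event.proc, Config.setLoc]) (by simp [Event.proc, Config.setLoc]) rfl
  | announce i v h =>
    exact .announce (congrArg Phase.stage h) (by simp [Event.proc, Config.setLoc, Phase.stage])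
      (by simp [Event.proc, Config.setLoc]) (by simp [Event.proc, Config.setLoc])
      (by simp [Event.proc, Config.setLoc])
  | forward i v h =>
    exact .wait (congrArg Phase.stage h) (by simp [Event.proc, Config.setLoc, Phase.stage])
      (by simp [Event.proc, Config.setLoc]) (by simp [Event.proc, Config.setLoc]) rfl
  | reply i v w h =>
    exact .wait (congrArg Phase.stage h) (by simp [Event.proc, Config.setLoc, Phase.stage])
      (by simp [Event.proc, Config.setLoc]) (by simp [Event.proc, Config.setLoc]) rfl
  | snapshot i v w h =>
    exact .snapshot v w h (by simp [Event.proc, Config.setLoc]) (by simp [Event.proc, Config.setLoc])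
      (by simp [Event.proc, Config.setLoc]) rfl
  | respond i v w S h =>
    exact .respond v w S h (by simp [Event.proc, Config.setLoc, Phase.stage])
      (by simp [Event.proc, Config.setLoc]) (by simp [Event.proc, Config.setLoc]) rfl
  | postAccess i c op next h h' =>
    exact .code _ rfl rfl (congrArg Phase.stage h)
      (by simp [Event.proc, Config.setLoc, Config.applyOp, h, Phase.stage])
      (by simp [Event.proc, Config.setLoc, Config.applyOp])
      (by simp [Event.proc, Config.setLoc, Config.applyOp]) rfl
  | report i b s h h' =>
    exact .code _ rfl rfl (congrArg Phase.stage h) (by simp [Event.proc, Config.setLoc, Phase.stage])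
      (by simp [Event.proc, Config.setLoc]) (by simp [Event.proc, Config.setLoc]) rfl

theorem Step.loc_of_ne {C C' : Config V} {e : Event A} (h : Step V C e C') {j : Fin n}
    (hj : e.proc ≠ j) : C'.loc j = C.loc j := by
  cases h <;> exact Function.update_of_ne (Ne.symm hj) _ _

theorem Step.ann_of_ne {C C' : Config V} {e : Event A} (h : Step V C e C') {j : Fin n}
    (hj : e.proc ≠ j) : C'.ann j = C.ann j := by
  cases h <;> first | rfl | exact Function.update_of_ne (Ne.symm hj) _ _

namespace Execution

/-- The level of process `i` at time `t`. -/
def level (E : Execution V) (i : Fin n) (t : ℕ) : ℕ := ((E.conf t).loc i).level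

variable (E : Execution V)

theorem loc_succ_of_ne {i : Fin n} {t : ℕ} (h : (E.event t).proc ≠ i) :
    (E.conf (t + 1)).loc i = (E.conf t).loc i := (E.step t).loc_of_ne h

theorem kind {i : Fin n} {t : ℕ} (h : (E.event t).proc = i) :
    StepKind i ((E.conf t).loc i) ((E.conf (t + 1)).loc i) ((E.conf t).ann i)
      ((E.conf (t + 1)).ann i) (⋃ j, (E.conf t).ann j) (E.event t) := by
  subst h; exact (E.step t).kind

theorem level_zero (i : Fin n) : E.level i 0 = 0 := by
  simp [level, E.conf_zero, Config.initial, LocalState.level, Phase.stage]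

theorem level_succ (i : Fin n) (t : ℕ) :
    E.level i (t + 1) = E.level i t ∨
      ((E.event t).proc = i ∧ E.level i (t + 1) = E.level i t + 1) := by
  by_cases h : (E.event t).proc = i
  · have hk := E.kind h
    unfold level LocalState.level
    generalize E.event t = e at h hk
    cases hk with
    | code _ _ _ h0 h1 hc => left; omega
    | wait h0 h1 hc => left; omega
    | invoke v h0 h1 hc =>
      have h2 : ((E.conf t).loc i).phase.stage = 0 := congrArg Phase.stage h0
      exact Or.inr ⟨rfl, by omega⟩
    | announce h0 h1 hc => right; exact ⟨rfl, by omega⟩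
    | snapshot v w h0 h1 hc =>
      have h2 : ((E.conf t).loc i).phase.stage = 2 := congrArg Phase.stage h0
      have h3 : ((E.conf (t + 1)).loc i).phase.stage = 3 := congrArg Phase.stage h1
      exact Or.inr ⟨rfl, by omega⟩
    | respond v w S h0 h1 hc =>
      have h2 : ((E.conf t).loc i).phase.stage = 3 := congrArg Phase.stage h0
      exact Or.inr ⟨rfl, by omega⟩
  · left; unfold level; rw [E.loc_succ_of_ne h]

theorem level_mono (i : Fin n) : Monotone (E.level i) :=
  monotone_nat_of_le_succ fun t => by rcases E.level_succ i t with h | h <;> omega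

theorem level_le (i : Fin n) (t : ℕ) : E.level i t ≤ t := by
  induction t with
  | zero => rw [E.level_zero]
  | succ t ih => rcases E.level_succ i t with h | h <;> omega

theorem count_eq (i : Fin n) (t : ℕ) : ((E.conf t).loc i).count = E.level i t / 4 := by
  have := ((E.conf t).loc i).phase.stage_lt
  unfold level LocalState.level; omega

theorem stage_eq (i : Fin n) (t : ℕ) : ((E.conf t).loc i).phase.stage = E.level i t % 4 := by
  have := ((E.conf t).loc i).phase.stage_lt
  unfold level LocalState.level; omega

/-- Blocks of code that are wait-free let the interactions go on: a process whose level does not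
change stays, after a report, in the block that precedes the interaction, and does not report again.
-/
theorem level_unbounded (hV : V.WaitFree) {i : Fin n} (hi : (E.stepTimes i).Infinite) (j : ℕ) :
    ∃ t, j < E.level i t := by
  by_contra hb
  push Not at hb
  obtain ⟨t0, ht0⟩ : ∃ t0, ∀ t, t0 ≤ t → E.level i t = E.level i t0 := by
    obtain ⟨N, ⟨t0, rfl⟩, hN⟩ := Set.exists_max_image (Set.range (E.level i)) id
      ((Set.finite_Iic j).subset (by rintro _ ⟨t, rfl⟩; exact hb t)) ⟨_, 0, rfl⟩
    exact ⟨t0, fun t ht => le_antisymm (hN _ ⟨t, rfl⟩) (E.level_mono i ht)⟩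
  have hinf := hV E i hi
  obtain ⟨t1, ⟨b1, h1⟩, ht1⟩ := hinf.exists_gt t0
  obtain ⟨t2, ⟨b2, h2⟩, ht2⟩ := hinf.exists_gt t1
  have key : ∀ t, t1 + 1 ≤ t → ((E.conf t).loc i).phase = .choose ∨
      ∃ v, ((E.conf t).loc i).phase = .before v := by
    intro t ht
    induction t, ht using Nat.le_induction with
    | base =>
      left
      have hs := E.step t1
      rw [h1] at hs
      generalize E.conf (t1 + 1) = C' at hs
      cases hs
      simp [Config.setLoc]
    | succ t ht ih =>
      by_cases hp : (E.event t).proc = i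
      · have hl : E.level i (t + 1) = E.level i t := by
          rw [ht0 t (by omega), ht0 (t + 1) (by omega)]
        have hs := E.step t
        unfold level at hl
        generalize E.conf (t + 1) = C' at hs hl
        generalize E.event t = e at hs hp
        generalize E.conf t = C at hs hl ih
        cases hs with
        | pick i' v h =>
          obtain rfl : i' = i := hp
          exact Or.inr ⟨v, by simp [Config.setLoc]⟩
        | preAccess i' v c op next h =>
          obtain rfl : i' = i := hp
          exact Or.inr ⟨v, by simp [Config.setLoc, h]⟩
        | invoke i' v h =>
          obtain rfl : i' = i := hp
          simp [LocalState.level, Config.setLoc, h, Phase.stage] at hl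
        | announce i' v h =>
          obtain rfl : i' = i := hp
          rcases ih with ih | ⟨_, ih⟩ <;> rw [h] at ih <;> cases ih
        | forward i' v h =>
          obtain rfl : i' = i := hp
          rcases ih with ih | ⟨_, ih⟩ <;> rw [h] at ih <;> cases ih
        | reply i' v w h =>
          obtain rfl : i' = i := hp
          rcases ih with ih | ⟨_, ih⟩ <;> rw [h] at ih <;> cases ih
        | snapshot i' v w h =>
          obtain rfl : i' = i := hp
          rcases ih with ih | ⟨_, ih⟩ <;> rw [h] at ih <;> cases ih
        | respond i' v w S h =>
          obtain rfl : i' = i := hp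
          rcases ih with ih | ⟨_, ih⟩ <;> rw [h] at ih <;> cases ih
        | postAccess i' c op next h =>
          obtain rfl : i' = i := hp
          rcases ih with ih | ⟨_, ih⟩ <;> rw [h] at ih <;> cases ih
        | report i' b s h =>
          obtain rfl : i' = i := hp
          rcases ih with ih | ⟨_, ih⟩ <;> rw [h] at ih <;> cases ih
      · rw [E.loc_succ_of_ne hp]; exact ih
  have hs := E.step t2
  rw [h2] at hs
  have hk := key t2 ht2
  generalize E.conf (t2 + 1) = C' at hs
  cases hs with
  | report _ _ _ h => rcases hk with hk | ⟨v, hk⟩ <;> rw [h] at hk <;> cases hk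

/-- Every process completes infinitely many interactions. -/
def Live : Prop := ∀ i j, ∃ t, j < E.level i t

theorem live (hV : V.WaitFree) (hE : E.Fair) : E.Live := fun i => E.level_unbounded hV (hE i)

/-- The time at which process `i` passes from level `j` to level `j + 1`. -/
noncomputable def passTime (i : Fin n) (j : ℕ) : ℕ := sInf {t | j < E.level i (t + 1)}

variable {E}

theorem passTime_lt_iff (h : E.Live) {i : Fin n} {j t : ℕ} :
    E.passTime i j < t ↔ j < E.level i t := by
  constructor
  · intro hlt
    obtain ⟨t', ht'⟩ := h i j
    have hne : {t | j < E.level i (t + 1)}.Nonempty := ⟨t', lt_of_lt_of_le ht'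
      (E.level_mono i (by omega))⟩
    have : j < E.level i (E.passTime i j + 1) := Nat.sInf_mem hne
    exact lt_of_lt_of_le this (E.level_mono i hlt)
  · intro hj
    cases t with
    | zero => rw [E.level_zero] at hj; omega
    | succ t => exact Nat.lt_succ_of_le (Nat.sInf_le hj)

theorem level_passTime (h : E.Live) (i : Fin n) (j : ℕ) : E.level i (E.passTime i j) = j := by
  have h1 : ¬ j < E.level i (E.passTime i j) := fun hc => lt_irrefl _ ((passTime_lt_iff h).2 hc)
  have h2 : j < E.level i (E.passTime i j + 1) := (passTime_lt_iff h).1 (by omega)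
  rcases E.level_succ i (E.passTime i j) with h3 | h3 <;> omega

theorem level_passTime_succ (h : E.Live) (i : Fin n) (j : ℕ) :
    E.level i (E.passTime i j + 1) = j + 1 := by
  have h1 := level_passTime h i j
  have h2 : j < E.level i (E.passTime i j + 1) := (passTime_lt_iff h).1 (by omega)
  rcases E.level_succ i (E.passTime i j) with h3 | h3 <;> omega

theorem proc_passTime (h : E.Live) (i : Fin n) (j : ℕ) :
    (E.event (E.passTime i j)).proc = i := by
  have h1 := level_passTime h i j
  have h2 := level_passTime_succ h i j
  rcases E.level_succ i (E.passTime i j) with h3 | h3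
  · omega
  · exact h3.1

theorem eq_passTime (h : E.Live) {i : Fin n} {t : ℕ} (ht : E.level i (t + 1) = E.level i t + 1) :
    E.passTime i (E.level i t) = t := by
  have h1 : E.passTime i (E.level i t) < t + 1 := (passTime_lt_iff h).2 (by omega)
  have h2 : ¬ E.passTime i (E.level i t) < t := fun hc => by
    have := (passTime_lt_iff h).1 hc; omega
  omega

theorem interleaving_passTime (h : E.Live) : Interleaving E.passTime := by
  refine ⟨fun i j j' hj => ?_, fun i i' j j' hij => ?_⟩
  · rw [passTime_lt_iff h, level_passTime h]; exact hj
  · rw [← proc_passTime h i j, hij, proc_passTime h]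

end Execution

/-- The operation `a` is announced before the snapshot of the operation `b` is taken, when process
`i` passes level `j` at time `μ i j`. -/
def AnnouncedFor (μ : Fin n → ℕ → ℕ) (a b : OpId n) : Prop :=
  μ a.1 (4 * a.2 + 1) < μ b.1 (4 * b.2 + 2)

/-- The visible events of `E`: process `i` passes level `j` at time `μ i j`, its `k`-th operation
has invocation `v i k` and response `w i k`, and the view consists of the invocations that are
announced before its snapshot. -/
structure Execution.Trace (E : Execution V) (μ : Fin n → ℕ → ℕ) (v : ∀ i, ℕ → A.Inv i)
    (w : ∀ i, ℕ → A.Resp i) : Prop where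
  il : Interleaving μ
  inv : ∀ i k, E.event (μ i (4 * k)) = .invoke i k (v i k)
  resp : ∀ i k, E.event (μ i (4 * k + 3)) =
    .respond i k (w i k) (entry v w (AnnouncedFor μ) (i, k)).2
  symb : ∀ t, (E.event t).symbol.isSome → ∃ i k, t = μ i (4 * k) ∨ t = μ i (4 * k + 3)

namespace Execution

variable {E : Execution V}

/-- What is visible in an execution is determined by the passing times and by the invocations and
responses. At all times, the announced invocations are those whose announcement is passed. -/
theorem exists_trace (h : E.Live) : ∃ v w, E.Trace E.passTime v w ∧
    ∀ i t, (E.conf t).ann i = {m | ∃ k, 4 * k + 1 < E.level i t ∧ m = ⟨i, k, v i k⟩} := by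
  -- the events at the passing times
  have hinv : ∀ i k, ∃ v, E.event (E.passTime i (4 * k)) = .invoke i k v ∧
      ((E.conf (E.passTime i (4 * k) + 1)).loc i).sent =
        ((E.conf (E.passTime i (4 * k))).loc i).sent ∪ {⟨i, k, v⟩} := by
    intro i k
    have h1 := level_passTime h i (4 * k)
    have h2 := level_passTime_succ h i (4 * k)
    have h3 := E.count_eq i (E.passTime i (4 * k))
    have h4 := E.stage_eq i (E.passTime i (4 * k))
    have h5 := E.stage_eq i (E.passTime i (4 * k) + 1)
    have hk := E.kind (proc_passTime h i (4 * k))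
    rw [h1] at h3 h4
    rw [h2] at h5
    have hc : ((E.conf (E.passTime i (4 * k))).loc i).count = k := by omega
    generalize E.event (E.passTime i (4 * k)) = e at hk
    cases hk with
    | code _ _ _ h0 h1' => omega
    | wait h0 h1' => omega
    | invoke v h0 h1' hc' hs => rw [hc] at hs ⊢; exact ⟨v, rfl, hs⟩
    | announce h0 h1' => omega
    | snapshot v w h0 h1' => rw [h0] at h4; simp only [Phase.stage] at h4; omega
    | respond v w S h0 h1' => rw [h0] at h4; simp only [Phase.stage] at h4; omega
  have hresp : ∀ i k, ∃ w, E.event (E.passTime i (4 * k + 3)) =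
      .respond i k w (⋃ j, (E.conf (E.passTime i (4 * k + 2))).ann j) := by
    intro i k
    -- the local state does not change between the snapshot and the response
    have hsnap : ∃ v w, ((E.conf (E.passTime i (4 * k + 2) + 1)).loc i).phase =
        .viewed v w (⋃ j, (E.conf (E.passTime i (4 * k + 2))).ann j) := by
      have h4 := E.stage_eq i (E.passTime i (4 * k + 2))
      have h5 := E.stage_eq i (E.passTime i (4 * k + 2) + 1)
      rw [level_passTime h] at h4
      rw [level_passTime_succ h] at h5
      have hk := E.kind (proc_passTime h i (4 * k + 2))
      generalize E.event (E.passTime i (4 * k + 2)) = e at hk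
      cases hk with
      | code _ _ _ h0 h1' => omega
      | wait h0 h1' => omega
      | invoke v h0 h1' => rw [h0] at h4; simp only [Phase.stage] at h4; omega
      | announce h0 h1' => omega
      | snapshot v w h0 h1' => exact ⟨v, w, h1'⟩
      | respond v w S h0 h1' => rw [h0] at h4; simp only [Phase.stage] at h4; omega
    obtain ⟨v, w, hvw⟩ := hsnap
    have hstay : ∀ t, E.passTime i (4 * k + 2) + 1 ≤ t → t ≤ E.passTime i (4 * k + 3) →
        ((E.conf t).loc i).phase = .viewed v w (⋃ j, (E.conf (E.passTime i (4 * k + 2))).ann j) := by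
      intro t ht
      induction t, ht using Nat.le_induction with
      | base => intro _; exact hvw
      | succ t ht ih =>
        intro ht'
        have ih' := ih (by omega)
        by_cases hp : (E.event t).proc = i
        · exfalso
          have hl1 : ¬ 4 * k + 3 < E.level i (t + 1) := fun hc => by
            have := (passTime_lt_iff h).2 hc; omega
          have hl2 : 4 * k + 2 < E.level i t := (passTime_lt_iff h).1 (by omega)
          have hm := E.level_mono i (Nat.le_succ t)
          simp only [Nat.succ_eq_add_one] at hm
          have h5 := E.stage_eq i (t + 1)
          have hk := E.kind hp
          generalize E.event t = e at hk
          cases hk with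
          | code _ _ _ h0 h1' => rw [ih'] at h0; simp [Phase.stage] at h0
          | wait h0 h1' => rw [ih'] at h0; simp [Phase.stage] at h0
          | invoke v h0 h1' => rw [ih'] at h0; cases h0
          | announce h0 h1' => rw [ih'] at h0; simp [Phase.stage] at h0
          | snapshot v w h0 h1' => rw [ih'] at h0; cases h0
          | respond v w S h0 h1' => omega
        · rw [E.loc_succ_of_ne hp]; exact ih'
    have hv := hstay (E.passTime i (4 * k + 3))
      ((interleaving_passTime h).mono i (by omega)) le_rfl
    have h3 := E.count_eq i (E.passTime i (4 * k + 3))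
    rw [level_passTime h] at h3
    have hc : ((E.conf (E.passTime i (4 * k + 3))).loc i).count = k := by omega
    have h2 := level_passTime_succ h i (4 * k + 3)
    have h5 := E.stage_eq i (E.passTime i (4 * k + 3) + 1)
    have hk := E.kind (proc_passTime h i (4 * k + 3))
    generalize E.event (E.passTime i (4 * k + 3)) = e at hk
    cases hk with
    | code _ _ _ h0 h1' => rw [hv] at h0; simp [Phase.stage] at h0
    | wait h0 h1' => rw [hv] at h0; simp [Phase.stage] at h0
    | invoke v h0 h1' => rw [hv] at h0; cases h0
    | announce h0 h1' => rw [hv] at h0; simp [Phase.stage] at h0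
    | snapshot v w h0 h1' => rw [hv] at h0; cases h0
    | respond v w S h0 h1' =>
      rw [hv] at h0
      cases h0
      rw [hc]; exact ⟨w, rfl⟩
  choose v hv hsent using hinv
  choose w hw using hresp
  have hsa : ∀ i t, ((E.conf t).loc i).sent = {m | ∃ k, 4 * k < E.level i t ∧ m = ⟨i, k, v i k⟩} ∧
      (E.conf t).ann i = {m | ∃ k, 4 * k + 1 < E.level i t ∧ m = ⟨i, k, v i k⟩} := by
    intro i t
    induction t with
    | zero =>
      rw [E.level_zero]
      simp [E.conf_zero, Config.initial]
    | succ t ih =>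
      obtain ⟨ih1, ih2⟩ := ih
      by_cases hp : (E.event t).proc = i
      · have h4 := E.stage_eq i t
        have h5 := E.stage_eq i (t + 1)
        have h6 := E.count_eq i t
        have h7 := E.count_eq i (t + 1)
        have hk := E.kind hp
        have hpass := eq_passTime h (i := i) (t := t)
        generalize he : E.event t = e at hk
        cases hk with
        | code _ _ _ h0 h1 hc hs ha =>
          have : E.level i (t + 1) = E.level i t := by omega
          rw [this, hs, ha]; exact ⟨ih1, ih2⟩
        | wait h0 h1 hc hs ha =>
          have : E.level i (t + 1) = E.level i t := by omega
          rw [this, hs, ha]; exact ⟨ih1, ih2⟩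
        | invoke b h0 h1 hc hs ha =>
          rw [h0] at h4
          simp only [Phase.stage] at h4
          have hl : E.level i (t + 1) = E.level i t + 1 := by omega
          have hpt := hpass hl
          obtain ⟨k, hk⟩ : ∃ k, E.level i t = 4 * k := ⟨E.level i t / 4, by omega⟩
          rw [hk] at hpt hl
          have hs' := hsent i k
          rw [hpt] at hs'
          rw [hs', ha, ih1, ih2, hl, hk]
          constructor
          · ext m
            constructor
            · rintro (⟨l, hl, rfl⟩ | rfl)
              · exact ⟨l, by omega, rfl⟩
              · exact ⟨k, by omega, rfl⟩
            · rintro ⟨l, hl, rfl⟩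
              rcases Nat.lt_or_ge l k with h' | h'
              · exact Or.inl ⟨l, by omega, rfl⟩
              · obtain rfl : l = k := by omega
                exact Or.inr rfl
          · ext m
            constructor
            · rintro ⟨l, hl, rfl⟩; exact ⟨l, by omega, rfl⟩
            · rintro ⟨l, hl, rfl⟩; exact ⟨l, by omega, rfl⟩
        | announce h0 h1 hc hs ha =>
          rw [hs, ha, ih1]
          refine ⟨?_, ?_⟩ <;>
          · ext m
            constructor
            · rintro ⟨l, hl, rfl⟩; exact ⟨l, by omega, rfl⟩
            · rintro ⟨l, hl, rfl⟩; exact ⟨l, by omega, rfl⟩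
        | snapshot b c h0 h1 hc hs ha =>
          rw [h0] at h4
          rw [h1] at h5
          simp only [Phase.stage] at h4 h5
          rw [hs, ha, ih1, ih2]
          refine ⟨?_, ?_⟩ <;>
          · ext m
            constructor
            · rintro ⟨l, hl, rfl⟩; exact ⟨l, by omega, rfl⟩
            · rintro ⟨l, hl, rfl⟩; exact ⟨l, by omega, rfl⟩
        | respond b c S h0 h1 hc hs ha =>
          rw [h0] at h4
          simp only [Phase.stage] at h4
          rw [hs, ha, ih1, ih2]
          refine ⟨?_, ?_⟩ <;>
          · ext m
            constructor
            · rintro ⟨l, hl, rfl⟩; exact ⟨l, by omega, rfl⟩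
            · rintro ⟨l, hl, rfl⟩; exact ⟨l, by omega, rfl⟩
      · have : E.level i (t + 1) = E.level i t := by unfold level; rw [E.loc_succ_of_ne hp]
        rw [this, E.loc_succ_of_ne hp, (E.step t).ann_of_ne hp]
        exact ⟨ih1, ih2⟩
  refine ⟨v, w, ⟨interleaving_passTime h, hv, fun i k => ?_, fun t ht => ?_⟩,
    fun i t => (hsa i t).2⟩
  · rw [hw]
    congr 1
    ext m
    simp only [Set.mem_iUnion, (hsa _ _).2]
    constructor
    · rintro ⟨j, l, hl, rfl⟩
      exact mark_mem_entry.2 ⟨(passTime_lt_iff h).2 hl, rfl⟩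
    · obtain ⟨j, l, b⟩ := m
      intro hm
      obtain ⟨h1, rfl⟩ := mark_mem_entry.1 hm
      exact ⟨j, l, (passTime_lt_iff h).1 h1, rfl⟩
  · obtain ⟨i, hp⟩ : ∃ i, (E.event t).proc = i := ⟨_, rfl⟩
    have h4 := E.stage_eq i t
    have h5 := E.stage_eq i (t + 1)
    have h6 := E.count_eq i t
    have h7 := E.count_eq i (t + 1)
    have hpass := eq_passTime h (i := i) (t := t)
    have hk := E.kind hp
    generalize E.event t = e at hk ht
    cases hk with
    | code _ hp hs => rw [hs] at ht; simp at ht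
    | wait => simp [Event.symbol] at ht
    | invoke b h0 h1 hc =>
      rw [h0] at h4
      simp only [Phase.stage] at h4
      refine ⟨i, E.level i t / 4, Or.inl ?_⟩
      rw [show 4 * (E.level i t / 4) = E.level i t by omega]
      exact (hpass (by omega)).symm
    | announce => simp [Event.symbol] at ht
    | snapshot => simp [Event.symbol] at ht
    | respond b c S h0 h1 hc =>
      rw [h0] at h4
      simp only [Phase.stage] at h4
      refine ⟨i, E.level i t / 4, Or.inr ?_⟩
      rw [show 4 * (E.level i t / 4) + 3 = E.level i t by omega]
      exact (hpass (by omega)).symm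

/-! ### The input and the entries of an execution -/

/-- The responses and the views of the operations of an execution. -/
def entries (E : Execution V) : Set (Entry A) := {d | E.Responds d.1 d.2}

theorem Trace.entries_eq {μ : Fin n → ℕ → ℕ} {v : ∀ i, ℕ → A.Inv i} {w : ∀ i, ℕ → A.Resp i}
    (h : E.Trace μ v w) : E.entries = DRV.entries v w (AnnouncedFor μ) := by
  ext d
  constructor
  · rintro ⟨t, ht⟩
    obtain ⟨i, k, rfl | rfl⟩ := h.symb t (by rw [ht]; rfl)
    · rw [h.inv] at ht; cases ht
    · rw [h.resp] at ht
      obtain ⟨⟨i', k', w'⟩, S⟩ := d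
      simp only [Event.respond.injEq] at ht
      obtain ⟨rfl, rfl, h3, rfl⟩ := ht
      obtain rfl := eq_of_heq h3
      exact ⟨(i, k), rfl⟩
  · rintro ⟨o, rfl⟩
    exact ⟨_, h.resp o.1 o.2⟩

theorem hasInput_of_enum {x : Word A} {f : ℕ → ℕ} (hf : StrictMono f)
    (hr : ∀ t, (E.event t).symbol.isSome ↔ ∃ k, f k = t)
    (hx : ∀ k, (E.event (f k)).symbol = some (x k)) : E.HasInput x := by
  intro k
  rw [nth_eq_of_strictMono hf hr]
  exact hx k

theorem HasInput.unique {x y : Word A} (hx : E.HasInput x) (hy : E.HasInput y) : x = y := by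
  funext k
  have := hx k
  rw [hy k] at this
  exact (Option.some.inj this).symm

/-- The times of invocations and responses, in alternation, when process `i` passes level `j` at
time `μ i j`. -/
def symbolTime (μ : Fin n → ℕ → ℕ) (i : Fin n) (j : ℕ) : ℕ := μ i (4 * (j / 2) + 3 * (j % 2))

theorem symbolTime_even (μ : Fin n → ℕ → ℕ) (i : Fin n) (k : ℕ) :
    symbolTime μ i (2 * k) = μ i (4 * k) := by
  unfold symbolTime; congr 1; omega

theorem symbolTime_odd (μ : Fin n → ℕ → ℕ) (i : Fin n) (k : ℕ) :
    symbolTime μ i (2 * k + 1) = μ i (4 * k + 3) := by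
  unfold symbolTime; congr 1; omega

theorem interleaving_symbolTime {μ : Fin n → ℕ → ℕ} (h : Interleaving μ) :
    Interleaving (symbolTime μ) :=
  ⟨fun i j j' hj => h.mono i (by omega), fun _ _ _ _ hij => h.inj _ _ _ _ hij⟩

theorem Trace.symbol_symbolTime {μ : Fin n → ℕ → ℕ} {v : ∀ i, ℕ → A.Inv i}
    {w : ∀ i, ℕ → A.Resp i} (h : E.Trace μ v w) {x : Word A} {Q : Fin n → ℕ → ℕ}
    (hx : Presents x Q v w) (i : Fin n) (j : ℕ) :
    (E.event (symbolTime μ i j)).symbol = some (x (Q i j)) := by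
  obtain ⟨k, rfl | rfl⟩ := Nat.even_or_odd' j
  · rw [symbolTime_even, h.inv, hx.inv]; rfl
  · rw [symbolTime_odd, h.resp, hx.resp]; rfl

theorem Trace.symbol_iff {μ : Fin n → ℕ → ℕ} {v : ∀ i, ℕ → A.Inv i}
    {w : ∀ i, ℕ → A.Resp i} (h : E.Trace μ v w) (t : ℕ) :
    (E.event t).symbol.isSome ↔ ∃ i j, symbolTime μ i j = t := by
  constructor
  · intro ht
    obtain ⟨i, k, rfl | rfl⟩ := h.symb t ht
    · exact ⟨i, 2 * k, symbolTime_even _ _ _⟩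
    · exact ⟨i, 2 * k + 1, symbolTime_odd _ _ _⟩
  · rintro ⟨i, j, rfl⟩
    obtain ⟨k, rfl | rfl⟩ := Nat.even_or_odd' j
    · rw [symbolTime_even, h.inv]; rfl
    · rw [symbolTime_odd, h.resp]; rfl

theorem Trace.hasInput {μ : Fin n → ℕ → ℕ} {v : ∀ i, ℕ → A.Inv i} {w : ∀ i, ℕ → A.Resp i}
    (h : E.Trace μ v w) {x : Word A} {Q : Fin n → ℕ → ℕ} (hx : Presents x Q v w)
    (hQ : Interleaving.SameOrder Q (symbolTime μ)) : E.HasInput x := by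
  choose p q hpq using hx.surj
  refine hasInput_of_enum (f := fun t => symbolTime μ (p t) (q t)) ?_ (fun t => ?_) (fun t => ?_)
  · intro s t hst
    rw [← hpq s, ← hpq t] at hst
    exact (hQ _ _ _ _).1 hst
  · rw [h.symbol_iff]
    constructor
    · rintro ⟨i, j, rfl⟩
      obtain ⟨h1, h2⟩ := hx.il.eq_iff.1 (hpq (Q i j))
      exact ⟨Q i j, by simp only [h1, h2]⟩
    · rintro ⟨s, rfl⟩; exact ⟨_, _, rfl⟩
  · rw [h.symbol_symbolTime hx, hpq]

/-- The input of an execution with a given trace: the symbols in the order of their times. -/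
theorem Trace.exists_input [NeZero n] {μ : Fin n → ℕ → ℕ} {v : ∀ i, ℕ → A.Inv i}
    {w : ∀ i, ℕ → A.Resp i} (h : E.Trace μ v w) :
    ∃ x Q, Presents x Q v w ∧ Interleaving.SameOrder Q (symbolTime μ) ∧ E.HasInput x := by
  obtain ⟨Q, hQ, hs, ho⟩ := (interleaving_symbolTime h.il).exists_compress
  obtain ⟨x, hx⟩ := exists_presents hQ hs v w
  exact ⟨x, Q, hx, ho, h.hasInput hx ho⟩

/-- Some well-formed word has the entries of a given trace: place the invocations at their
announcements, and the responses at their snapshots. -/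
theorem exists_hasEntries [NeZero n] {μ : Fin n → ℕ → ℕ} (h : Interleaving μ)
    (v : ∀ i, ℕ → A.Inv i) (w : ∀ i, ℕ → A.Resp i) :
    ∃ z : Word A, HasEntries z (DRV.entries v w (AnnouncedFor μ)) := by
  obtain ⟨Q, hQ, hs, ho⟩ := Interleaving.exists_compress
    (κ := fun i j => μ i (4 * (j / 2) + j % 2 + 1))
    ⟨fun i j j' hj => h.mono i (by omega), fun _ _ _ _ hij => h.inj _ _ _ _ hij⟩
  obtain ⟨z, hz⟩ := exists_presents hQ hs v w
  refine ⟨z, Q, v, w, hz, ?_⟩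
  congr 1
  funext a b
  apply propext
  unfold AnnouncedFor Sees
  rw [ho]
  dsimp only
  rw [show 4 * (2 * a.2 / 2) + 2 * a.2 % 2 + 1 = 4 * a.2 + 1 by omega,
    show 4 * ((2 * b.2 + 1) / 2) + (2 * b.2 + 1) % 2 + 1 = 4 * b.2 + 2 by omega]

end Execution

end Levels

/-! ### Reordering the steps of an execution -/

section Reorder

variable {n : ℕ} {P : Set SharedObject} {A : DistAlphabet n} {V : Algorithm P A}

/-- The next step of the process is an access to the shared memory of the algorithm. -/
def LocalState.Accesses {i : Fin n} (l : LocalState V i) : Prop :=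
  (∃ v c op next, l.phase = .before v ∧ V.pre i l.code = .access c op next) ∨
    ∃ c op next, l.phase = .after ∧ V.post i l.code = .access c op next

/-- The next step of the process is the snapshot of the timed adversary. -/
def LocalState.TakesSnapshot {i : Fin n} (l : LocalState V i) : Prop :=
  ∃ v w, l.phase = .replied v w

theorem Config.eq_of {C D : Config V} (h1 : ∀ i, C.loc i = D.loc i) (h2 : C.mem = D.mem)
    (h3 : ∀ i, C.ann i = D.ann i) : C = D := by
  cases C; cases D
  obtain rfl := funext h1
  obtain rfl := h2
  obtain rfl := funext h3
  rfl

theorem Step.mem_of_not_accesses {C C' : Config V} {e : Event A} (h : Step V C e C')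
    (hn : ¬ (C.loc e.proc).Accesses) : C'.mem = C.mem := by
  cases h with
  | preAccess i v c op next h h' => exact absurd (Or.inl ⟨v, c, op, next, h, h'⟩) hn
  | postAccess i c op next h h' => exact absurd (Or.inr ⟨c, op, next, h, h'⟩) hn
  | _ => rfl

/-- A step depends only on the local state of its process, on the shared memory if it accesses the
shared memory, and on the announcements if it takes a snapshot. -/
theorem Step.replay {C C' D D' : Config V} {e : Event A} (h : Step V C e C')
    (hloc : D.loc e.proc = C.loc e.proc) (hloc' : D'.loc e.proc = C'.loc e.proc)
    (hl : ∀ j, e.proc ≠ j → D'.loc j = D.loc j)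
    (hann : D.ann e.proc = C.ann e.proc) (hann' : D'.ann e.proc = C'.ann e.proc)
    (ha : ∀ j, e.proc ≠ j → D'.ann j = D.ann j)
    (hmem : (C.loc e.proc).Accesses → D.mem = C.mem ∧ D'.mem = C'.mem)
    (hmem' : ¬ (C.loc e.proc).Accesses → D'.mem = D.mem)
    (hsnap : (C.loc e.proc).TakesSnapshot → ⋃ j, D.ann j = ⋃ j, C.ann j) :
    Step V D e D' := by
  have key : ∀ D'', Step V D e D'' → D''.loc e.proc = C'.loc e.proc →
      D''.ann e.proc = C'.ann e.proc → D''.mem = D'.mem → Step V D e D' := by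
    intro D'' h1 h2 h3 h4
    have : D'' = D' := by
      refine Config.eq_of (fun j => ?_) h4 (fun j => ?_)
      · by_cases hj : e.proc = j
        · subst hj; rw [h2, hloc']
        · rw [h1.loc_of_ne hj, hl j hj]
      · by_cases hj : e.proc = j
        · subst hj; rw [h3, hann']
        · rw [h1.ann_of_ne hj, ha j hj]
    rw [← this]; exact h1
  cases h with
  | pick i v h =>
    simp only [Event.proc] at *
    refine key _ (.pick D i v (by rw [hloc]; exact h)) (by simp [Config.setLoc, hloc]) hann
      (hmem' ?_).symm
    rintro (⟨_, _, _, _, h1, -⟩ | ⟨_, _, _, h1, -⟩) <;> rw [h] at h1 <;> cases h1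
  | preAccess i v c op next h h' =>
    simp only [Event.proc] at *
    obtain ⟨m1, m2⟩ := hmem (Or.inl ⟨v, c, op, next, h, h'⟩)
    refine key _ (.preAccess D i v c op next (by rw [hloc]; exact h) (by rw [hloc]; exact h'))
      (by simp [Config.setLoc, Config.result, hloc, m1]) hann ?_
    rw [m2]; simp [Config.setLoc, Config.applyOp, m1]
  | invoke i v h h' =>
    simp only [Event.proc] at *
    have := Step.invoke D i v (by rw [hloc]; exact h) (by rw [hloc]; exact h')
    rw [hloc] at this
    refine key _ this (by simp [Config.setLoc]) hann (hmem' ?_).symm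
    rintro (⟨_, _, _, _, h1, h2⟩ | ⟨_, _, _, h1, -⟩)
    · rw [h'] at h2; cases h2
    · rw [h] at h1; cases h1
  | announce i v h =>
    simp only [Event.proc] at *
    refine key _ (.announce D i v (by rw [hloc]; exact h)) (by simp [Config.setLoc, hloc])
      (by simp [Config.setLoc, hloc]) (hmem' ?_).symm
    rintro (⟨_, _, _, _, h1, -⟩ | ⟨_, _, _, h1, -⟩) <;> rw [h] at h1 <;> cases h1
  | forward i v h =>
    simp only [Event.proc] at *
    refine key _ (.forward D i v (by rw [hloc]; exact h)) (by simp [Config.setLoc, hloc]) hann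
      (hmem' ?_).symm
    rintro (⟨_, _, _, _, h1, -⟩ | ⟨_, _, _, h1, -⟩) <;> rw [h] at h1 <;> cases h1
  | reply i v w h =>
    simp only [Event.proc] at *
    refine key _ (.reply D i v w (by rw [hloc]; exact h)) (by simp [Config.setLoc, hloc]) hann
      (hmem' ?_).symm
    rintro (⟨_, _, _, _, h1, -⟩ | ⟨_, _, _, h1, -⟩) <;> rw [h] at h1 <;> cases h1
  | snapshot i v w h =>
    simp only [Event.proc] at *
    refine key _ (.snapshot D i v w (by rw [hloc]; exact h))
      (by simp [Config.setLoc, hloc, hsnap ⟨v, w, h⟩]) hann (hmem' ?_).symm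
    rintro (⟨_, _, _, _, h1, -⟩ | ⟨_, _, _, h1, -⟩) <;> rw [h] at h1 <;> cases h1
  | respond i v w S h =>
    simp only [Event.proc] at *
    have := Step.respond D i v w S (by rw [hloc]; exact h)
    rw [hloc] at this
    refine key _ this (by simp [Config.setLoc]) hann (hmem' ?_).symm
    rintro (⟨_, _, _, _, h1, -⟩ | ⟨_, _, _, h1, -⟩) <;> rw [h] at h1 <;> cases h1
  | postAccess i c op next h h' =>
    simp only [Event.proc] at *
    obtain ⟨m1, m2⟩ := hmem (Or.inr ⟨c, op, next, h, h'⟩)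
    refine key _ (.postAccess D i c op next (by rw [hloc]; exact h) (by rw [hloc]; exact h'))
      (by simp [Config.setLoc, Config.result, hloc, m1]) hann ?_
    rw [m2]; simp [Config.setLoc, Config.applyOp, m1]
  | report i b s h h' =>
    simp only [Event.proc] at *
    refine key _ (.report D i b s (by rw [hloc]; exact h) (by rw [hloc]; exact h'))
      (by simp [Config.setLoc, hloc]) hann (hmem' ?_).symm
    rintro (⟨_, _, _, _, h1, -⟩ | ⟨_, _, _, h1, h2⟩)
    · rw [h] at h1; cases h1
    · rw [h'] at h2; cases h2

/-- A quantity `f` that changes only at the times in `p` can be followed through a permutation `e`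
of the times that does not change the order of the times in `p`. -/
theorem exists_reordered_value {X : Type*} (e : ℕ ≃ ℕ) (p : ℕ → Prop)
    (hp : ∀ s t, p s → p t → s < t → e s < e t) (f : ℕ → X) (hf : ∀ t, ¬ p t → f (t + 1) = f t) :
    ∃ g : ℕ → X, g 0 = f 0 ∧ (∀ t, p t → g (e t) = f t ∧ g (e t + 1) = f (t + 1)) ∧
      (∀ t, ¬ p t → g (e t + 1) = g (e t)) ∧
      ∀ t, ∃ s, g t = f s ∧ ∀ τ, p τ → (τ < s ↔ e τ < t) := by
  set up : ℕ → ℕ := fun t => sInf {s | ∀ τ, p τ → e τ < t → τ < s} with hup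
  have hne : ∀ t, {s | ∀ τ, p τ → e τ < t → τ < s}.Nonempty := by
    intro t
    have hfin : {τ | e τ < t}.Finite := (Set.finite_Iio t).preimage e.injective.injOn
    obtain ⟨B, hB⟩ := hfin.bddAbove
    exact ⟨B + 1, fun τ _ h => Nat.lt_succ_of_le (hB h)⟩
  have hiff : ∀ t τ, p τ → (τ < up t ↔ e τ < t) := by
    intro t τ hτ
    refine ⟨fun h => ?_, fun h => Nat.sInf_mem (hne t) τ hτ h⟩
    by_contra hc
    have : up t ≤ τ := by
      refine Nat.sInf_le fun τ' hτ' h' => ?_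
      by_contra hn
      rcases (not_lt.1 hn).lt_or_eq with h1 | h1
      · have := hp τ τ' hτ hτ' h1; omega
      · subst h1; exact hc h'
    omega
  have hconst : ∀ s s', s ≤ s' → (∀ τ, s ≤ τ → τ < s' → ¬ p τ) → f s' = f s := by
    intro s s' hs
    induction s', hs using Nat.le_induction with
    | base => intro _; rfl
    | succ m hm ih =>
      intro h
      rw [hf m (h m hm (by omega)), ih fun τ h1 h2 => h τ h1 (by omega)]
  refine ⟨fun t => f (up t), ?_, fun t ht => ⟨?_, ?_⟩, fun t ht => ?_, fun t => ⟨up t, rfl, hiff t⟩⟩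
  · have : up 0 = 0 := Nat.le_zero.1 (Nat.sInf_le fun τ _ h => absurd h (Nat.not_lt_zero _))
    simp only [this]
  · refine (hconst _ _ ?_ fun τ h1 h2 h3 => ?_).symm
    · by_contra hc
      exact lt_irrefl _ ((hiff _ t ht).1 (not_le.1 hc))
    · have := (hiff (e t) τ h3).2 (hp _ _ h3 ht h2); omega
  · refine hconst _ _ ((hiff (e t + 1) t ht).2 (by omega)) fun τ h1 h2 h3 => ?_
    have := (hiff (e t + 1) τ h3).1 h2
    have := hp t τ ht h3 h1
    omega
  · have : up (e t + 1) = up (e t) := by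
      simp only [hup]
      congr 1
      ext s
      refine forall₂_congr fun τ hτ => ?_
      have : e τ ≠ e t := fun h => ht (e.injective h ▸ hτ)
      have h' : e τ < e t + 1 ↔ e τ < e t := by omega
      rw [h']
    simp only [this]

namespace Execution

/-- The steps of an execution can be permuted if the order is kept among the steps of each process,
among the accesses to the shared memory, and between announcements and snapshots. -/
theorem exists_reorder {E : Execution V} (hL : E.Live) (hF : E.Fair) (e : ℕ ≃ ℕ)
    (hproc : ∀ s t, (E.event s).proc = (E.event t).proc → s < t → e s < e t)
    (hmem : ∀ s t, ((E.conf s).loc (E.event s).proc).Accesses →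
      ((E.conf t).loc (E.event t).proc).Accesses → s < t → e s < e t)
    (hsnap : ∀ t, ((E.conf t).loc (E.event t).proc).TakesSnapshot → ∀ j l,
      e (E.passTime j (4 * l + 1)) < e t ↔ E.passTime j (4 * l + 1) < t) :
    ∃ E' : Execution V, E'.Fair ∧ E'.Indist E ∧ ∀ t, E'.event (e t) = E.event t := by
  obtain ⟨v, w, -, hann⟩ := exists_trace hL
  have hloc := fun i => exists_reordered_value e (fun t => (E.event t).proc = i)
    (fun s t hs ht => hproc s t (hs.trans ht.symm))
    (fun t => ((E.conf t).loc i, (E.conf t).ann i))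
    (fun t ht => by rw [E.loc_succ_of_ne ht, (E.step t).ann_of_ne ht])
  choose g g0 g1 g2 g3 using hloc
  obtain ⟨m, m0, m1, m2, -⟩ := exists_reordered_value e
    (fun t => ((E.conf t).loc (E.event t).proc).Accesses) hmem (fun t => (E.conf t).mem)
    (fun t ht => (E.step t).mem_of_not_accesses ht)
  set conf : ℕ → Config V := fun t => ⟨fun i => (g i t).1, m t, fun i => (g i t).2⟩ with hconf
  have hstep : ∀ t, Step V (conf (e t)) (E.event t) (conf (e t + 1)) := by
    intro t
    have h1 := g1 _ t rfl
    refine (E.step t).replay ?_ ?_ (fun j hj => ?_) ?_ ?_ (fun j hj => ?_) (fun h => m1 t h)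
      (fun h => m2 t h) (fun h => ?_)
    · simp only [hconf, h1.1]
    · simp only [hconf, h1.2]
    · simp only [hconf, g2 j t hj]
    · simp only [hconf, h1.1]
    · simp only [hconf, h1.2]
    · simp only [hconf, g2 j t hj]
    · congr 1
      funext j
      obtain ⟨s, hs1, hs2⟩ := g3 j (e t)
      simp only [hconf, hs1, hann]
      ext a
      refine exists_congr fun l => and_congr_left fun _ => ?_
      rw [← passTime_lt_iff hL, ← passTime_lt_iff hL, hs2 _ (proc_passTime hL j _), hsnap t h]
  have hevent : ∀ t, E.event (e.symm (e t)) = E.event t := fun t => by rw [e.symm_apply_apply]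
  let E' : Execution V :=
    { conf := conf
      event := fun t => E.event (e.symm t)
      conf_zero := by
        refine Config.eq_of (fun i => ?_) ?_ (fun i => ?_)
        · simp only [hconf, g0, E.conf_zero]
        · simp only [hconf, m0, E.conf_zero]
        · simp only [hconf, g0, E.conf_zero]
      step := fun t => by
        have := hstep (e.symm t)
        rwa [e.apply_symm_apply] at this }
  classical
  have hst : ∀ p k, Nat.nth (fun t => t ∈ E'.stepTimes p) k =
      e (Nat.nth (fun t => t ∈ E.stepTimes p) k) := by
    intro p k
    have hinf : (Set.ofPred fun t => t ∈ E.stepTimes p).Infinite := hF p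
    have hm : ∀ k, (E.event (Nat.nth (fun t => t ∈ E.stepTimes p) k)).proc = p :=
      fun k => Nat.nth_mem_of_infinite hinf k
    refine nth_eq_of_strictMono (f := fun k => e (Nat.nth (fun t => t ∈ E.stepTimes p) k))
      (fun a b hab => hproc _ _ ((hm a).trans (hm b).symm) (Nat.nth_strictMono hinf hab))
      (fun t => ?_) k
    constructor
    · intro ht
      refine ⟨Nat.count (fun t => t ∈ E.stepTimes p) (e.symm t), ?_⟩
      have : e.symm t ∈ E.stepTimes p := ht
      show e (Nat.nth (fun t => t ∈ E.stepTimes p) _) = t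
      rw [Nat.nth_count (p := fun t => t ∈ E.stepTimes p) this, e.apply_symm_apply]
    · rintro ⟨k, rfl⟩
      show (E.event (e.symm (e _))).proc = p
      rw [hevent]; exact hm k
  refine ⟨E', fun p => ?_, fun p k => ?_, hevent⟩
  · have : E'.stepTimes p = e '' E.stepTimes p := by
      ext t
      constructor
      · intro ht; exact ⟨e.symm t, ht, e.apply_symm_apply t⟩
      · rintro ⟨s, hs, rfl⟩
        show (E.event (e.symm (e s))).proc = p
        rw [hevent]; exact hs
    rw [this]
    exact (hF p).image e.injective.injOn
  · unfold localSeq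
    rw [hst]
    have hinf : (Set.ofPred fun t => t ∈ E.stepTimes p).Infinite := hF p
    have := (g1 p _ (Nat.nth_mem_of_infinite hinf k)).1
    simp only [E', hconf, this]

/-! ### Every word with the entries of an execution is the input of an indistinguishable one -/

/-- An access to the shared memory is no part of an interaction. -/
theorem accesses_level {E : Execution V} {t : ℕ}
    (h : ((E.conf t).loc (E.event t).proc).Accesses) :
    E.level (E.event t).proc t % 4 = 0 ∧
      E.level (E.event t).proc (t + 1) = E.level (E.event t).proc t := by
  have hs := E.step t
  rw [← E.stage_eq]
  unfold level
  generalize E.conf (t + 1) = C' at *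
  generalize E.event t = e at *
  generalize E.conf t = C at *
  have h0 : (C.loc e.proc).phase.stage = 0 := by
    rcases h with ⟨_, _, _, _, h, -⟩ | ⟨_, _, _, h, -⟩ <;> rw [h] <;> rfl
  refine ⟨h0, ?_⟩
  have hk := hs.kind
  cases hs with
  | invoke i v h1 h2 =>
    simp only [Event.proc] at *
    rcases h with ⟨_, _, _, _, _, h⟩ | ⟨_, _, _, h, -⟩
    · rw [h2] at h; cases h
    · rw [h1] at h; cases h
  | announce i v h1 => simp only [Event.proc] at *; rw [h1] at h0; simp [Phase.stage] at h0
  | forward i v h1 => simp only [Event.proc] at *; rw [h1] at h0; simp [Phase.stage] at h0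
  | reply i v w h1 => simp only [Event.proc] at *; rw [h1] at h0; simp [Phase.stage] at h0
  | snapshot i v w h1 => simp only [Event.proc] at *; rw [h1] at h0; simp [Phase.stage] at h0
  | respond i v w S h1 => simp only [Event.proc] at *; rw [h1] at h0; simp [Phase.stage] at h0
  | pick i v h1 => simp [Event.proc, LocalState.level, Config.setLoc, h1, Phase.stage]
  | preAccess i v c op next h1 h2 =>
    simp [Event.proc, LocalState.level, Config.setLoc, h1, Config.applyOp]
  | postAccess i c op next h1 h2 =>
    simp [Event.proc, LocalState.level, Config.setLoc, h1, Config.applyOp]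
  | report i b s h1 h2 => simp [Event.proc, LocalState.level, Config.setLoc, h1, Phase.stage]

theorem takesSnapshot_level {E : Execution V} (hL : E.Live) {t : ℕ}
    (h : ((E.conf t).loc (E.event t).proc).TakesSnapshot) :
    ∃ k, E.passTime (E.event t).proc (4 * k + 2) = t := by
  obtain ⟨v, w, h⟩ := h
  have h4 := E.stage_eq (E.event t).proc t
  have h5 := E.stage_eq (E.event t).proc (t + 1)
  have h6 := E.count_eq (E.event t).proc t
  have h7 := E.count_eq (E.event t).proc (t + 1)
  have h8 : ((E.conf t).loc (E.event t).proc).phase.stage = 2 := congrArg Phase.stage h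
  have hs : E.level (E.event t).proc (t + 1) = E.level (E.event t).proc t + 1 := by
    have hs := E.step t
    unfold level
    generalize E.conf (t + 1) = C' at *
    generalize E.event t = e at *
    generalize E.conf t = C at *
    cases hs with
    | snapshot i v w h1 => simp [Event.proc, LocalState.level, Config.setLoc, h1, Phase.stage]
    | _ => simp_all [Event.proc]
  refine ⟨E.level (E.event t).proc t / 4, ?_⟩
  rw [show 4 * (E.level (E.event t).proc t / 4) + 2 = E.level (E.event t).proc t by omega]
  exact eq_passTime hL hs

/-- The steps of the interaction with the timed adversary can be postponed or advanced so that the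
input becomes any given word `y` with the same entries. The invocation of an operation and the steps
up to its snapshot belong to the position of its invocation in `y`, its snapshot and its response to
the position of its response. All steps that belong to position `q` happen at once, at the first
original snapshot time of an operation whose response is not before `q` in `y`. -/
theorem exists_indist_of_hasEntries {E : Execution V} (hL : E.Live) (hF : E.Fair) {y : Word A}
    (hy : HasEntries y E.entries) :
    ∃ E' : Execution V, E'.Fair ∧ E'.Indist E ∧ E'.HasInput y ∧ E'.entries = E.entries := by
  obtain ⟨v, w, htr, -⟩ := exists_trace hL
  rw [htr.entries_eq] at hy ⊢
  obtain ⟨Q, hQ, hsees⟩ := hy.presents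
  set μ := E.passTime with hμ
  have hil := interleaving_passTime hL
  rw [← hμ] at hil
  have hS : ∀ a b : OpId n, Q a.1 (2 * a.2) < Q b.1 (2 * b.2 + 1) ↔
      μ a.1 (4 * a.2 + 1) < μ b.1 (4 * b.2 + 2) := fun a b =>
    iff_of_eq (congrFun (congrFun hsees a) b)
  -- `T q` is the first snapshot of an operation whose response is not before position `q` of `y`.
  set T : ℕ → ℕ := fun q => sInf {t | ∃ i k, q ≤ Q i (2 * k + 1) ∧ μ i (4 * k + 2) = t} with hT
  have T_le : ∀ {q i k}, q ≤ Q i (2 * k + 1) → T q ≤ μ i (4 * k + 2) := fun h =>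
    Nat.sInf_le ⟨_, _, h, rfl⟩
  have T_eq : ∀ q, ∃ i k, q ≤ Q i (2 * k + 1) ∧ μ i (4 * k + 2) = T q := by
    intro q
    obtain ⟨i, -, -⟩ := hQ.surj 0
    refine Nat.sInf_mem (s := {t | ∃ i k, q ≤ Q i (2 * k + 1) ∧ μ i (4 * k + 2) = t})
      ⟨_, i, q, ?_, rfl⟩
    have := (hQ.il.mono i).le_apply (x := 2 * q + 1)
    omega
  have T_mono : Monotone T := by
    intro q q' hq
    obtain ⟨i, k, h1, h2⟩ := T_eq q'
    rw [← h2]; exact T_le (hq.trans h1)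
  have T_fin : ∀ N, {q | T q ≤ N}.Finite := by
    intro N
    refine (Set.Finite.biUnion (hil.finite_lt (N + 1))
      (t := fun a => Set.Iic (Q a.1 (2 * (a.2 / 4) + 1))) (fun _ _ => Set.finite_Iic _)).subset ?_
    intro q hq
    obtain ⟨i, k, h1, h2⟩ := T_eq q
    have hq' : T q ≤ N := hq
    refine Set.mem_biUnion (x := (i, 4 * k + 2)) (by simp only [Set.mem_ofPred_eq]; omega) ?_
    simp only [Set.mem_Iic]
    rw [show (4 * k + 2) / 4 = k by omega]; exact h1
  -- the symbol of `y` to which a step belongs, if it is part of an interaction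
  set part : ℕ → Option ℕ := fun t =>
    if E.level (E.event t).proc t % 4 = 3 ∨ (E.level (E.event t).proc t % 4 = 2 ∧
        E.level (E.event t).proc (t + 1) ≠ E.level (E.event t).proc t) then
      some (Q (E.event t).proc (2 * (E.level (E.event t).proc t / 4) + 1))
    else if E.level (E.event t).proc t % 4 = 0 ∧
        E.level (E.event t).proc (t + 1) = E.level (E.event t).proc t then none
    else some (Q (E.event t).proc (2 * (E.level (E.event t).proc t / 4))) with hpart
  have part_cases : ∀ i t, (E.event t).proc = i →
      (part t = none ∧ E.level i t % 4 = 0 ∧ E.level i (t + 1) = E.level i t) ∨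
      (part t = some (Q i (2 * (E.level i t / 4))) ∧ E.level i t % 4 ≠ 3 ∧
        (E.level i t % 4 = 0 → E.level i (t + 1) ≠ E.level i t) ∧
        (E.level i t % 4 = 2 → E.level i (t + 1) = E.level i t)) ∨
      (part t = some (Q i (2 * (E.level i t / 4) + 1)) ∧
        (E.level i t % 4 = 3 ∨ (E.level i t % 4 = 2 ∧ E.level i (t + 1) ≠ E.level i t))) := by
    rintro i t rfl
    simp only [hpart]
    split_ifs with h1 h2
    · exact Or.inr (Or.inr ⟨rfl, h1⟩)
    · exact Or.inl ⟨rfl, h2⟩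
    · exact Or.inr (Or.inl ⟨rfl, fun h => h1 (Or.inl h), fun h h' => h2 ⟨h, h'⟩,
        fun h => by_contra fun h' => h1 (Or.inr ⟨h, h'⟩)⟩)
  -- Steps of the code keep their times. The steps that belong to position `q` of `y` move to the
  -- time `T q`, where positions that move to the same time are kept in order.
  set key : ℕ → ℕ ×ₗ ℕ ×ₗ ℕ := fun t =>
    match part t with
    | none => toLex (t, toLex (0, t))
    | some q => toLex (T q, toLex (q + 1, t)) with hkey
  have key_none : ∀ {t}, part t = none → key t = toLex (t, toLex (0, t)) := by
    intro t h; simp only [hkey, h]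
  have key_some : ∀ {t q}, part t = some q → key t = toLex (T q, toLex (q + 1, t)) := by
    intro t q h; simp only [hkey, h]
  have key_inj : Function.Injective key := by
    intro s t hst
    have : ∀ t, (ofLex (ofLex (key t)).2).2 = t := by
      intro t
      cases hp : part t with
      | none => rw [key_none hp]; rfl
      | some q => rw [key_some hp]; rfl
    rw [← this s, hst, this]
  have key_fst : ∀ {s t}, key s < key t → (ofLex (key s)).1 ≤ (ofLex (key t)).1 := by
    intro s t hst
    rcases (Prod.Lex.lt_iff).1 hst with h | h
    · exact h.le
    · exact h.1.le
  have key_fin : ∀ t, {s | key s < key t}.Finite := by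
    intro t
    set N := (ofLex (key t)).1
    choose p r hpr using hQ.surj
    refine ((Set.finite_Iic N).union (Set.Finite.biUnion (T_fin N)
      (t := fun q => Set.Iic (μ (p q) (2 * r q + 3))) (fun _ _ => Set.finite_Iic _))).subset ?_
    intro s hs
    have h1 := key_fst hs
    have hlt : ∀ i j, E.level i s ≤ j → s ≤ μ i j := fun i j h => by
      by_contra hc
      have := (passTime_lt_iff hL).1 (not_le.1 hc); omega
    rcases part_cases _ s rfl with ⟨h, -⟩ | ⟨h, -⟩ | ⟨h, -⟩
    · rw [key_none h] at h1; exact Or.inl h1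
    · rw [key_some h] at h1
      refine Or.inr (Set.mem_biUnion h1 ?_)
      obtain ⟨h2, h3⟩ := hQ.il.eq_iff.1 (hpr (Q (E.event s).proc
        (2 * (E.level (E.event s).proc s / 4))))
      rw [h2, h3]
      exact hlt _ _ (by omega)
    · rw [key_some h] at h1
      refine Or.inr (Set.mem_biUnion h1 ?_)
      obtain ⟨h2, h3⟩ := hQ.il.eq_iff.1 (hpr (Q (E.event s).proc
        (2 * (E.level (E.event s).proc s / 4) + 1)))
      rw [h2, h3]
      exact hlt _ _ (by omega)
  have some_lt : ∀ {s t q q'}, part s = some q → part t = some q' → q < q' → key s < key t := by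
    intro s t q q' hs ht hq
    rw [key_some hs, key_some ht, Prod.Lex.toLex_lt_toLex, Prod.Lex.toLex_lt_toLex]
    rcases (T_mono hq.le).lt_or_eq with h | h
    · exact Or.inl h
    · exact Or.inr ⟨h, Or.inl (by simpa using hq)⟩
  have some_le : ∀ {s t q q'}, part s = some q → part t = some q' → q ≤ q' → s < t →
      key s < key t := by
    intro s t q q' hs ht hq hst
    rcases hq.lt_or_eq with h | rfl
    · exact some_lt hs ht h
    · rw [key_some hs, key_some ht, Prod.Lex.toLex_lt_toLex, Prod.Lex.toLex_lt_toLex]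
      exact Or.inr ⟨rfl, Or.inr ⟨rfl, hst⟩⟩
  have before_T : ∀ i k q, Q i (2 * k) ≤ q → μ i (4 * k + 1) < T q := by
    intro i k q hq
    obtain ⟨i', k', h1, h2⟩ := T_eq q
    rw [← h2]
    refine (hS (i, k) (i', k')).1 (lt_of_le_of_ne (hq.trans h1) fun h => ?_)
    have := (hQ.il.eq_iff.1 h).2
    dsimp only at this
    omega
  have key_proc : ∀ s t, (E.event s).proc = (E.event t).proc → s < t → key s < key t := by
    intro s t hp hst
    obtain ⟨i, hi⟩ : ∃ i, (E.event t).proc = i := ⟨_, rfl⟩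
    have hm := E.level_mono i hst.le
    have hm0 := E.level_mono i (Nat.le_add_right s 1)
    have hm1 := E.level_mono i (Nat.succ_le_of_lt hst)
    simp only [Nat.succ_eq_add_one] at hm1
    have hQm := (hQ.il.mono i).monotone
    rcases part_cases i s (hp.trans hi) with ⟨h, h1, h2⟩ | ⟨h, h1, h2, h3⟩ | ⟨h, h1⟩ <;>
      rcases part_cases i t hi with ⟨h', h1', h2'⟩ | ⟨h', h1', h2', h3'⟩ | ⟨h', h1'⟩
    · rw [key_none h, key_none h', Prod.Lex.toLex_lt_toLex]; exact Or.inl hst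
    · rw [key_none h, key_some h', Prod.Lex.toLex_lt_toLex]
      refine Or.inl (show s < T _ from lt_of_le_of_lt ?_ (before_T i _ _ le_rfl))
      by_contra hc
      have := (passTime_lt_iff hL).1 (not_le.1 hc)
      omega
    · rw [key_none h, key_some h', Prod.Lex.toLex_lt_toLex]
      refine Or.inl (show s < T _ from
        lt_of_le_of_lt ?_ (before_T i (E.level i t / 4) _ (hQm (Nat.le_succ _))))
      by_contra hc
      have := (passTime_lt_iff hL).1 (not_le.1 hc)
      omega
    · rw [key_some h, key_none h', Prod.Lex.toLex_lt_toLex]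
      refine Or.inl (show T _ < t from
        lt_of_le_of_lt (T_le (hQm (Nat.le_succ _))) ((passTime_lt_iff hL).2 ?_))
      omega
    · exact some_le h h' (hQm (by omega)) hst
    · exact some_le h h' (hQm (by omega)) hst
    · rw [key_some h, key_none h', Prod.Lex.toLex_lt_toLex]
      refine Or.inl (show T _ < t from lt_of_le_of_lt (T_le le_rfl) ((passTime_lt_iff hL).2 ?_))
      omega
    · exact some_le h h' (hQm (by omega)) hst
    · exact some_le h h' (hQm (by omega)) hst
  obtain ⟨e, he, -⟩ := exists_rank key key_inj key_fin
  have part_pass : ∀ i j, part (μ i j) = some (Q i (2 * (j / 4) + if j % 4 < 2 then 0 else 1)) := by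
    intro i j
    have h1 := level_passTime hL i j
    have h2 := level_passTime_succ hL i j
    rw [← hμ] at h1 h2
    rcases part_cases i (μ i j) (proc_passTime hL i j) with ⟨h, h3, h4⟩ | ⟨h, h3, h4, h5⟩ | ⟨h, h3⟩
    · omega
    · rw [h, h1, if_pos (by omega), Nat.add_zero]
    · rw [h, h1, if_neg (by omega)]
  have hsnap : ∀ i j k l, e (μ j (4 * l + 1)) < e (μ i (4 * k + 2)) ↔
      μ j (4 * l + 1) < μ i (4 * k + 2) := by
    intro i j k l
    have h1 := part_pass j (4 * l + 1)
    have h2 := part_pass i (4 * k + 2)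
    rw [if_pos (by omega), show (4 * l + 1) / 4 = l by omega] at h1
    rw [if_neg (by omega), show (4 * k + 2) / 4 = k by omega] at h2
    rw [he, ← hS (j, l) (i, k)]
    constructor
    · intro h
      by_contra hc
      rcases (not_lt.1 hc).lt_or_eq with h' | h'
      · exact lt_asymm h (some_lt h2 h1 h')
      · have := (hQ.il.eq_iff.1 h').2
        dsimp only at this
        omega
    · exact some_lt h1 h2
  obtain ⟨E', hF', hI, hev⟩ := exists_reorder hL hF e
    (fun s t h hst => (he s t).2 (key_proc s t h hst))
    (fun s t hs ht hst => by
      rw [he]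
      obtain ⟨s1, s2⟩ := accesses_level hs
      obtain ⟨t1, t2⟩ := accesses_level ht
      have h1 : part s = none := by simp [hpart, s1, s2]
      have h2 : part t = none := by simp [hpart, t1, t2]
      rw [key_none h1, key_none h2, Prod.Lex.toLex_lt_toLex]
      exact Or.inl hst)
    (fun t ht j l => by
      obtain ⟨k, hk⟩ := takesSnapshot_level hL ht
      have := hsnap (E.event t).proc j k l
      rw [← hk]
      exact this)
  have htr' : E'.Trace (fun i j => e (μ i j)) v w := by
    have hA : AnnouncedFor (fun i j => e (μ i j)) = AnnouncedFor μ := by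
      funext a b
      exact propext (hsnap b.1 a.1 b.2 a.2)
    refine ⟨⟨fun i j j' hj => (he _ _).2 (key_proc _ _ ?_ (hil.mono i hj)), fun i i' j j' h =>
      hil.inj _ _ _ _ (e.injective h)⟩, fun i k => ?_, fun i k => ?_, fun t ht => ?_⟩
    · rw [hμ, proc_passTime hL, proc_passTime hL]
    · rw [hev, htr.inv]
    · rw [hev, htr.resp, hA]
    · obtain ⟨s, rfl⟩ := e.surjective t
      rw [hev] at ht
      obtain ⟨i, k, h⟩ := htr.symb s ht
      exact ⟨i, k, h.imp (congrArg e) (congrArg e)⟩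
  refine ⟨E', hF', hI, htr'.hasInput hQ ?_, ?_⟩
  · have hp : ∀ i j, part (symbolTime μ i j) = some (Q i j) := by
      intro i j
      unfold symbolTime
      rw [part_pass]
      congr 2
      split_ifs <;> omega
    have hlt : ∀ i j i' j', Q i j < Q i' j' → e (symbolTime μ i j) < e (symbolTime μ i' j') :=
      fun i j i' j' h => (he _ _).2 (some_lt (hp i j) (hp i' j') h)
    intro i j i' j'
    refine ⟨hlt i j i' j', fun h => ?_⟩
    by_contra hc
    rcases (not_lt.1 hc).lt_or_eq with h' | h'
    · exact lt_asymm h (hlt _ _ _ _ h')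
    · obtain ⟨rfl, rfl⟩ := hQ.il.eq_iff.1 h'
      exact lt_irrefl _ h
  · rw [htr'.entries_eq]
    congr 1
    funext a b
    exact propext (hsnap b.1 a.1 b.2 a.2)

end Execution

end Reorder

/-! ### Sketches are the words with the entries of the execution -/

section Sketch

/-- A predicate that holds at `0`, and both holds and fails infinitely often, cuts `ℕ` into
intervals `[b k, e k)` where it holds and `[e k, b (k + 1))` where it fails. -/
theorem exists_blocks {p : ℕ → Prop} (h0 : p 0) (hp : ∀ N, ∃ t, N ≤ t ∧ p t)
    (hn : ∀ N, ∃ t, N ≤ t ∧ ¬ p t) :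
    ∃ b e : ℕ → ℕ, b 0 = 0 ∧ (∀ k, b k < e k ∧ e k < b (k + 1)) ∧
      (∀ k t, b k ≤ t → t < e k → p t) ∧ ∀ k t, e k ≤ t → t < b (k + 1) → ¬ p t := by
  classical
  set f : ℕ → ℕ := fun N => Nat.find (hp N) with hf
  set g : ℕ → ℕ := fun N => Nat.find (hn N) with hg
  have f1 : ∀ N, N ≤ f N ∧ p (f N) := fun N => Nat.find_spec (hp N)
  have f2 : ∀ N t, N ≤ t → t < f N → ¬ p t := fun N t h h' hc => Nat.find_min (hp N) h' ⟨h, hc⟩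
  have g1 : ∀ N, N ≤ g N ∧ ¬ p (g N) := fun N => Nat.find_spec (hn N)
  have g2 : ∀ N t, N ≤ t → t < g N → p t := fun N t h h' =>
    by_contra fun hc => Nat.find_min (hn N) h' ⟨h, hc⟩
  set b : ℕ → ℕ := fun k => (fun N => f (g N))^[k] 0 with hb
  have hbs : ∀ k, b (k + 1) = f (g (b k)) := fun k => Function.iterate_succ_apply' _ _ _
  have hbp : ∀ k, p (b k) := by
    intro k
    cases k with
    | zero => exact h0
    | succ k => rw [hbs]; exact (f1 _).2
  refine ⟨b, fun k => g (b k), rfl, fun k => ⟨?_, ?_⟩, fun k => g2 _, fun k t h1 h2 => ?_⟩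
  · exact lt_of_le_of_ne (g1 _).1 fun h =>
      (g1 (b k)).2 (by rw [← show b k = g (b k) from h]; exact hbp k)
  · rw [hbs]
    exact lt_of_le_of_ne (f1 _).1 fun h =>
      (g1 (b k)).2 (by rw [show g (b k) = f (g (b k)) from h]; exact (f1 _).2)
  · rw [hbs] at h2; exact f2 _ t h1 h2

theorem exists_mem_block {ℓ : ℕ → ℕ} (h0 : ℓ 0 = 0) (hl : ∀ k, ℓ k < ℓ (k + 1)) (t : ℕ) :
    ∃ k, ℓ k ≤ t ∧ t < ℓ (k + 1) := by
  induction t with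
  | zero => exact ⟨0, by omega, by have := hl 0; omega⟩
  | succ t ih =>
    obtain ⟨k, h1, h2⟩ := ih
    rcases Nat.lt_or_ge (t + 1) (ℓ (k + 1)) with h | h
    · exact ⟨k, by omega, h⟩
    · exact ⟨k + 1, h, by have := hl (k + 1); omega⟩

variable {n : ℕ} {P : Set SharedObject} {A : DistAlphabet n} {V : Algorithm P A} {E : Execution V}

/-- In a sketch, the invocation of `a` comes before the response of `b` if and only if its block is
not later, which means that `a` is in the view of `b`. -/
theorem Execution.IsSketch.hasEntries (hL : E.Live) {y : Word A} (hy : E.IsSketch y) :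
    HasEntries y E.entries := by
  classical
  obtain ⟨v, w, htr, -⟩ := exists_trace hL
  obtain ⟨u, I, R, hu, hur, hI, hR, hyw⟩ := hy
  set μ := E.passTime
  have hresp : ∀ r S, E.Responds r S ↔ ∃ o, entry v w (AnnouncedFor μ) o = (r, S) := by
    intro r S
    have : (r, S) ∈ E.entries ↔ (r, S) ∈ DRV.entries v w (AnnouncedFor μ) := by
      rw [htr.entries_eq]
    exact this
  have hself : ∀ o, AnnouncedFor μ o o := fun o => htr.il.mono _ (by omega)
  -- `α o` and `β o` are the blocks of the invocation and of the response of the operation `o`.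
  have hβ : ∀ o, ∃ k, u k = (entry v w (AnnouncedFor μ) o).2 := by
    intro o
    have : (entry v w (AnnouncedFor μ) o).2 ∈ Set.range u := by
      rw [hur]; exact ⟨_, (hresp _ _).2 ⟨o, rfl⟩⟩
    exact this
  choose β hβ using hβ
  have hmark : ∀ o k, (⟨o.1, o.2, v o.1 o.2⟩ : Marked A) ∈ (entry v w (AnnouncedFor μ) k).2 ↔
      AnnouncedFor μ o k := fun o k => mark_mem_entry.trans (by simp)
  have hα : ∀ o : OpId n, ∃ k, (⟨o.1, o.2, v o.1 o.2⟩ : Marked A) ∈ u k := fun o =>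
    ⟨β o, by rw [hβ, hmark]; exact hself o⟩
  set α : OpId n → ℕ := fun o => Nat.find (hα o) with hαdef
  have α_le : ∀ o k, (⟨o.1, o.2, v o.1 o.2⟩ : Marked A) ∈ u k ↔ α o ≤ k := fun o k =>
    ⟨fun h => Nat.find_min' (hα o) h, fun h => hu.monotone h (Nat.find_spec (hα o))⟩
  have hrel : ∀ a b, AnnouncedFor μ a b ↔ α a ≤ β b := by
    intro a b
    rw [← hmark, ← hβ, α_le]
  have memI : ∀ k a, a ∈ I k ↔ ∃ o : OpId n, a = ⟨o.1, o.2, v o.1 o.2⟩ ∧ α o = k := by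
    intro k a
    rw [(hI k).2]
    constructor
    · rintro ⟨h1, h2⟩
      have : u k ∈ {S | ∃ r, E.Responds r S} := by rw [← hur]; exact ⟨k, rfl⟩
      obtain ⟨r, hr⟩ := this
      obtain ⟨o, ho⟩ := (hresp _ _).1 hr
      have h3 : a ∈ (entry v w (AnnouncedFor μ) o).2 := by rw [ho]; exact h1
      obtain ⟨b, -, rfl⟩ := h3
      refine ⟨b, rfl, le_antisymm ((α_le _ _).1 h1) ?_⟩
      by_contra hc
      exact h2 _ (not_le.1 hc) ((α_le _ _).2 le_rfl)
    · rintro ⟨o, rfl, rfl⟩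
      refine ⟨(α_le _ _).2 le_rfl, fun j hj hc => ?_⟩
      have := (α_le _ _).1 hc
      omega
  have memR : ∀ k r, r ∈ R k ↔ ∃ o : OpId n, r = ⟨o.1, o.2, w o.1 o.2⟩ ∧ β o = k := by
    intro k r
    rw [(hR k).2, hresp]
    refine exists_congr fun o => ?_
    constructor
    · intro h
      refine ⟨(congrArg Prod.fst h).symm, hu.injective ?_⟩
      rw [hβ, h]
    · rintro ⟨rfl, rfl⟩
      rw [hβ]; rfl
  -- the starts of the blocks
  set blk : ℕ → List (Symbol A) := fun k => (I k).map (fun a => Symbol.inv a.1 a.2.2) ++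
          (R k).map (fun r => Symbol.resp r.1 r.2.2) with hblk
  set ℓ : ℕ → ℕ := fun K => ((List.range K).flatMap blk).length with hℓ
  have ℓ0 : ℓ 0 = 0 := rfl
  have ℓs : ∀ K, ℓ (K + 1) = ℓ K + (I K).length + (R K).length := by
    intro K
    simp only [hℓ, List.range_succ, List.flatMap_append, List.length_append]
    simp [hblk, add_assoc]
  have hval : ∀ K r s, (blk K)[r]? = some s → y (ℓ K + r) = s := by
    intro K r s h
    refine hyw (K + 1) _ s ?_
    rw [List.range_succ, List.flatMap_append, List.getElem?_append_right (Nat.le_add_right _ _)]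
    simpa [hℓ] using h
  have hvI : ∀ K r (h : r < (I K).length),
      y (ℓ K + r) = .inv ((I K)[r]).1 ((I K)[r]).2.2 := by
    intro K r h
    apply hval
    simp only [hblk]
    rw [List.getElem?_append_left (by simpa using h)]
    simp [h]
  have hvR : ∀ K r (h : r < (R K).length),
      y (ℓ K + ((I K).length + r)) = .resp ((R K)[r]).1 ((R K)[r]).2.2 := by
    intro K r h
    apply hval
    simp only [hblk]
    rw [List.getElem?_append_right (by simp)]
    simp [h]
  have hRpos : ∀ K, 0 < (R K).length := by
    intro K
    have : u K ∈ {S | ∃ r, E.Responds r S} := by rw [← hur]; exact ⟨K, rfl⟩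
    obtain ⟨r, hr⟩ := this
    exact List.length_pos_of_mem (((hR K).2 r).2 hr)
  have ℓlt : ∀ K, ℓ K < ℓ (K + 1) := fun K => by have := hRpos K; rw [ℓs]; omega
  have ℓmono : Monotone ℓ := monotone_nat_of_le_succ fun K => (ℓlt K).le
  -- the positions of the symbols of an operation
  set pI : OpId n → ℕ := fun o => (I (α o)).idxOf ⟨o.1, o.2, v o.1 o.2⟩ with hpI
  set pR : OpId n → ℕ := fun o => (R (β o)).idxOf ⟨o.1, o.2, w o.1 o.2⟩ with hpR
  have pI_lt : ∀ o, pI o < (I (α o)).length := fun o =>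
    List.idxOf_lt_length_iff.2 ((memI _ _).2 ⟨o, rfl, rfl⟩)
  have pR_lt : ∀ o, pR o < (R (β o)).length := fun o =>
    List.idxOf_lt_length_iff.2 ((memR _ _).2 ⟨o, rfl, rfl⟩)
  set Q : Fin n → ℕ → ℕ := fun i j =>
    if j % 2 = 0 then ℓ (α (i, j / 2)) + pI (i, j / 2)
    else ℓ (β (i, j / 2)) + ((I (β (i, j / 2))).length + pR (i, j / 2)) with hQ
  have hQe : ∀ i k, Q i (2 * k) = ℓ (α (i, k)) + pI (i, k) := by
    intro i k; simp [hQ]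
  have hQo : ∀ i k, Q i (2 * k + 1) = ℓ (β (i, k)) + ((I (β (i, k))).length + pR (i, k)) := by
    intro i k
    simp only [hQ]
    rw [if_neg (by omega), show (2 * k + 1) / 2 = k by omega]
  have hlt : ∀ a b : OpId n, Q a.1 (2 * a.2) < Q b.1 (2 * b.2 + 1) ↔ α a ≤ β b := by
    intro a b
    rw [hQe, hQo]
    constructor
    · intro h
      by_contra hc
      have h1 := ℓmono (Nat.succ_le_of_lt (not_le.1 hc))
      have h2 := ℓs (β b)
      have h3 := pR_lt b
      simp only [Nat.succ_eq_add_one] at h1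
      change _ < ℓ (β b) + ((I (β b)).length + pR b) at h
      change ℓ (α a) + pI a < _ at h
      omega
    · intro h
      have h3 := pI_lt a
      change ℓ (α a) + pI a < ℓ (β b) + ((I (β b)).length + pR b)
      rcases h.lt_or_eq with h | h
      · have h1 := ℓmono (Nat.succ_le_of_lt h)
        have h2 := ℓs (α a)
        simp only [Nat.succ_eq_add_one] at h1
        omega
      · rw [← h]; omega
  have hinv : ∀ i k, y (Q i (2 * k)) = .inv i (v i k) := by
    intro i k
    rw [hQe, hvI _ _ (pI_lt (i, k)),
      show (I (α (i, k)))[pI (i, k)]'(pI_lt (i, k)) = ⟨i, k, v i k⟩ from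
        List.getElem_idxOf (pI_lt (i, k))]
  have hrsp : ∀ i k, y (Q i (2 * k + 1)) = .resp i (w i k) := by
    intro i k
    rw [hQo, hvR _ _ (pR_lt (i, k)),
      show (R (β (i, k)))[pR (i, k)]'(pR_lt (i, k)) = ⟨i, k, w i k⟩ from
        List.getElem_idxOf (pR_lt (i, k))]
  have hproc : ∀ i j, (y (Q i j)).proc = i := by
    intro i j
    obtain ⟨k, rfl | rfl⟩ := Nat.even_or_odd' j
    · rw [hinv]; rfl
    · rw [hrsp]; rfl
  refine ⟨Q, v, w, ⟨⟨fun i => strictMono_nat_of_lt_succ fun j => ?_, fun i i' j j' h => ?_⟩,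
    fun t => ?_, hinv, hrsp⟩, ?_⟩
  · obtain ⟨k, rfl | rfl⟩ := Nat.even_or_odd' j
    · exact (hlt (i, k) (i, k)).2 ((hrel _ _).1 (hself _))
    · rw [show 2 * k + 1 + 1 = 2 * (k + 1) by ring]
      have h1 : ¬ AnnouncedFor μ (i, k + 1) (i, k) := fun h => by
        have := (htr.il.mono i).lt_iff_lt.1 h
        dsimp only at this
        omega
      rw [hrel] at h1
      have h2 := (hlt (i, k + 1) (i, k)).not.2 h1
      refine lt_of_le_of_ne (not_lt.1 h2) fun h => ?_
      have h3 := hrsp i k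
      rw [h, hinv] at h3
      cases h3
  · rw [← hproc i j, h, hproc]
  · obtain ⟨K, h1, h2⟩ := exists_mem_block ℓ0 ℓlt t
    rw [ℓs] at h2
    rcases Nat.lt_or_ge (t - ℓ K) (I K).length with h | h
    · obtain ⟨o, ho, hK⟩ := (memI K _).1 (List.getElem_mem h)
      refine ⟨o.1, 2 * o.2, ?_⟩
      rw [hQe]
      simp only [hpI]
      rw [hK, ← ho, List.Nodup.idxOf_getElem (hI K).1]
      omega
    · have h' : t - ℓ K - (I K).length < (R K).length := by omega
      obtain ⟨o, ho, hK⟩ := (memR K _).1 (List.getElem_mem h')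
      refine ⟨o.1, 2 * o.2 + 1, ?_⟩
      rw [hQo]
      simp only [hpR]
      rw [hK, ← ho, List.Nodup.idxOf_getElem (hR K).1]
      omega
  · rw [htr.entries_eq]
    congr 1
    funext a b
    exact propext ((hrel a b).trans (hlt a b).symm)

/-- A word whose entries are those of the execution alternates between runs of invocations and runs
of responses. The views are the sets of invocations before the ends of the runs of invocations, so
that these runs and the runs of responses are the blocks of a sketch. -/
theorem Execution.isSketch_of_hasEntries (hL : E.Live) {y : Word A}
    (hy : HasEntries y E.entries) : E.IsSketch y := by
  obtain ⟨v, w, htr, -⟩ := exists_trace hL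
  have hresp : ∀ r S, E.Responds r S ↔ ∃ o, entry v w (AnnouncedFor E.passTime) o = (r, S) := by
    intro r S
    have : (r, S) ∈ E.entries ↔ (r, S) ∈ DRV.entries v w (AnnouncedFor E.passTime) := by
      rw [htr.entries_eq]
    exact this
  rw [htr.entries_eq] at hy
  obtain ⟨Q, hQ, hsees⟩ := hy.presents
  rw [← hsees] at hresp
  clear hsees hy
  have hwf := hQ.wellFormed
  choose p r hpr using hQ.surj
  have hpr' : ∀ i j, p (Q i j) = i ∧ r (Q i j) = j := fun i j => hQ.il.eq_iff.1 (hpr _)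
  have hev : ∀ i k, (y (Q i (2 * k))).IsInv := fun i k => by rw [hQ.inv]; trivial
  have hod : ∀ i k, ¬ (y (Q i (2 * k + 1))).IsInv := fun i k => by rw [hQ.resp]; exact id
  have hInv : ∀ t, (y t).IsInv → ∃ k, r t = 2 * k := by
    intro t ht
    obtain ⟨k, hk | hk⟩ := Nat.even_or_odd' (r t)
    · exact ⟨k, hk⟩
    · rw [← hpr t, hk] at ht; exact absurd ht (hod _ _)
  have hResp : ∀ t, ¬ (y t).IsInv → ∃ k, r t = 2 * k + 1 := by
    intro t ht
    obtain ⟨k, hk | hk⟩ := Nat.even_or_odd' (r t)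
    · rw [← hpr t, hk] at ht; exact absurd (hev _ _) ht
    · exact ⟨k, hk⟩
  have hge : ∀ i j, j ≤ Q i j := fun i j => (hQ.il.mono i).le_apply
  obtain ⟨b, e, hb0, hbe, hbI, heR⟩ := exists_blocks (p := fun t => (y t).IsInv)
    ((hwf.2 0).2 (by simp))
    (fun N => ⟨Q (p 0) (2 * N), by have := hge (p 0) (2 * N); omega, hev _ _⟩)
    (fun N => ⟨Q (p 0) (2 * N + 1), by have := hge (p 0) (2 * N + 1); omega, hod _ _⟩)
  have hbmono : StrictMono b := strictMono_nat_of_lt_succ fun k => (hbe k).1.trans (hbe k).2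
  have hemono : StrictMono e := strictMono_nat_of_lt_succ fun k => (hbe k).2.trans (hbe (k + 1)).1
  have heb : ∀ {j k}, j < k → e j < b k := fun {j k} h =>
    lt_of_lt_of_le (hbe j).2 (hbmono.monotone h)
  -- `[b k, e k)` is a run of invocations, and `[e k, b (k + 1))` is a run of responses
  set u : ℕ → View A := fun k =>
    {m | ∃ o : OpId n, Q o.1 (2 * o.2) < e k ∧ m = ⟨o.1, o.2, v o.1 o.2⟩} with hu
  have mem_u : ∀ (o : OpId n) k, (⟨o.1, o.2, v o.1 o.2⟩ : Marked A) ∈ u k ↔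
      Q o.1 (2 * o.2) < e k := by
    intro o k
    constructor
    · rintro ⟨⟨i', k'⟩, h1, h2⟩
      obtain ⟨i, l⟩ := o
      simp only [Sigma.mk.injEq] at h2
      obtain ⟨rfl, h2⟩ := h2
      simp only [heq_eq_eq, Prod.mk.injEq] at h2
      obtain ⟨rfl, -⟩ := h2
      exact h1
    · intro h; exact ⟨o, h, rfl⟩
  set mk : ℕ → Marked A := fun t => ⟨p t, r t / 2, v (p t) (r t / 2)⟩ with hmk
  set rs : ℕ → Σ i : Fin n, ℕ × A.Resp i := fun t => ⟨p t, r t / 2, w (p t) (r t / 2)⟩ with hrs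
  have hmkQ : ∀ i k, mk (Q i (2 * k)) = ⟨i, k, v i k⟩ := by
    intro i k
    obtain ⟨h1, h2⟩ := hpr' i (2 * k)
    simp only [hmk]
    rw [h2, h1, show 2 * k / 2 = k by omega]
  have hrsQ : ∀ i k, rs (Q i (2 * k + 1)) = ⟨i, k, w i k⟩ := by
    intro i k
    obtain ⟨h1, h2⟩ := hpr' i (2 * k + 1)
    simp only [hrs]
    rw [h2, h1, show (2 * k + 1) / 2 = k by omega]
  -- the view of an operation whose response lies in the `k`-th block
  have view_eq : ∀ (o : OpId n) k, e k ≤ Q o.1 (2 * o.2 + 1) → Q o.1 (2 * o.2 + 1) < b (k + 1) →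
      entry v w (Sees Q) o = (⟨o.1, o.2, w o.1 o.2⟩, u k) := by
    intro o k h1 h2
    refine Prod.ext rfl ?_
    ext m
    refine exists_congr fun a => and_congr_left fun _ => ⟨fun h => ?_, fun h => lt_of_lt_of_le h h1⟩
    by_contra hc
    exact heR k _ (not_lt.1 hc) (lt_trans h h2) (hev _ _)
  have hblock : ∀ o : OpId n, ∃ k, e k ≤ Q o.1 (2 * o.2 + 1) ∧ Q o.1 (2 * o.2 + 1) < b (k + 1) := by
    intro o
    obtain ⟨k, h1, h2⟩ := exists_mem_block hb0 (fun k => hbmono (Nat.lt_succ_self k))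
      (Q o.1 (2 * o.2 + 1))
    refine ⟨k, ?_, h2⟩
    by_contra hc
    exact hod _ _ (hbI k _ h1 (not_le.1 hc))
  have hu_mono : StrictMono u := by
    refine strictMono_nat_of_lt_succ fun k => ⟨?_, fun h => ?_⟩
    · rintro m ⟨o, ho, rfl⟩
      exact ⟨o, ho.trans (hemono (Nat.lt_succ_self k)), rfl⟩
    · obtain ⟨l, hl⟩ := hInv (b (k + 1)) (hbI (k + 1) _ le_rfl (hbe (k + 1)).1)
      have hq : Q (p (b (k + 1))) (2 * l) = b (k + 1) := by rw [← hl, hpr]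
      have h1 := h ((mem_u (p (b (k + 1)), l) (k + 1)).2 (by rw [hq]; exact (hbe (k + 1)).1))
      rw [mem_u, hq] at h1
      have := (hbe k).2
      omega
  refine ⟨u, fun k => (List.range' (b k) (e k - b k)).map mk,
    fun k => (List.range' (e k) (b (k + 1) - e k)).map rs, hu_mono, ?_, fun k => ⟨?_, fun a => ?_⟩,
    fun k => ⟨?_, fun a => ?_⟩, ?_⟩
  · ext S
    constructor
    · rintro ⟨k, rfl⟩
      obtain ⟨l, hl⟩ := hResp (e k) (heR k _ le_rfl (hbe k).2)
      have hq : Q (p (e k)) (2 * l + 1) = e k := by rw [← hl, hpr]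
      exact ⟨_, (hresp _ _).2 ⟨(p (e k), l), view_eq _ k hq.ge (by rw [hq]; exact (hbe k).2)⟩⟩
    · rintro ⟨r, hr⟩
      obtain ⟨o, ho⟩ := (hresp _ _).1 hr
      obtain ⟨k, h1, h2⟩ := hblock o
      rw [view_eq o k h1 h2] at ho
      exact ⟨k, congrArg Prod.snd ho⟩
  · refine List.Nodup.map_on ?_ List.nodup_range'
    intro s hs t ht hst
    simp only [List.mem_range'_1] at hs ht
    obtain ⟨l, hl⟩ := hInv s (hbI k _ hs.1 (by omega))
    obtain ⟨l', hl'⟩ := hInv t (hbI k _ ht.1 (by omega))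
    rw [← hpr s, ← hpr t, hl, hl'] at hst ⊢
    rw [hmkQ, hmkQ] at hst
    simp only [Sigma.mk.injEq] at hst
    obtain ⟨h1, h2⟩ := hst
    rw [h1] at h2 ⊢
    simp only [heq_eq_eq, Prod.mk.injEq] at h2
    rw [h2.1]
  · simp only [List.mem_map, List.mem_range'_1]
    constructor
    · rintro ⟨t, ht, rfl⟩
      obtain ⟨l, hl⟩ := hInv t (hbI k _ ht.1 (by omega))
      have hq : Q (p t) (2 * l) = t := by rw [← hl, hpr]
      rw [← hq, hmkQ]
      refine ⟨(mem_u (p t, l) k).2 (by rw [hq]; omega), fun j hj h => ?_⟩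
      have h1 := (mem_u (p t, l) j).1 h
      have := heb hj
      rw [hq] at h1
      omega
    · rintro ⟨⟨o, ho, rfl⟩, h⟩
      refine ⟨Q o.1 (2 * o.2), ⟨?_, by omega⟩, hmkQ _ _⟩
      by_contra hc
      cases k with
      | zero => omega
      | succ k =>
        refine h k (Nat.lt_succ_self k) ((mem_u o k).2 ?_)
        by_contra hc'
        exact heR k _ (not_lt.1 hc') (not_le.1 hc) (hev _ _)
  · refine List.Nodup.map_on ?_ List.nodup_range'
    intro s hs t ht hst
    simp only [List.mem_range'_1] at hs ht
    obtain ⟨l, hl⟩ := hResp s (heR k _ hs.1 (by omega))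
    obtain ⟨l', hl'⟩ := hResp t (heR k _ ht.1 (by omega))
    rw [← hpr s, ← hpr t, hl, hl'] at hst ⊢
    rw [hrsQ, hrsQ] at hst
    simp only [Sigma.mk.injEq] at hst
    obtain ⟨h1, h2⟩ := hst
    rw [h1] at h2 ⊢
    simp only [heq_eq_eq, Prod.mk.injEq] at h2
    rw [h2.1]
  · simp only [List.mem_map, List.mem_range'_1]
    rw [hresp]
    constructor
    · rintro ⟨t, ht, rfl⟩
      obtain ⟨l, hl⟩ := hResp t (heR k _ ht.1 (by omega))
      have hq : Q (p t) (2 * l + 1) = t := by rw [← hl, hpr]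
      refine ⟨(p t, l), ?_⟩
      rw [view_eq (p t, l) k (by rw [hq]; exact ht.1) (by rw [hq]; omega), ← hq, hrsQ]
      dsimp only
      rw [hq]
    · rintro ⟨o, ho⟩
      obtain ⟨k', h1, h2⟩ := hblock o
      rw [view_eq o k' h1 h2] at ho
      obtain rfl := hu_mono.injective (congrArg Prod.snd ho)
      refine ⟨Q o.1 (2 * o.2 + 1), ⟨h1, by omega⟩, ?_⟩
      rw [hrsQ]
      exact congrArg Prod.fst ho
  · -- the concatenation of the first blocks is a prefix of `y`
    have hcat : ∀ K, ((List.range K).flatMap fun k =>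
        ((List.range' (b k) (e k - b k)).map mk).map (fun a => Symbol.inv a.1 a.2.2) ++
          ((List.range' (e k) (b (k + 1) - e k)).map rs).map (fun r => Symbol.resp r.1 r.2.2)) =
        (List.range (b K)).map y := by
      intro K
      induction K with
      | zero => simp [hb0]
      | succ K ih =>
        have h1 := (hbe K).1
        have h2 := (hbe K).2
        have hsplit : List.range (b (K + 1)) = List.range (b K) ++
            (List.range' (b K) (e K - b K) ++ List.range' (e K) (b (K + 1) - e K)) := by
          have e1 := List.range'_append_1 (s := b K) (m := e K - b K) (n := b (K + 1) - e K)
          rw [show b K + (e K - b K) = e K by omega] at e1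
          have e2 := List.range'_append_1 (s := 0) (m := b K) (n := b (K + 1) - b K)
          rw [e1, List.range_eq_range', List.range_eq_range',
            show e K - b K + (b (K + 1) - e K) = b (K + 1) - b K by omega]
          rw [Nat.zero_add] at e2
          rw [e2]
          congr 1
          omega
        rw [List.range_succ, List.flatMap_append, ih, hsplit, List.map_append, List.map_append]
        congr 1
        simp only [List.flatMap_cons, List.flatMap_nil, List.append_nil, List.map_map]
        congr 1
        · refine List.map_congr_left fun t ht => ?_
          rw [List.mem_range'_1] at ht
          obtain ⟨l, hl⟩ := hInv t (hbI K _ ht.1 (by omega))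
          have hq : Q (p t) (2 * l) = t := by rw [← hl, hpr]
          rw [Function.comp_apply, ← hq, hmkQ, hQ.inv]
        · refine List.map_congr_left fun t ht => ?_
          rw [List.mem_range'_1] at ht
          obtain ⟨l, hl⟩ := hResp t (heR K _ ht.1 (by omega))
          have hq : Q (p t) (2 * l + 1) = t := by rw [← hl, hpr]
          rw [Function.comp_apply, ← hq, hrsQ, hQ.resp]
    intro K m s hs
    rw [hcat, List.getElem?_map] at hs
    rcases Nat.lt_or_ge m (b K) with h | h
    · rw [List.getElem?_range h] at hs
      exact Option.some.inj hs
    · rw [List.getElem?_eq_none (by simpa using h)] at hs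
      cases hs

end Sketch

/-! ### Scheduling: executions with a prescribed interaction -/

section Schedule

variable {n : ℕ} {P : Set SharedObject} {A : DistAlphabet n} {V : Algorithm P A}

/-- Every process can always take a step. It may pick `v` if it has to pick an invocation, and it
may receive `w` if the underlying adversary has to reply. -/
theorem exists_step (C : Config V) (i : Fin n) (v : A.Inv i) (w : A.Resp i) :
    ∃ s : Event A × Config V, Step V C s.1 s.2 ∧ s.1.proc = i ∧
      ((C.loc i).phase = .choose → (s.2.loc i).phase = .before v) ∧
      ∀ v', (C.loc i).phase = .forwarded v' → (s.2.loc i).phase = .replied v' w := by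
  cases h : (C.loc i).phase with
  | choose =>
    exact ⟨(_, _), .pick C i v h, rfl, fun _ => by simp, fun _ h' => by (cases h')⟩
  | before v' =>
    cases h' : V.pre i (C.loc i).code with
    | access c op next =>
      exact ⟨(_, _), .preAccess C i v' c op next h h', rfl, fun h => by (cases h),
        fun _ h => by (cases h)⟩
    | finish b =>
      exact ⟨(_, _), .invoke C i v' h h', rfl, fun h => by (cases h), fun _ h => by (cases h)⟩
  | invoked v' =>
    exact ⟨(_, _), .announce C i v' h, rfl, fun h => by (cases h), fun _ h => by (cases h)⟩
  | announced v' =>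
    exact ⟨(_, _), .forward C i v' h, rfl, fun h => by (cases h), fun _ h => by (cases h)⟩
  | forwarded v' =>
    exact ⟨(_, _), .reply C i v' w h, rfl, fun h => by (cases h),
      fun _ h => by (cases h; simp)⟩
  | replied v' w' =>
    exact ⟨(_, _), .snapshot C i v' w' h, rfl, fun h => by (cases h), fun _ h => by (cases h)⟩
  | viewed v' w' S =>
    exact ⟨(_, _), .respond C i v' w' S h, rfl, fun h => by (cases h), fun _ h => by (cases h)⟩
  | after =>
    cases h' : V.post i (C.loc i).code with
    | access c op next =>
      exact ⟨(_, _), .postAccess C i c op next h h', rfl, fun h => by (cases h),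
        fun _ h => by (cases h)⟩
    | finish b => exact ⟨(_, _), .report C i b.1 b.2 h h', rfl, fun h => by (cases h),
        fun _ h => by (cases h)⟩

/-- The event and the configuration of the next step of process `i`, which picks `v` or receives
`w` if it has a choice. -/
noncomputable def Config.next (C : Config V) (i : Fin n) (v : A.Inv i) (w : A.Resp i) :
    Event A × Config V := (exists_step C i v w).choose

/-- The next step when the process to run is the one with index `m` in the schedule `ξ`, and the
`k`-th operation of process `i` is to have invocation `v i k` and response `w i k`. -/
noncomputable def schedStep (V : Algorithm P A) (ξ : ℕ → Fin n) (v : ∀ i, ℕ → A.Inv i)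
    (w : ∀ i, ℕ → A.Resp i) (s : Config V × ℕ) : Event A × Config V :=
  s.1.next (ξ s.2) (v _ (s.1.loc (ξ s.2)).count) (w _ (s.1.loc (ξ s.2)).count)

/-- The configuration and the number of completed turns after the next step. A turn lasts until the
process passes its next level. -/
noncomputable def schedNext (V : Algorithm P A) (ξ : ℕ → Fin n) (v : ∀ i, ℕ → A.Inv i)
    (w : ∀ i, ℕ → A.Resp i) (s : Config V × ℕ) : Config V × ℕ :=
  let C' := (schedStep V ξ v w s).2
  (C', if (C'.loc (ξ s.2)).level = (s.1.loc (ξ s.2)).level then s.2 else s.2 + 1)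

/-- The run in which the processes `ξ 0`, `ξ 1`, ... take turns: the configurations, with the numbers
of completed turns. -/
noncomputable def sched (V : Algorithm P A) (ξ : ℕ → Fin n) (v : ∀ i, ℕ → A.Inv i)
    (w : ∀ i, ℕ → A.Resp i) (t : ℕ) : Config V × ℕ :=
  (schedNext V ξ v w)^[t] (Config.initial V, 0)

theorem sched_succ (ξ : ℕ → Fin n) (v : ∀ i, ℕ → A.Inv i) (w : ∀ i, ℕ → A.Resp i) (t : ℕ) :
    sched V ξ v w (t + 1) = schedNext V ξ v w (sched V ξ v w t) :=
  Function.iterate_succ_apply' _ _ _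

/-- The execution in which the processes `ξ 0`, `ξ 1`, ... take turns. -/
noncomputable def scheduled (V : Algorithm P A) (ξ : ℕ → Fin n) (v : ∀ i, ℕ → A.Inv i)
    (w : ∀ i, ℕ → A.Resp i) : Execution V where
  conf t := (sched V ξ v w t).1
  event t := (schedStep V ξ v w (sched V ξ v w t)).1
  conf_zero := rfl
  step t := by
    rw [sched_succ]
    exact (exists_step _ _ _ _).choose_spec.1

section

variable {ξ : ℕ → Fin n} {v : ∀ i, ℕ → A.Inv i} {w : ∀ i, ℕ → A.Resp i}

theorem proc_scheduled (t : ℕ) :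
    ((scheduled V ξ v w).event t).proc = ξ (sched V ξ v w t).2 :=
  (exists_step _ _ _ _).choose_spec.2.1

theorem conf_scheduled_succ (t : ℕ) :
    (scheduled V ξ v w).conf (t + 1) = (schedNext V ξ v w (sched V ξ v w t)).1 :=
  congrArg Prod.fst (sched_succ ξ v w t)

theorem turn_succ (t : ℕ) : (sched V ξ v w (t + 1)).2 =
    if (scheduled V ξ v w).level (ξ (sched V ξ v w t).2) (t + 1) =
      (scheduled V ξ v w).level (ξ (sched V ξ v w t).2) t then (sched V ξ v w t).2
    else (sched V ξ v w t).2 + 1 := by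
  rw [Execution.level, Execution.level, conf_scheduled_succ, sched_succ]
  rfl

theorem turn_le (t : ℕ) : (sched V ξ v w t).2 ≤ t := by
  induction t with
  | zero => exact le_rfl
  | succ t ih => rw [turn_succ]; split_ifs <;> omega

theorem turn_mono : Monotone fun t => (sched V ξ v w t).2 :=
  monotone_nat_of_le_succ fun t => by
    show _ ≤ (sched V ξ v w (t + 1)).2
    rw [turn_succ]; split_ifs <;> omega

/-- The level of a process is the number of its completed turns. -/
theorem level_scheduled (i : Fin n) (t : ℕ) :
    (scheduled V ξ v w).level i t = Nat.count (fun m => ξ m = i) (sched V ξ v w t).2 := by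
  induction t with
  | zero => rw [Execution.level_zero]; rfl
  | succ t ih =>
    have hl := (scheduled V ξ v w).level_succ i t
    rw [turn_succ]
    by_cases hi : ξ (sched V ξ v w t).2 = i
    · rw [hi]
      rcases hl with hl | ⟨-, hl⟩
      · rw [if_pos hl, hl, ih]
      · rw [if_neg (by omega), hl, Nat.count_succ, if_pos hi, ih]
    · have : (scheduled V ξ v w).level i (t + 1) = (scheduled V ξ v w).level i t := by
        rcases hl with hl | ⟨hl, -⟩
        · exact hl
        · rw [proc_scheduled] at hl; exact absurd hl hi
      rw [this, ih]
      split_ifs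
      · rfl
      · rw [Nat.count_succ, if_neg hi, Nat.add_zero]

theorem exists_turn_ge (hV : V.WaitFree) (M : ℕ) : ∃ t, M ≤ (sched V ξ v w t).2 := by
  by_contra hb
  push Not at hb
  obtain ⟨t0, ht0⟩ : ∃ t0, ∀ t, t0 ≤ t → (sched V ξ v w t).2 = (sched V ξ v w t0).2 := by
    obtain ⟨N, ⟨t0, rfl⟩, hN⟩ := Set.exists_max_image (Set.range fun t => (sched V ξ v w t).2) id
      ((Set.finite_Iio M).subset (by rintro _ ⟨t, rfl⟩; exact hb t)) ⟨_, 0, rfl⟩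
    exact ⟨t0, fun t ht => le_antisymm (hN _ ⟨t, rfl⟩) (turn_mono ht)⟩
  have hinf : ((scheduled V ξ v w).stepTimes (ξ (sched V ξ v w t0).2)).Infinite := by
    refine (Set.Ici_infinite t0).mono fun t ht => ?_
    show ((scheduled V ξ v w).event t).proc = _
    rw [proc_scheduled, ht0 t ht]
  obtain ⟨t, ht⟩ := (scheduled V ξ v w).level_unbounded hV hinf M
  rw [level_scheduled] at ht
  have := Nat.count_le (p := fun m => ξ m = ξ (sched V ξ v w t0).2) (n := (sched V ξ v w t).2)
  have := hb t
  omega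

/-- A scheduled process that has picked an invocation or received a response has the prescribed
one. -/
theorem phase_scheduled (i : Fin n) (t : ℕ) :
    (∀ b, (((scheduled V ξ v w).conf t).loc i).phase = .before b →
      b = v i (((scheduled V ξ v w).conf t).loc i).count) ∧
    (∀ b c, (((scheduled V ξ v w).conf t).loc i).phase = .replied b c →
      c = w i (((scheduled V ξ v w).conf t).loc i).count) ∧
    ∀ b c S, (((scheduled V ξ v w).conf t).loc i).phase = .viewed b c S →
      c = w i (((scheduled V ξ v w).conf t).loc i).count := by
  induction t with
  | zero =>
    rw [(scheduled V ξ v w).conf_zero]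
    simp [Config.initial]
  | succ t ih =>
    by_cases hi : ((scheduled V ξ v w).event t).proc = i
    · obtain ⟨ih1, ih2, ih3⟩ := ih
      have hspec := (exists_step (sched V ξ v w t).1 (ξ (sched V ξ v w t).2)
        (v _ ((sched V ξ v w t).1.loc (ξ (sched V ξ v w t).2)).count)
        (w _ ((sched V ξ v w t).1.loc (ξ (sched V ξ v w t).2)).count)).choose_spec.2.2
      rw [proc_scheduled] at hi
      rw [hi] at hspec
      have hp : ((scheduled V ξ v w).event t).proc = i := by rw [proc_scheduled, hi]
      have hpick : (((scheduled V ξ v w).conf t).loc i).phase = .choose →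
          (((scheduled V ξ v w).conf (t + 1)).loc i).phase =
            .before (v i (((scheduled V ξ v w).conf t).loc i).count) := by
        intro h
        subst hi
        rw [conf_scheduled_succ]
        exact hspec.1 h
      have hreply : ∀ b, (((scheduled V ξ v w).conf t).loc i).phase = .forwarded b →
          (((scheduled V ξ v w).conf (t + 1)).loc i).phase =
            .replied b (w i (((scheduled V ξ v w).conf t).loc i).count) := by
        intro b h
        subst hi
        rw [conf_scheduled_succ]
        exact hspec.2 b h
      have hs := (scheduled V ξ v w).step t
      clear hspec hi
      generalize (scheduled V ξ v w).conf (t + 1) = C' at *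
      generalize (scheduled V ξ v w).event t = e at *
      generalize (scheduled V ξ v w).conf t = C at *
      cases hs with
      | pick i' b h =>
        obtain rfl : i' = i := hp
        have h' := hpick h
        simp only [Config.setLoc, Function.update_self] at h' ⊢
        rw [h']
        exact ⟨fun _ h => by (cases h; rfl), fun _ _ h => by (cases h), fun _ _ _ h => by (cases h)⟩
      | reply i' b c h =>
        obtain rfl : i' = i := hp
        have h' := hreply b h
        simp only [Config.setLoc, Function.update_self] at h' ⊢
        rw [h']
        exact ⟨fun _ h => by (cases h), fun _ _ h => by (cases h; rfl), fun _ _ _ h => by (cases h)⟩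
      | preAccess i' b c op next h h' =>
        obtain rfl : i' = i := hp
        simp only [Config.setLoc, Function.update_self]
        rw [h] at ih1 ⊢
        exact ⟨fun _ h => by (cases h; exact ih1 _ rfl), fun _ _ h => by (cases h),
          fun _ _ _ h => by (cases h)⟩
      | snapshot i' b c h =>
        obtain rfl : i' = i := hp
        simp only [Config.setLoc, Function.update_self]
        refine ⟨fun _ h => by (cases h), fun _ _ h => by (cases h), fun _ _ _ h' => ?_⟩
        cases h'
        exact ih2 _ _ h
      | postAccess i' c op next h h' =>
        obtain rfl : i' = i := hp
        simp only [Config.setLoc, Function.update_self]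
        rw [h]
        exact ⟨fun _ h => by (cases h), fun _ _ h => by (cases h), fun _ _ _ h => by (cases h)⟩
      | invoke i' _ _ _ | announce i' _ _ | forward i' _ _ | respond i' _ _ _ _
      | report i' _ _ _ _ =>
        obtain rfl : i' = i := hp
        simp only [Config.setLoc, Function.update_self]
        exact ⟨fun _ h => by (cases h), fun _ _ h => by (cases h), fun _ _ _ h => by (cases h)⟩
    · rw [(scheduled V ξ v w).loc_succ_of_ne hi]
      exact ih

theorem live_scheduled (hV : V.WaitFree) (hξ : ∀ i, {m | ξ m = i}.Infinite) :
    (scheduled V ξ v w).Live := by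
  intro i j
  obtain ⟨t, ht⟩ := exists_turn_ge (V := V) (ξ := ξ) (v := v) (w := w) hV
    (Nat.nth (fun m => ξ m = i) j + 1)
  exact ⟨t, by rw [level_scheduled]; exact (Nat.lt_nth_iff_count_lt (hξ i)).2 ht⟩

theorem Execution.Live.fair {E : Execution V} (h : E.Live) : E.Fair := fun i =>
  (Set.infinite_range_of_injective ((interleaving_passTime h).mono i).injective).mono (by
    rintro _ ⟨j, rfl⟩; exact proc_passTime h i j)

theorem trace_scheduled (hV : V.WaitFree) (hξ : ∀ i, {m | ξ m = i}.Infinite) :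
    (scheduled V ξ v w).Trace (scheduled V ξ v w).passTime v w := by
  have hL := live_scheduled (V := V) (v := v) (w := w) hV hξ
  obtain ⟨v', w', htr, -⟩ := Execution.exists_trace hL
  have hv : v' = v := by
    funext i k
    have h1 := htr.inv i k
    have hk := (scheduled V ξ v w).kind (Execution.proc_passTime hL i (4 * k))
    have hph := (phase_scheduled (V := V) (ξ := ξ) (v := v) (w := w) i
      ((scheduled V ξ v w).passTime i (4 * k))).1
    generalize (scheduled V ξ v w).event _ = e at hk h1
    cases hk with
    | code _ hp hs => rw [h1] at hs; cases hs
    | invoke b h0 =>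
      simp only [Event.invoke.injEq, true_and] at h1
      obtain ⟨h2, h3⟩ := h1
      rw [hph b h0, h2] at h3
      exact (eq_of_heq h3).symm
    | wait | announce | snapshot | respond => cases h1
  have hw : w' = w := by
    funext i k
    have h1 := htr.resp i k
    have hk := (scheduled V ξ v w).kind (Execution.proc_passTime hL i (4 * k + 3))
    have hph := (phase_scheduled (V := V) (ξ := ξ) (v := v) (w := w) i
      ((scheduled V ξ v w).passTime i (4 * k + 3))).2.2
    generalize (scheduled V ξ v w).event _ = e at hk h1
    cases hk with
    | code _ hp hs => rw [h1] at hs; cases hs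
    | respond b c S h0 =>
      simp only [Event.respond.injEq, true_and] at h1
      obtain ⟨h2, h3, -⟩ := h1
      rw [hph b c S h0, h2] at h3
      exact (eq_of_heq h3).symm
    | wait | announce | snapshot | invoke => cases h1
  rw [← hv, ← hw] at htr ⊢
  exact htr

theorem turn_passTime (hV : V.WaitFree) (hξ : ∀ i, {m | ξ m = i}.Infinite) (i : Fin n) (j : ℕ) :
    (sched V ξ v w ((scheduled V ξ v w).passTime i j)).2 = Nat.nth (fun m => ξ m = i) j := by
  have hL := live_scheduled (V := V) (v := v) (w := w) hV hξ
  have h1 := Execution.proc_passTime hL i j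
  have h2 := Execution.level_passTime hL i j
  rw [proc_scheduled] at h1
  rw [level_scheduled] at h2
  rw [← h2, Nat.nth_count (p := fun m => ξ m = i) h1, h2]

theorem passTime_scheduled_lt_iff (hV : V.WaitFree) (hξ : ∀ i, {m | ξ m = i}.Infinite) {κ}
    (hκ : ∀ i j, Nat.nth (fun m => ξ m = i) j = κ i j) :
    Interleaving.SameOrder (scheduled V ξ v w).passTime κ := by
  intro i j i' j'
  have hL := live_scheduled (V := V) (v := v) (w := w) hV hξ
  rw [Execution.passTime_lt_iff hL, level_scheduled, turn_passTime hV hξ, ← hκ, ← hκ]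
  exact Nat.lt_nth_iff_count_lt (hξ i)

/-- The first steps of a scheduled execution depend only on the first turns and operations. -/
theorem scheduled_congr {ξ' : ℕ → Fin n} {v' : ∀ i, ℕ → A.Inv i} {w' : ∀ i, ℕ → A.Resp i} {N : ℕ}
    (hξ : ∀ m ≤ N, ξ m = ξ' m) (hv : ∀ i, ∀ k ≤ N, v i k = v' i k)
    (hw : ∀ i, ∀ k ≤ N, w i k = w' i k) {t : ℕ} (ht : t ≤ N) :
    (scheduled V ξ v w).event t = (scheduled V ξ' v' w').event t := by
  have hstep : ∀ t ≤ N, sched V ξ v w t = sched V ξ' v' w' t →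
      schedStep V ξ v w (sched V ξ v w t) = schedStep V ξ' v' w' (sched V ξ' v' w' t) := by
    intro t ht h
    have h1 : (sched V ξ v w t).2 ≤ N := (turn_le t).trans ht
    have h2 : ∀ i, ((sched V ξ v w t).1.loc i).count ≤ N := fun i => by
      have h3 := (scheduled V ξ v w).count_eq i t
      have h4 := (scheduled V ξ v w).level_le i t
      change ((sched V ξ v w t).1.loc i).count = _ at h3
      omega
    rw [← h]
    unfold schedStep
    rw [← hξ _ h1, hv _ _ (h2 _), hw _ _ (h2 _)]
  have hs : ∀ t ≤ N, sched V ξ v w t = sched V ξ' v' w' t := by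
    intro t
    induction t with
    | zero => intro _; rfl
    | succ t ih =>
      intro ht
      have h := ih (by omega)
      have h1 : (sched V ξ v w t).2 ≤ N := (turn_le t).trans (by omega)
      rw [sched_succ, sched_succ, schedNext, schedNext, hstep t (by omega) h, ← h, hξ _ h1]
  exact congrArg Prod.fst (hstep t ht (hs t ht))

end

/-- Any interaction with the timed adversary occurs in an execution of any algorithm. -/
theorem exists_execution [NeZero n] (hV : V.WaitFree) {κ : Fin n → ℕ → ℕ} (hκ : Interleaving κ)
    (v : ∀ i, ℕ → A.Inv i) (w : ∀ i, ℕ → A.Resp i) :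
    ∃ (G : Execution V) (μ : Fin n → ℕ → ℕ), G.Live ∧ G.Trace μ v w ∧
      Interleaving.SameOrder μ κ := by
  obtain ⟨Q, hQ, hs, ho⟩ := hκ.exists_compress
  choose p q hpq using hs
  have hp : ∀ i t, p t = i ↔ ∃ j, Q i j = t := by
    intro i t
    constructor
    · rintro rfl; exact ⟨q t, hpq t⟩
    · rintro ⟨j, rfl⟩; exact (hQ.eq_iff.1 (hpq _)).1
  have hinf : ∀ i, {m | p m = i}.Infinite := by
    intro i
    have : {m | p m = i} = Set.range (Q i) := by ext t; exact hp i t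
    rw [this]
    exact Set.infinite_range_of_injective (hQ.mono i).injective
  refine ⟨scheduled V p v w, _, live_scheduled hV hinf, trace_scheduled hV hinf, ?_⟩
  intro i j i' j'
  rw [← ho]
  exact passTime_scheduled_lt_iff hV hinf (fun i j => nth_eq_of_strictMono (hQ.mono i) (hp i) j)
    i j i' j'

/-! ### Tight executions -/

/-- The execution with input `y` in which announcements immediately follow the invocations, and
snapshots immediately precede the responses. -/
noncomputable def tight (V : Algorithm P A) (y : Word A) (v : ∀ i, ℕ → A.Inv i)
    (w : ∀ i, ℕ → A.Resp i) : Execution V := scheduled V (fun m => (y (m / 2)).proc) v w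

theorem tight_spec (hV : V.WaitFree) {y : Word A} {Q : Fin n → ℕ → ℕ} {v : ∀ i, ℕ → A.Inv i}
    {w : ∀ i, ℕ → A.Resp i} (hy : Presents y Q v w) :
    (tight V y v w).Live ∧ (tight V y v w).HasInput y ∧
      (tight V y v w).entries = entries v w (Sees Q) := by
  -- each position of `y` is given two turns, for an invocation and its announcement, or for a
  -- snapshot and the response
  set κ : Fin n → ℕ → ℕ := fun i j => 2 * Q i (j / 2) + j % 2 with hκ
  have κmono : ∀ i, StrictMono (κ i) := by
    intro i
    refine strictMono_nat_of_lt_succ fun j => ?_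
    have := hy.il.mono i (Nat.lt_succ_self (j / 2))
    simp only [hκ, Nat.succ_eq_add_one] at *
    rcases Nat.mod_two_eq_zero_or_one j with h | h
    · rw [show (j + 1) / 2 = j / 2 by omega]; omega
    · rw [show (j + 1) / 2 = j / 2 + 1 by omega]; omega
  have hp : ∀ i t, (y (t / 2)).proc = i ↔ ∃ j, κ i j = t := by
    intro i t
    rw [hy.proc_iff]
    simp only [hκ]
    constructor
    · rintro ⟨j, hj⟩
      refine ⟨2 * j + t % 2, ?_⟩
      rw [show (2 * j + t % 2) / 2 = j by omega]
      omega
    · rintro ⟨j, hj⟩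
      exact ⟨j / 2, by omega⟩
  have hinf : ∀ i, {m | (y (m / 2)).proc = i}.Infinite := by
    intro i
    have : {m | (y (m / 2)).proc = i} = Set.range (κ i) := by ext t; exact hp i t
    rw [this]
    exact Set.infinite_range_of_injective (κmono i).injective
  have htr := trace_scheduled (v := v) (w := w) hV hinf
  have ho := passTime_scheduled_lt_iff (v := v) (w := w) hV hinf
    (fun i j => nth_eq_of_strictMono (κmono i) (hp i) j)
  refine ⟨live_scheduled hV hinf, htr.hasInput hy fun i j i' j' => ?_, ?_⟩
  · unfold Execution.symbolTime
    rw [ho]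
    simp only [hκ]
    have e1 : ∀ j, (4 * (j / 2) + 3 * (j % 2)) / 2 = j := fun j => by omega
    have e2 : ∀ j, (4 * (j / 2) + 3 * (j % 2)) % 2 = j % 2 := fun j => by omega
    rw [e1, e1, e2, e2]
    constructor
    · intro h; omega
    · intro h
      by_contra hc
      rcases (not_lt.1 hc).lt_or_eq with h' | h'
      · omega
      · have := (hy.il.eq_iff.1 h').2
        subst this
        omega
  · rw [tight, htr.entries_eq]
    congr 1
    funext a b
    apply propext
    unfold AnnouncedFor Sees
    rw [ho]
    simp only [hκ]
    rw [show (4 * a.2 + 1) / 2 = 2 * a.2 by omega, show (4 * b.2 + 2) / 2 = 2 * b.2 + 1 by omega]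
    omega

/-- Every turn takes at least one step, so the first `N` steps do not reach beyond position `N`. -/
theorem tight_congr {y y' : Word A} {v v' : ∀ i, ℕ → A.Inv i} {w w' : ∀ i, ℕ → A.Resp i} {N : ℕ}
    (hy : ∀ t ≤ N, (y t).proc = (y' t).proc) (hv : ∀ i, ∀ k ≤ N, v i k = v' i k)
    (hw : ∀ i, ∀ k ≤ N, w i k = w' i k) {t : ℕ} (ht : t ≤ N) :
    (tight V y v w).event t = (tight V y' v' w').event t :=
  scheduled_congr (fun m hm => hy _ (by omega)) hv hw ht

end Schedule

/-! ### Collecting the entries of all operations in registers -/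

section Collector

variable {n : ℕ} {P : Set SharedObject} {A : DistAlphabet n}

theorem Config.applyOp_mem_self {V : Algorithm P A} (C : Config V) (c : V.Cell)
    (op : (V.obj c).Op) : (C.applyOp c op).mem c = ((V.obj c).apply (C.mem c) op).1 := by
  simp [Config.applyOp]

theorem Config.applyOp_mem_of_ne {V : Algorithm P A} (C : Config V) {c d : V.Cell}
    (op : (V.obj c).Op) (h : d ≠ c) : (C.applyOp c op).mem d = C.mem d := by
  simp [Config.applyOp, h]

/-- The state of a process of the collecting algorithm: the entries that it knows, those that it
knew at its previous report, the number of its completed operations, and the number of accesses to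
the shared memory in the present block. -/
structure CollectorState (A : DistAlphabet n) where
  known : Set (Entry A)
  prev : Set (Entry A)
  done : ℕ
  pc : ℕ

/-- The collecting algorithm: after each response, process `i` writes the set of all entries it
knows to register `i`, then reads all registers and adds what it finds there. Its report is a
function `f` of what it knew at its previous report and of what it knows now. -/
def collector (hP : ∀ α : Type, register α ∈ P)
    (f : Set (Entry A) → Set (Entry A) → Report) : Algorithm P A where
  Cell := Fin n
  obj _ := register (Set (Entry A))
  obj_mem _ := hP _
  memStart _ := (∅ : Set (Entry A))
  State _ := CollectorState A
  start _ := ⟨∅, ∅, 0, 0⟩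
  pick _ s _ := s
  pre _ _ := .finish ()
  receive i s w S :=
    { s with known := insert (⟨i, s.done, w⟩, S) s.known, done := s.done + 1, pc := 0 }
  post i s :=
    if s.pc = 0 then
      .access i (some s.known : Option (Set (Entry A))) fun _ => { s with pc := 1 }
    else if h : s.pc - 1 < n then
      .access (⟨s.pc - 1, h⟩ : Fin n) (none : Option (Set (Entry A)))
        fun r : Option (Set (Entry A)) =>
          { s with known := s.known ∪ r.getD ∅, pc := s.pc + 1 }
    else .finish (f s.prev s.known, { s with prev := s.known })

variable {hP : ∀ α : Type, register α ∈ P} {f : Set (Entry A) → Set (Entry A) → Report}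

/-- The state of the code of process `i`. -/
def Config.cst (C : Config (collector hP f)) (i : Fin n) : CollectorState A := (C.loc i).code

/-- The content of register `i`. -/
def Config.cell (C : Config (collector hP f)) (i : Fin n) : Set (Entry A) := C.mem i

/-- The steps of process `i` of the collecting algorithm. -/
inductive CollectorStep (i : Fin n) (C C' : Config (collector hP f)) : Event A → Prop
  | quiet (e : Event A) (h1 : (C.loc i).phase ≠ .after) (h2 : C'.cst i = C.cst i)
      (h3 : C'.cell = C.cell) (h4 : (C'.loc i).count = (C.loc i).count)
      (h5 : ∀ i b, e ≠ .report i b) (h6 : ∀ i k w S, e ≠ .respond i k w S) : CollectorStep i C C' e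
  | respond (w : A.Resp i) (S : View A) (h1 : (C.loc i).phase ≠ .after)
      (h2 : C'.cst i = ⟨insert (⟨i, (C.cst i).done, w⟩, S) (C.cst i).known, (C.cst i).prev,
        (C.cst i).done + 1, 0⟩)
      (h3 : C'.cell = C.cell) (h4 : (C'.loc i).count = (C.loc i).count + 1)
      (h5 : (C'.loc i).phase = .after) : CollectorStep i C C' (.respond i (C.loc i).count w S)
  | write (h1 : (C.loc i).phase = .after) (hpc : (C.cst i).pc = 0)
      (h2 : C'.cst i = ⟨(C.cst i).known, (C.cst i).prev, (C.cst i).done, 1⟩)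
      (h3 : C'.cell = Function.update C.cell i (C.cst i).known)
      (h4 : (C'.loc i).count = (C.loc i).count)
      (h5 : (C'.loc i).phase = .after) : CollectorStep i C C' (.internal i)
  | read (j : Fin n) (h1 : (C.loc i).phase = .after) (hpc : (C.cst i).pc = j + 1)
      (h2 : C'.cst i = ⟨(C.cst i).known ∪ C.cell j, (C.cst i).prev, (C.cst i).done, j + 2⟩)
      (h3 : C'.cell = C.cell) (h4 : (C'.loc i).count = (C.loc i).count)
      (h5 : (C'.loc i).phase = .after) : CollectorStep i C C' (.internal i)
  | report (h1 : (C.loc i).phase = .after) (hpc : n < (C.cst i).pc)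
      (h2 : C'.cst i = ⟨(C.cst i).known, (C.cst i).known, (C.cst i).done, (C.cst i).pc⟩)
      (h3 : C'.cell = C.cell) (h4 : (C'.loc i).count = (C.loc i).count) :
      CollectorStep i C C' (.report i (f (C.cst i).prev (C.cst i).known))

theorem collector_post (i : Fin n) (s : CollectorState A) :
    (s.pc = 0 ∧ (collector hP f).post i s =
      .access (i : Fin n) (some s.known : Option (Set (Entry A))) fun _ => { s with pc := 1 }) ∨
    (∃ (_ : s.pc ≠ 0) (h : s.pc - 1 < n), (collector hP f).post i s =
      .access (⟨s.pc - 1, h⟩ : Fin n) (none : Option (Set (Entry A)))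
        fun r : Option (Set (Entry A)) => { s with known := s.known ∪ r.getD ∅, pc := s.pc + 1 }) ∨
    (n < s.pc ∧ (collector hP f).post i s =
      .finish (f s.prev s.known, { s with prev := s.known })) := by
  by_cases h0 : s.pc = 0
  · exact Or.inl ⟨h0, if_pos h0⟩
  · by_cases h1 : s.pc - 1 < n
    · exact Or.inr (Or.inl ⟨h0, h1, (if_neg h0).trans (dif_pos h1)⟩)
    · exact Or.inr (Or.inr ⟨by omega, (if_neg h0).trans (dif_neg h1)⟩)

theorem Step.collectorStep {C C' : Config (collector hP f)} {e : Event A} (h : Step _ C e C') :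
    CollectorStep e.proc C C' e := by
  cases h with
  | pick i v h =>
    exact .quiet _ (by simp [Event.proc, h]) (by simp [Config.cst, Config.setLoc, Event.proc]; rfl)
      rfl (by simp [Config.setLoc, Event.proc]) (by simp) (by simp)
  | preAccess i v c op next h h' => cases h'
  | invoke i v h h' =>
    exact .quiet _ (by simp [Event.proc, h]) (by simp [Config.cst, Config.setLoc, Event.proc]; rfl)
      rfl (by simp [Config.setLoc, Event.proc]) (by simp) (by simp)
  | announce i v h =>
    exact .quiet _ (by simp [Event.proc, h]) (by simp [Config.cst, Config.setLoc, Event.proc]; rfl)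
      rfl (by simp [Config.setLoc, Event.proc]) (by simp) (by simp)
  | forward i v h =>
    exact .quiet _ (by simp [Event.proc, h]) (by simp [Config.cst, Config.setLoc, Event.proc]; rfl)
      rfl (by simp [Config.setLoc, Event.proc]) (by simp) (by simp)
  | reply i v w h =>
    exact .quiet _ (by simp [Event.proc, h]) (by simp [Config.cst, Config.setLoc, Event.proc]; rfl)
      rfl (by simp [Config.setLoc, Event.proc]) (by simp) (by simp)
  | snapshot i v w h =>
    exact .quiet _ (by simp [Event.proc, h]) (by simp [Config.cst, Config.setLoc, Event.proc]; rfl)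
      rfl (by simp [Config.setLoc, Event.proc]) (by simp) (by simp)
  | respond i v w S h =>
    exact .respond w S (by simp [h]) (by simp [Config.cst, Config.setLoc, collector])
      rfl (by simp [Config.setLoc]) (by simp [Config.setLoc])
  | postAccess i c op next h h' =>
    rcases collector_post (hP := hP) (f := f) i (C.cst i) with ⟨h0, e⟩ | ⟨h0, h1, e⟩ | ⟨h0, e⟩
    · cases h'.symm.trans e
      refine .write h h0 ?_ ?_ (by simp [Config.setLoc, Event.proc, Config.applyOp])
        (by simp [Config.setLoc, Event.proc, h])
      · simp [Config.cst, Config.setLoc, Event.proc]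
      · funext j
        by_cases hj : j = i
        · subst hj
          exact (C.applyOp_mem_self _ _).trans
            (Function.update_self j (C.cst j).known C.cell).symm
        · refine Eq.trans ?_ (Function.update_of_ne hj (C.cst i).known C.cell).symm
          exact C.applyOp_mem_of_ne _ hj
    · cases h'.symm.trans e
      refine .read ⟨(C.cst i).pc - 1, h1⟩ h (by simp only [Event.proc]; omega) ?_ ?_
        (by simp [Config.setLoc, Event.proc, Config.applyOp])
        (by simp [Config.setLoc, Event.proc, h])
      · simp only [Config.cst, Config.setLoc, Event.proc, Function.update_self]
        congr 1
        show (C.cst i).pc + 1 = (C.cst i).pc - 1 + 2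
        omega
      · funext j
        by_cases hj : j = (⟨(C.cst i).pc - 1, h1⟩ : Fin n)
        · subst hj
          exact C.applyOp_mem_self _ _
        · exact C.applyOp_mem_of_ne _ hj
    · cases h'.symm.trans e
  | report i b s h h' =>
    rcases collector_post (hP := hP) (f := f) i (C.cst i) with ⟨h0, e⟩ | ⟨h0, h1, e⟩ | ⟨h0, e⟩
    · cases h'.symm.trans e
    · cases h'.symm.trans e
    cases h'.symm.trans e
    exact .report h (by simp only [Event.proc]; omega)
      (by simp [Config.cst, Config.setLoc, Event.proc])
      rfl (by simp [Config.setLoc, Event.proc])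

/-! ### The collecting algorithm is wait-free -/

/-- A bound for the number of steps that a process takes before it reports. -/
def Config.rank (C : Config (collector hP f)) (i : Fin n) : ℕ :=
  match (C.loc i).phase with
  | .choose => n + 10
  | .before _ => n + 9
  | .invoked _ => n + 8
  | .announced _ => n + 7
  | .forwarded _ => n + 6
  | .replied _ _ => n + 5
  | .viewed _ _ _ => n + 4
  | .after => n + 2 - (C.cst i).pc

theorem Step.rank_lt {C C' : Config (collector hP f)} {e : Event A} {p : Fin n}
    (h : Step _ C e C') (hp : e.proc = p) (hr : ∀ i b, e ≠ .report i b) : C'.rank p < C.rank p := by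
  have hc : CollectorStep p C C' e := hp ▸ h.collectorStep
  cases hc with
  | write h1 hpc h2 h3 h4 h5 =>
    simp only [Config.rank]
    rw [h1, h5, h2]; dsimp only; omega
  | read j h1 hpc h2 h3 h4 h5 =>
    have := j.2
    simp only [Config.rank]
    rw [h1, h5, h2]; dsimp only; omega
  | report => exact absurd rfl (hr _ _)
  | respond w S h1 h2 h3 h4 h5 =>
    simp only [Config.rank]
    rw [h5, h2]
    have := n.zero_le
    cases hph : (C.loc p).phase <;> first | exact absurd hph h1 | (dsimp only; omega)
  | quiet _ h1 h2 h3 h4 h5 h6 =>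
    subst hp
    cases h with
    | pick i v h => simp [Config.rank, Config.setLoc, Event.proc, h]
    | preAccess i v c op next h h' => cases h'
    | invoke i v h => simp [Config.rank, Config.setLoc, Event.proc, h]
    | announce i v h => simp [Config.rank, Config.setLoc, Event.proc, h]
    | forward i v h => simp [Config.rank, Config.setLoc, Event.proc, h]
    | reply i v w h => simp [Config.rank, Config.setLoc, Event.proc, h]
    | snapshot i v w h => simp [Config.rank, Config.setLoc, Event.proc, h]
    | respond i v w S h => exact absurd rfl (h6 _ _ _ _)
    | postAccess i c op next h h' => exact absurd h h1
    | report i b s h h' => exact absurd rfl (h5 _ _)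

theorem collector_waitFree : (collector (A := A) hP f).WaitFree := by
  intro E p hp
  by_contra hfin
  obtain ⟨N, hN⟩ := (Set.not_infinite.1 hfin).bddAbove
  have hno : ∀ t, N < t → ∀ b, E.event t ≠ .report p b := fun t ht b hb => by
    have := hN ⟨b, hb⟩; omega
  have hstep : ∀ t, N < t → ((E.event t).proc = p → (E.conf (t + 1)).rank p < (E.conf t).rank p) ∧
      ((E.event t).proc ≠ p → (E.conf (t + 1)).rank p = (E.conf t).rank p) := by
    refine fun t ht => ⟨fun h => ?_, fun h => ?_⟩
    · refine (E.step t).rank_lt h fun i b hb => ?_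
      rw [hb] at h
      obtain rfl : i = p := h
      exact hno t ht b hb
    · simp only [Config.rank, Config.cst, E.loc_succ_of_ne h]
  have hanti : ∀ s t, N < s → s ≤ t → (E.conf t).rank p ≤ (E.conf s).rank p := by
    intro s t hs hst
    induction t, hst using Nat.le_induction with
    | base => exact le_rfl
    | succ t ht ih =>
      have h1 := hstep t (by omega)
      by_cases h : (E.event t).proc = p
      · exact (h1.1 h).le.trans ih
      · exact (h1.2 h).le.trans ih
  have hdesc : ∀ r, ∃ s, N < s ∧ (E.conf s).rank p + r ≤ (E.conf (N + 1)).rank p := by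
    intro r
    induction r with
    | zero => exact ⟨N + 1, by omega, le_rfl⟩
    | succ r ih =>
      obtain ⟨s, hs, h⟩ := ih
      obtain ⟨t, ht, hst⟩ := hp.exists_gt s
      have h1 := hanti s t hs hst.le
      have h2 := (hstep t (by omega)).1 ht
      exact ⟨t + 1, by omega, by omega⟩
  obtain ⟨s, -, hs⟩ := hdesc ((E.conf (N + 1)).rank p + 1)
  omega

/-! ### What the processes know -/

namespace Execution

variable {E : Execution (collector (A := A) hP f)}

/-- The entries of the operations that are completed before time `t`. -/
def entriesBefore {P : Set SharedObject} {V : Algorithm P A} (E : Execution V) (t : ℕ) :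
    Set (Entry A) := {d | ∃ s < t, E.event s = .respond d.1.1 d.1.2.1 d.1.2.2 d.2}

theorem finite_entriesBefore {P : Set SharedObject} {V : Algorithm P A} (E : Execution V) (t : ℕ) :
    (E.entriesBefore t).Finite := by
  have hinj : Function.Injective fun d : Entry A => Event.respond d.1.1 d.1.2.1 d.1.2.2 d.2 := by
    rintro ⟨⟨i, k, w⟩, S⟩ ⟨⟨i', k', w'⟩, S'⟩ h
    simp only [Event.respond.injEq] at h
    obtain ⟨rfl, rfl, h, rfl⟩ := h
    obtain rfl := eq_of_heq h
    rfl
  refine (((Set.finite_Iio t).image E.event).preimage hinj.injOn).subset ?_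
  rintro d ⟨s, hs, h⟩
  exact ⟨s, hs, h⟩

theorem entriesBefore_mono {P : Set SharedObject} {V : Algorithm P A} (E : Execution V) :
    Monotone E.entriesBefore := by
  rintro s t hst d ⟨r, hr, h⟩
  exact ⟨r, by omega, h⟩

theorem collectorStep {p : Fin n} {t : ℕ} (h : (E.event t).proc = p) :
    CollectorStep p (E.conf t) (E.conf (t + 1)) (E.event t) := by
  subst h; exact (E.step t).collectorStep

theorem cst_succ_of_ne {p : Fin n} {t : ℕ} (h : (E.event t).proc ≠ p) :
    (E.conf (t + 1)).cst p = (E.conf t).cst p := by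
  unfold Config.cst
  rw [E.loc_succ_of_ne h]

theorem known_mono (p : Fin n) : Monotone fun t => ((E.conf t).cst p).known := by
  refine monotone_nat_of_le_succ fun t => ?_
  by_cases h : (E.event t).proc = p
  · have hc := collectorStep h
    generalize E.event t = e at hc
    cases hc with
    | quiet _ h1 h2 => rw [h2]
    | respond w S h1 h2 => rw [h2]; exact Set.subset_insert _ _
    | write h1 hpc h2 => rw [h2]
    | read j h1 hpc h2 => rw [h2]; exact Set.subset_union_left
    | report h1 hpc h2 => rw [h2]
  · rw [cst_succ_of_ne h]

theorem cell_succ_of_ne (j : Fin n) {t : ℕ} (h : (E.event t).proc ≠ j) :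
    (E.conf (t + 1)).cell j = (E.conf t).cell j := by
  obtain ⟨p, hp⟩ : ∃ p, (E.event t).proc = p := ⟨_, rfl⟩
  have hc := collectorStep hp
  rw [hp] at h
  generalize E.event t = e at hc
  cases hc with
  | quiet _ h1 h2 h3 => rw [h3]
  | respond w S h1 h2 h3 => rw [h3]
  | write h1 hpc h2 h3 => rw [h3]; exact Function.update_of_ne (Ne.symm h) _ _
  | read j h1 hpc h2 h3 => rw [h3]
  | report h1 hpc h2 h3 => rw [h3]

theorem cell_subset_known (j : Fin n) (t : ℕ) :
    (E.conf t).cell j ⊆ ((E.conf t).cst j).known := by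
  induction t with
  | zero => rw [E.conf_zero]; exact Set.empty_subset _
  | succ t ih =>
    by_cases h : (E.event t).proc = j
    · have hm := ih.trans (known_mono (E := E) j (Nat.le_succ t))
      dsimp only [Nat.succ_eq_add_one] at hm
      have hc := collectorStep h
      generalize E.event t = e at hc
      cases hc with
      | quiet _ h1 h2 h3 => rw [h3]; exact hm
      | respond w S h1 h2 h3 => rw [h3]; exact hm
      | write h1 hpc h2 h3 => rw [h3, h2, Function.update_self]
      | read j h1 hpc h2 h3 => rw [h3]; exact hm
      | report h1 hpc h2 h3 => rw [h3]; exact hm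
    · rw [cell_succ_of_ne j h, cst_succ_of_ne h]; exact ih

theorem cell_mono (j : Fin n) : Monotone fun t => (E.conf t).cell j := by
  refine monotone_nat_of_le_succ fun t => ?_
  by_cases h : (E.event t).proc = j
  · have hc := collectorStep h
    generalize E.event t = e at hc
    cases hc with
    | quiet _ h1 h2 h3 => rw [h3]
    | respond w S h1 h2 h3 => rw [h3]
    | write h1 hpc h2 h3 =>
      rw [h3, Function.update_self]; exact cell_subset_known j t
    | read j h1 hpc h2 h3 => rw [h3]
    | report h1 hpc h2 h3 => rw [h3]
  · rw [cell_succ_of_ne j h]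

theorem done_eq_count (p : Fin n) (t : ℕ) :
    ((E.conf t).cst p).done = ((E.conf t).loc p).count := by
  induction t with
  | zero => rw [E.conf_zero]; rfl
  | succ t ih =>
    by_cases h : (E.event t).proc = p
    · have hc := collectorStep h
      generalize E.event t = e at hc
      cases hc with
      | quiet _ h1 h2 h3 h4 => rw [h2, h4, ih]
      | respond w S h1 h2 h3 h4 => rw [h2, h4, ih]
      | write h1 hpc h2 h3 h4 => rw [h2, h4, ih]
      | read j h1 hpc h2 h3 h4 => rw [h2, h4, ih]
      | report h1 hpc h2 h3 h4 => rw [h2, h4, ih]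
    · rw [cst_succ_of_ne h, E.loc_succ_of_ne h, ih]

theorem known_subset (t : ℕ) : (∀ p, ((E.conf t).cst p).known ⊆ E.entriesBefore t) ∧
    ∀ j, (E.conf t).cell j ⊆ E.entriesBefore t := by
  suffices h : ∀ p, ((E.conf t).cst p).known ⊆ E.entriesBefore t from
    ⟨h, fun j => (cell_subset_known j t).trans (h j)⟩
  induction t with
  | zero => intro p; rw [E.conf_zero]; exact Set.empty_subset _
  | succ t ih =>
    intro p
    have hm := E.entriesBefore_mono (Nat.le_succ t)
    simp only [Nat.succ_eq_add_one] at hm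
    by_cases h : (E.event t).proc = p
    · have hc := collectorStep h
      have hd := done_eq_count (E := E) p t
      have he : ∀ w S, E.event t = .respond p ((E.conf t).loc p).count w S →
          ((⟨p, ((E.conf t).cst p).done, w⟩, S) : Entry A) ∈ E.entriesBefore (t + 1) := by
        intro w S h'
        rw [hd]
        exact ⟨t, by omega, h'⟩
      generalize E.event t = e at hc he
      cases hc with
      | quiet _ h1 h2 => rw [h2]; exact (ih p).trans hm
      | respond w S h1 h2 =>
        rw [h2]
        exact Set.insert_subset (he w S rfl) ((ih p).trans hm)
      | write h1 hpc h2 => rw [h2]; exact (ih p).trans hm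
      | read j h1 hpc h2 =>
        rw [h2]
        exact (Set.union_subset (ih p) ((cell_subset_known j t).trans (ih j))).trans hm
      | report h1 hpc h2 => rw [h2]; exact (ih p).trans hm
    · rw [cst_succ_of_ne h]; exact (ih p).trans hm

theorem mem_known_of_respond {p : Fin n} {t k : ℕ} {w : A.Resp p} {S : View A}
    (h : E.event t = .respond p k w S) :
    ((⟨p, k, w⟩, S) : Entry A) ∈ ((E.conf (t + 1)).cst p).known := by
  have hc := collectorStep (E := E) (p := p) (t := t) (by rw [h]; rfl)
  have hd := done_eq_count (E := E) p t
  generalize E.event t = e at hc h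
  cases hc with
  | quiet _ h1 h2 h3 h4 h5 h6 => exact absurd h (h6 _ _ _ _)
  | respond w' S' h1 h2 =>
    simp only [Event.respond.injEq, true_and] at h
    obtain ⟨rfl, h3, rfl⟩ := h
    obtain rfl := eq_of_heq h3
    rw [h2, ← hd]
    exact Set.mem_insert _ _
  | write => cases h
  | read => cases h
  | report => cases h

/-- The local state of a process does not change until its next step. -/
theorem exists_next_step (hF : E.Fair) (p : Fin n) (t : ℕ) :
    ∃ s, t ≤ s ∧ (E.event s).proc = p ∧ (E.conf s).loc p = (E.conf t).loc p := by
  classical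
  have hex : ∃ s, t ≤ s ∧ (E.event s).proc = p := by
    obtain ⟨s, hs, hst⟩ := (hF p).exists_gt t
    exact ⟨s, hst.le, hs⟩
  refine ⟨Nat.find hex, (Nat.find_spec hex).1, (Nat.find_spec hex).2, ?_⟩
  have : ∀ s, t ≤ s → s ≤ Nat.find hex → (E.conf s).loc p = (E.conf t).loc p := by
    intro s hs
    induction s, hs using Nat.le_induction with
    | base => intro _; rfl
    | succ s hs ih =>
      intro h
      rw [E.loc_succ_of_ne fun h' => Nat.find_min hex (Nat.lt_of_succ_le h) ⟨hs, h'⟩]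
      exact ih (by omega)
  exact this _ (Nat.find_spec hex).1 le_rfl

/-- Every process executes each of its accesses to the shared memory infinitely often. -/
theorem exists_access (hL : E.Live) (hF : E.Fair) (p : Fin n) (N c : ℕ) (hc : c ≤ n) :
    ∃ t, N ≤ t ∧ (E.event t).proc = p ∧ ((E.conf t).loc p).phase = .after ∧
      ((E.conf t).cst p).pc = c := by
  induction c with
  | zero =>
    obtain ⟨v, w, htr, -⟩ := exists_trace hL
    have hN : N ≤ E.passTime p (4 * N + 3) := by
      have := (htr.il.mono p).le_apply (x := 4 * N + 3); omega
    have hk := collectorStep (proc_passTime hL p (4 * N + 3))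
    have hr := htr.resp p N
    generalize E.event (E.passTime p (4 * N + 3)) = e at hk hr
    cases hk with
    | quiet _ h1 h2 h3 h4 h5 h6 => exact absurd hr (h6 _ _ _ _)
    | write => cases hr
    | read => cases hr
    | report => cases hr
    | respond w S h1 h2 h3 h4 h5 =>
      obtain ⟨s, hs, hp, hl⟩ := exists_next_step hF p (E.passTime p (4 * N + 3) + 1)
      refine ⟨s, by omega, hp, by rw [hl, h5], ?_⟩
      rw [Config.cst, hl]
      exact congrArg CollectorState.pc h2
  | succ c ih =>
    obtain ⟨t, ht, hp, hph, hpc⟩ := ih (by omega)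
    have hk := collectorStep hp
    have key : ((E.conf (t + 1)).loc p).phase = .after ∧ ((E.conf (t + 1)).cst p).pc = c + 1 := by
      generalize E.event t = e at hk
      cases hk with
      | quiet _ h1 => exact absurd hph h1
      | respond _ _ h1 => exact absurd hph h1
      | write h1 hpc' h2 h3 h4 h5 => rw [h2]; exact ⟨h5, by dsimp only; omega⟩
      | read j h1 hpc' h2 h3 h4 h5 => rw [h2]; exact ⟨h5, by dsimp only; omega⟩
      | report h1 hpc' => omega
    obtain ⟨s, hs, hp', hl⟩ := exists_next_step hF p (t + 1)
    refine ⟨s, by omega, hp', by rw [hl, key.1], ?_⟩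
    rw [Config.cst, hl]
    exact key.2

/-- Every entry is eventually known to every process: the process that responds writes it to its
register, and all others read that register later. -/
theorem exists_mem_known (hL : E.Live) (hF : E.Fair) {d : Entry A} (hd : d ∈ E.entries)
    (p : Fin n) : ∃ t, d ∈ ((E.conf t).cst p).known := by
  obtain ⟨⟨j, k, w⟩, S⟩ := d
  obtain ⟨s, hs⟩ := hd
  have h1 := mem_known_of_respond hs
  obtain ⟨t1, ht1, hp1, hph1, hpc1⟩ := exists_access hL hF j (s + 1) 0 (Nat.zero_le n)
  have hcell : ((⟨j, k, w⟩, S) : Entry A) ∈ (E.conf (t1 + 1)).cell j := by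
    have hm := known_mono (E := E) j ht1 h1
    have hk := collectorStep hp1
    generalize E.event t1 = e at hk
    cases hk with
    | quiet _ h1 => exact absurd hph1 h1
    | respond _ _ h1 => exact absurd hph1 h1
    | write h1 hpc' h2 h3 => rw [h3, Function.update_self]; exact hm
    | read j' h1 hpc' => omega
    | report h1 hpc' => omega
  obtain ⟨t2, ht2, hp2, hph2, hpc2⟩ := exists_access hL hF p (t1 + 1) (j + 1) j.2
  have hm := cell_mono (E := E) j ht2 hcell
  refine ⟨t2 + 1, ?_⟩
  have hk := collectorStep hp2
  generalize E.event t2 = e at hk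
  cases hk with
  | quiet _ h1 => exact absurd hph2 h1
  | respond _ _ h1 => exact absurd hph2 h1
  | write h1 hpc' => omega
  | read j' h1 hpc' h2 =>
    obtain rfl : j' = j := Fin.ext (by omega)
    rw [h2]; exact Or.inr hm
  | report h1 hpc' => have := j.2; omega

/-- The reports of a process of the collecting algorithm: `K m` is what it knows at its `m`-th
report, where `K 0` is empty and the reports are counted from `1`. -/
theorem exists_known_seq (hF : E.Fair) (p : Fin n) :
    ∃ K : ℕ → Set (Entry A), Monotone K ∧ (∀ m, (K m).Finite) ∧ (⋃ m, K m) = E.entries ∧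
      E.numNo p = {m | f (K m) (K (m + 1)) = .no}.encard := by
  classical
  have hL := E.live collector_waitFree hF
  set R : ℕ → Prop := fun t => ∃ b, E.event t = .report p b with hR
  have hinf : (Set.ofPred R).Infinite := collector_waitFree E p (hF p)
  -- nothing is known before the first report, hence the shift
  set K : ℕ → Set (Entry A) := fun m =>
    match m with
    | 0 => ∅
    | m + 1 => ((E.conf (Nat.nth R m)).cst p).known with hK
  have Ks : ∀ m, K (m + 1) = ((E.conf (Nat.nth R m)).cst p).known := fun m => rfl
  have hproc : ∀ t, R t → (E.event t).proc = p := by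
    rintro t ⟨b, hb⟩; rw [hb]; rfl
  have hprev : ∀ t, ((E.conf t).cst p).prev = K (Nat.count R t) := by
    intro t
    induction t with
    | zero => rw [E.conf_zero]; rfl
    | succ t ih =>
      rw [Nat.count_succ]
      by_cases h : (E.event t).proc = p
      · have hc := collectorStep h
        have hRt : R t ↔ ∃ b, E.event t = .report p b := Iff.rfl
        by_cases hr : R t
        · rw [if_pos hr, Ks, Nat.nth_count hr]
          obtain ⟨b, hb⟩ := hRt.1 hr
          generalize E.event t = e at hc hb
          cases hc with
          | quiet _ h1 h2 h3 h4 h5 => exact absurd hb (h5 _ _)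
          | respond => cases hb
          | write => cases hb
          | read => cases hb
          | report h1 hpc h2 => rw [h2]
        · rw [if_neg hr]
          refine Eq.trans ?_ ih
          have hr' : ∀ b, E.event t ≠ .report p b := fun b hb => hr ⟨b, hb⟩
          generalize E.event t = e at hc hr'
          cases hc with
          | quiet _ h1 h2 => rw [h2]
          | respond w S h1 h2 => rw [h2]
          | write h1 hpc h2 => rw [h2]
          | read j h1 hpc h2 => rw [h2]
          | report => exact absurd rfl (hr' _)
      · rw [cst_succ_of_ne h, ih, if_neg (fun hr => h (hproc t hr)), Nat.add_zero]
  have hrep : ∀ m, E.event (Nat.nth R m) = .report p (f (K m) (K (m + 1))) := by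
    intro m
    obtain ⟨b, hb⟩ := Nat.nth_mem_of_infinite hinf m
    have hc := collectorStep (hproc _ (Nat.nth_mem_of_infinite hinf m))
    have hp := hprev (Nat.nth R m)
    rw [Nat.count_nth_of_infinite hinf] at hp
    rw [← hp, Ks]
    generalize E.event (Nat.nth R m) = e at hc hb
    cases hc with
    | quiet _ h1 h2 h3 h4 h5 => exact absurd hb (h5 _ _)
    | respond => cases hb
    | write => cases hb
    | read => cases hb
    | report h1 hpc h2 => rfl
  refine ⟨K, monotone_nat_of_le_succ fun m => ?_, fun m => ?_, ?_, ?_⟩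
  · cases m with
    | zero => exact Set.empty_subset _
    | succ m =>
      rw [Ks, Ks]
      exact known_mono (E := E) p (Nat.nth_monotone hinf (Nat.le_succ m))
  · cases m with
    | zero => exact Set.finite_empty
    | succ m => exact (E.finite_entriesBefore _).subset ((known_subset _).1 p)
  · ext d
    simp only [Set.mem_iUnion]
    constructor
    · rintro ⟨m, hm⟩
      cases m with
      | zero => exact hm.elim
      | succ m =>
        obtain ⟨s, -, hs⟩ := (known_subset _).1 p hm
        exact ⟨s, hs⟩
    · intro hd
      obtain ⟨t, ht⟩ := exists_mem_known hL hF hd p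
      exact ⟨t + 1, known_mono (E := E) p (Nat.nth_strictMono hinf).le_apply ht⟩
  · have : {t | E.event t = .report p .no} =
        Nat.nth R '' {m | f (K m) (K (m + 1)) = .no} := by
      ext t
      constructor
      · intro ht
        have hr : R t := ⟨_, ht⟩
        refine ⟨Nat.count R t, ?_, Nat.nth_count hr⟩
        have h1 := hrep (Nat.count R t)
        rw [Nat.nth_count hr, show E.event t = .report p .no from ht] at h1
        simp only [Event.report.injEq, true_and] at h1
        exact h1.symm
      · rintro ⟨m, hm, rfl⟩
        show E.event _ = _
        rw [hrep, show f (K m) (K (m + 1)) = .no from hm]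
    rw [numNo, this, (Nat.nth_injective hinf).encard_image]

end Execution

end Collector

/-! ### Weak deciders from rules on finite sets of entries -/

section Classes

variable {n : ℕ} {P : Set SharedObject} {A : DistAlphabet n}

/-- The collecting algorithm predictively weakly decides `L` if its rule, on every increasing
sequence of finite sets that exhausts the entries, reports `no` infinitely often when the input is
not in `L`, and only finitely often when all words with these entries are in `L`. Otherwise the input
is in `L`, but another word with the same entries is not: that word is a sketch, and it is the input
of an indistinguishable execution. -/
theorem mem_PWD_of_rule [NeZero n] (hP : ∀ α : Type, register α ∈ P) {L : Set (Word A)}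
    (hwf : ∀ x ∈ L, WellFormed x) (f : Set (Entry A) → Set (Entry A) → Report)
    (hf : ∀ (μ : Fin n → ℕ → ℕ) (v : ∀ i, ℕ → A.Inv i) (w : ∀ i, ℕ → A.Resp i) (x : Word A)
      (Q : Fin n → ℕ → ℕ) (K : ℕ → Set (Entry A)), Interleaving μ → Presents x Q v w →
      Interleaving.SameOrder Q (Execution.symbolTime μ) → Monotone K → (∀ m, (K m).Finite) →
      (⋃ m, K m) = entries v w (AnnouncedFor μ) →
      ((∀ z, HasEntries z (entries v w (AnnouncedFor μ)) → z ∈ L) → x ∈ L →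
        {m | f (K m) (K (m + 1)) = .no}.Finite) ∧
      (x ∉ L → {m | f (K m) (K (m + 1)) = .no}.Infinite)) :
    (⟨A, L⟩ : Lang n) ∈ PWD n P := by
  refine ⟨hwf, collector hP f, collector_waitFree, fun E hF => ?_⟩
  have hL := E.live collector_waitFree hF
  obtain ⟨v, w, htr, -⟩ := Execution.exists_trace hL
  obtain ⟨x, Q, hx, hQ, hE⟩ := htr.exists_input
  have hent := htr.entries_eq
  refine ⟨x, hE, fun hxL => ?_, fun hxL p => ?_⟩
  · by_cases hall : ∀ z, HasEntries z E.entries → z ∈ L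
    · refine Or.inl fun p => ?_
      obtain ⟨K, h1, h2, h3, h4⟩ := Execution.exists_known_seq hF p
      rw [h4, Set.encard_lt_top_iff]
      exact (hf _ v w x Q K htr.il hx hQ h1 h2 (h3.trans hent)).1 (hent ▸ hall) hxL
    · by_cases hp : ∃ p, E.numNo p = ⊤
      · push Not at hall
        obtain ⟨z, hz, hzL⟩ := hall
        obtain ⟨E', h1, h2, h3, -⟩ := Execution.exists_indist_of_hasEntries hL hF hz
        exact Or.inr ⟨hp, z, Execution.isSketch_of_hasEntries hL hz, hzL, E', h1, h2, h3⟩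
      · push Not at hp
        exact Or.inl fun p => lt_top_iff_ne_top.2 (hp p)
  · obtain ⟨K, h1, h2, h3, h4⟩ := Execution.exists_known_seq hF p
    rw [h4, Set.encard_eq_top_iff]
    exact (hf _ v w x Q K htr.il hx hQ h1 h2 (h3.trans hent)).2 hxL

/-! ### What a strong decider decides -/

variable {V : Algorithm P A} {L : Set (Word A)}

theorem Step.post_of_report {C C' : Config V} {p : Fin n} {b : Report}
    (h : Step V C (.report p b) C') : (C.loc p).phase = .after ∧
      ∃ s, V.post p (C.loc p).code = .finish (b, s) := by
  cases h with
  | report _ _ s h h' => exact ⟨h, s, h'⟩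

theorem Step.eq_report {C C' : Config V} {e : Event A} {p : Fin n} {b : Report} {s : V.State p}
    (h : Step V C e C') (hp : e.proc = p) (h1 : (C.loc p).phase = .after)
    (h2 : V.post p (C.loc p).code = .finish (b, s)) : e = .report p b := by
  subst hp
  cases h with
  | pick i v h => cases h.symm.trans h1
  | preAccess i v c op next h => cases h.symm.trans h1
  | invoke i v h => cases h.symm.trans h1
  | announce i v h => cases h.symm.trans h1
  | forward i v h => cases h.symm.trans h1
  | reply i v w h => cases h.symm.trans h1
  | snapshot i v w h => cases h.symm.trans h1
  | respond i v w S h => cases h.symm.trans h1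
  | postAccess i c op next h h' => cases h'.symm.trans h2
  | report i b' s' h h' => cases h'.symm.trans h2; rfl

namespace Execution

theorem numNo_pos {E : Execution V} {p : Fin n} :
    0 < E.numNo p ↔ ∃ t, E.event t = .report p .no := by
  rw [numNo, Set.encard_pos]; rfl

theorem Indist.numNo_pos {E E' : Execution V} (h : E.Indist E') (hF' : E'.Fair)
    {p : Fin n} (hp : 0 < E.numNo p) : 0 < E'.numNo p := by
  classical
  obtain ⟨t, ht⟩ := Execution.numNo_pos.1 hp
  have hmem : t ∈ E.stepTimes p := by
    show (E.event t).proc = p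
    rw [ht]; rfl
  set k := Nat.count (fun t => t ∈ E.stepTimes p) t with hk
  have hnth : Nat.nth (fun t => t ∈ E.stepTimes p) k = t :=
    Nat.nth_count (p := fun t => t ∈ E.stepTimes p) hmem
  have hs := E.step t
  rw [ht] at hs
  obtain ⟨h1, s, h2⟩ := hs.post_of_report
  have hloc := h p k
  rw [localSeq, localSeq, hnth] at hloc
  rw [hloc] at h1 h2
  exact Execution.numNo_pos.2 ⟨_, (E'.step _).eq_report
    (Nat.nth_mem_of_infinite (p := fun t => t ∈ E'.stepTimes p) (hF' p) k) h1 h2⟩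

theorem Indist.symm {E E' : Execution V} (h : E.Indist E') : E'.Indist E := fun p k => (h p k).symm

end Execution

namespace Algorithm.PredStronglyDecides

/-- A strong decider that reports `no` does so because some word with the same entries as the
execution is not in the language. -/
theorem exists_hasEntries [NeZero n] (hD : V.PredStronglyDecides L) (hV : V.WaitFree)
    {E : Execution V} (hF : E.Fair) {p : Fin n} (hp : 0 < E.numNo p) :
    ∃ z, HasEntries z E.entries ∧ z ∉ L := by
  have hL := E.live hV hF
  obtain ⟨v, w, htr, -⟩ := Execution.exists_trace hL
  obtain ⟨z, hz⟩ := Execution.exists_hasEntries htr.il v w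
  rw [← htr.entries_eq] at hz
  by_cases hzL : z ∈ L
  · -- the algorithm also reports `no` in an indistinguishable execution with input `z`, which has
    -- to be justified
    obtain ⟨E', h1, h2, h3, h4⟩ := Execution.exists_indist_of_hasEntries hL hF hz
    have hp' := h2.symm.numNo_pos h1 hp
    obtain ⟨x, hx, hin, -⟩ := hD E' h1
    obtain rfl := hx.unique h3
    rcases hin hzL with h0 | ⟨-, y, hy, hyL, -⟩
    · exact absurd (h0 p) hp'.ne'
    · exact ⟨y, h4 ▸ hy.hasEntries (E'.live hV h1), hyL⟩
  · exact ⟨z, hz, hzL⟩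

theorem exists_no (hD : V.PredStronglyDecides L) {E : Execution V} (hF : E.Fair) {x : Word A}
    (hx : E.HasInput x) (hxL : x ∉ L) : ∃ p t, E.event t = .report p .no := by
  obtain ⟨x', hx', -, hout⟩ := hD E hF
  obtain rfl := hx'.unique hx
  obtain ⟨p, hp⟩ := hout hxL
  exact ⟨p, Execution.numNo_pos.1 hp⟩

/-- The first `no` in the tight execution of a word outside of the language depends on a finite part
of the word. Every word that agrees with it there has the same entries as some word outside of the
language. -/
theorem exists_bound [NeZero n] (hD : V.PredStronglyDecides L) (hV : V.WaitFree) {y : Word A}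
    {Q : Fin n → ℕ → ℕ} {v : ∀ i, ℕ → A.Inv i} {w : ∀ i, ℕ → A.Resp i} (hy : Presents y Q v w)
    (hyL : y ∉ L) : ∃ N, ∀ (y' : Word A) (Q' : Fin n → ℕ → ℕ) (v' : ∀ i, ℕ → A.Inv i)
      (w' : ∀ i, ℕ → A.Resp i), Presents y' Q' v' w' → (∀ t ≤ N, (y t).proc = (y' t).proc) →
      (∀ i, ∀ k ≤ N, v i k = v' i k) → (∀ i, ∀ k ≤ N, w i k = w' i k) →
      ∃ z, HasEntries z (entries v' w' (Sees Q')) ∧ z ∉ L := by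
  obtain ⟨h1, h2, -⟩ := tight_spec hV hy
  obtain ⟨p, N, hN⟩ := hD.exists_no h1.fair h2 hyL
  refine ⟨N, fun y' Q' v' w' hy' hp hv hw => ?_⟩
  obtain ⟨h1', -, h3'⟩ := tight_spec hV hy'
  rw [← h3']
  refine hD.exists_hasEntries hV h1'.fair (p := p) (Execution.numNo_pos.2 ⟨N, ?_⟩)
  rw [← tight_congr hp hv hw le_rfl, hN]

/-- An execution in which the input is not in the language has the same entries as some word that is
not in the language. -/
theorem exists_of_input [NeZero n] (hD : V.PredStronglyDecides L) (hV : V.WaitFree)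
    {μ : Fin n → ℕ → ℕ} (hμ : Interleaving μ) {x : Word A} {Q : Fin n → ℕ → ℕ}
    {v : ∀ i, ℕ → A.Inv i} {w : ∀ i, ℕ → A.Resp i} (hx : Presents x Q v w)
    (hQ : Interleaving.SameOrder Q (Execution.symbolTime μ)) (hxL : x ∉ L) :
    ∃ z, HasEntries z (entries v w (AnnouncedFor μ)) ∧ z ∉ L := by
  obtain ⟨G, μ', hG, htr, ho⟩ := exists_execution hV hμ v w
  have hin : G.HasInput x := htr.hasInput hx fun i j i' j' =>
    (hQ i j i' j').trans (ho _ _ _ _).symm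
  obtain ⟨p, hp⟩ := hD.exists_no hG.fair hin hxL
  have := hD.exists_hasEntries hV hG.fair (Execution.numNo_pos.2 hp)
  rwa [htr.entries_eq, show AnnouncedFor μ' = AnnouncedFor μ from
    funext fun a => funext fun b => propext (ho _ _ _ _)] at this

end Algorithm.PredStronglyDecides

/-! ### Strongly decidable languages are weakly decidable -/

/-- However the entries `D` are completed to those of a word, there is a word with these entries
that is not in `L`. -/
def Refutes (L : Set (Word A)) (D : Set (Entry A)) : Prop :=
  ∀ z Δ, HasEntries z Δ → D ⊆ Δ → ∃ z', HasEntries z' Δ ∧ z' ∉ L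

theorem Refutes.mono {D D' : Set (Entry A)} (h : Refutes L D) (hD : D ⊆ D') : Refutes L D' :=
  fun z Δ hz hΔ => h z Δ hz (hD.trans hΔ)

theorem exists_subset_of_monotone {α : Type*} {K : ℕ → Set α} (hK : Monotone K) {D : Set α}
    (hD : D.Finite) (hs : D ⊆ ⋃ m, K m) : ∃ m, D ⊆ K m := by
  induction D, hD using Set.Finite.induction_on with
  | empty => exact ⟨0, Set.empty_subset _⟩
  | @insert a D _ _ ih =>
    obtain ⟨m, hm⟩ := ih ((Set.subset_insert a D).trans hs)
    obtain ⟨k, hk⟩ := Set.mem_iUnion.1 (hs (Set.mem_insert a D))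
    exact ⟨max m k, Set.insert_subset (hK (le_max_right m k) hk)
      (hm.trans (hK (le_max_left m k)))⟩

/-- If some word with the entries `Δ` is not in `L`, then a finite part of `Δ` shows this: merge
the beginning of that word with any other completion of the part. -/
theorem Algorithm.PredStronglyDecides.exists_refutes [NeZero n] (hD : V.PredStronglyDecides L)
    (hV : V.WaitFree) {z : Word A} {Δ : Set (Entry A)} (hz : HasEntries z Δ) (hzL : z ∉ L) :
    ∃ D ⊆ Δ, D.Finite ∧ Refutes L D := by
  obtain ⟨Q, v, w, hz, rfl⟩ := hz
  obtain ⟨N, hN⟩ := hD.exists_bound hV hz hzL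
  refine ⟨entry v w (Sees Q) '' {o | o.2 ≤ N + 1}, Set.image_subset_range _ _,
    Set.Finite.image _ ((Set.finite_univ.prod (Set.finite_Iic (N + 1))).subset fun o ho =>
      ⟨Set.mem_univ _, ho⟩), ?_⟩
  rintro z' Δ ⟨Q', v', w', hz', rfl⟩ hs
  have hmem : ∀ o : OpId n, o.2 ≤ N + 1 → entry v w (Sees Q) o ∈ entries v' w' (Sees Q') :=
    fun o ho => hs ⟨o, ho, rfl⟩
  obtain ⟨y, R, hy, hR, hyz⟩ := exists_merge hz hz' (N + 1) hmem
  rw [← hR]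
  have he := fun o ho => entry_eq_of_mem_entries (hmem o ho)
  exact hN y R v' w' hy (fun t ht => by rw [hyz t (by omega)])
    (fun i k hk => (inv_eq_of_entry_eq (he (i, k) (by dsimp only; omega))
      (Sees.refl hz.il (i, k))).symm)
    (fun i k hk => (resp_eq_of_entry_eq (he (i, k) (by dsimp only; omega))).symm)

theorem PSD_subset_PWD [NeZero n] (hP : ∀ α : Type, register α ∈ P) : PSD n P ⊆ PWD n P := by
  classical
  rintro ⟨A, L⟩ ⟨hwf, V, hV, hD⟩
  refine mem_PWD_of_rule hP hwf (fun _ D => if Refutes L D then .no else .yes) ?_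
  intro μ v w x Q K hμ hx hQ hK hfin hU
  constructor
  · intro hall _
    refine Set.finite_empty.subset fun m hm => ?_
    have hm : Refutes L (K (m + 1)) := by
      by_contra h
      simp [h] at hm
    obtain ⟨z, hz⟩ := Execution.exists_hasEntries hμ v w
    obtain ⟨z', hz', hz'L⟩ := hm z _ hz (hU ▸ Set.subset_iUnion K (m + 1))
    exact hz'L (hall z' hz')
  · intro hxL
    obtain ⟨z, hz, hzL⟩ := hD.exists_of_input hV hμ hx hQ hxL
    obtain ⟨D, hDs, hDf, hDr⟩ := hD.exists_refutes hV hz hzL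
    obtain ⟨m, hm⟩ := exists_subset_of_monotone hK hDf (hU ▸ hDs)
    refine (Set.Ici_infinite m).mono fun k hk => ?_
    have : Refutes L (K (k + 1)) := hDr.mono (hm.trans (hK (Nat.le_succ_of_le hk)))
    simp [this]

end Classes

/-! ### The counter in terms of invocations, responses and the order of operations -/

theorem Symbol.inv_eq_inv_iff {n : ℕ} {A : DistAlphabet n} {i : Fin n} {a b : A.Inv i} :
    Symbol.inv i a = Symbol.inv i b ↔ a = b := by simp

theorem Symbol.resp_eq_resp_iff {n : ℕ} {A : DistAlphabet n} {i : Fin n} {a b : A.Resp i} :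
    Symbol.resp i a = Symbol.resp i b ↔ a = b := by simp

section SecCount

variable {n : ℕ} {P : Set SharedObject}

/-- The safety conditions of the strongly-eventual consistent counter for the operation `o`, where
`r a o` means that the invocation of `a` comes before the response of `o`. -/
structure SafeAt (v : ∀ i, ℕ → (counterAlphabet n).Inv i) (w : ∀ i, ℕ → (counterAlphabet n).Resp i)
    (r : OpId n → OpId n → Prop) (o : OpId n) : Prop where
  ack : v o.1 o.2 = CounterInv.inc → w o.1 o.2 = CounterResp.ack
  val : v o.1 o.2 = CounterInv.read → ∃ c, w o.1 o.2 = CounterResp.val c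
  own : ∀ c, v o.1 o.2 = CounterInv.read → w o.1 o.2 = CounterResp.val c →
    {k | k < o.2 ∧ v o.1 k = CounterInv.inc}.ncard ≤ c
  mono : ∀ k c d, k < o.2 → (∀ m, k < m → m < o.2 → v o.1 m ≠ CounterInv.read) →
    v o.1 k = CounterInv.read → v o.1 o.2 = CounterInv.read → w o.1 k = CounterResp.val c →
    w o.1 o.2 = CounterResp.val d → c ≤ d
  real : ∀ c, v o.1 o.2 = CounterInv.read → w o.1 o.2 = CounterResp.val c →
    c ≤ {a : OpId n | v a.1 a.2 = CounterInv.inc ∧ r a o}.ncard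

/-- The operations that are increments. -/
def incs (v : ∀ i, ℕ → (counterAlphabet n).Inv i) : Set (OpId n) :=
  {o | v o.1 o.2 = CounterInv.inc}

/-- The operations that are not reads returning `c`. -/
def unsettled (v : ∀ i, ℕ → (counterAlphabet n).Inv i) (w : ∀ i, ℕ → (counterAlphabet n).Resp i)
    (c : ℕ) : Set (OpId n) :=
  {o | ¬ (v o.1 o.2 = CounterInv.read ∧ w o.1 o.2 = CounterResp.val c)}

section Presents

variable {y : Word (counterAlphabet n)} {Q : Fin n → ℕ → ℕ}
  {v : ∀ i, ℕ → (counterAlphabet n).Inv i} {w : ∀ i, ℕ → (counterAlphabet n).Resp i}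

theorem Presents.isInc_iff (h : Presents y Q v w) (o : OpId n) :
    IsInc y o ↔ v o.1 o.2 = CounterInv.inc := by
  rw [IsInc, h.invPos_eq, h.inv]
  exact Symbol.inv_eq_inv_iff

theorem Presents.isRead_iff (h : Presents y Q v w) (o : OpId n) :
    IsRead y o ↔ v o.1 o.2 = CounterInv.read := by
  rw [IsRead, h.invPos_eq, h.inv]
  exact Symbol.inv_eq_inv_iff

theorem Presents.resp_eq_iff (h : Presents y Q v w) (o : OpId n) (b : CounterResp) :
    y (respPos y o) = .resp o.1 b ↔ w o.1 o.2 = b := by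
  rw [h.respPos_eq, h.resp]
  exact Symbol.resp_eq_resp_iff

theorem Presents.readReturns_iff (h : Presents y Q v w) (o : OpId n) (c : ℕ) :
    ReadReturns y o c ↔ v o.1 o.2 = CounterInv.read ∧ w o.1 o.2 = CounterResp.val c := by
  rw [ReadReturns, h.isRead_iff, h.resp_eq_iff]

theorem Presents.precedes_iff (h : Presents y Q v w) (a o : OpId n) :
    Precedes y a o ↔ ¬ Sees Q o a := by
  rw [Precedes, h.respPos_eq, h.invPos_eq, Sees, not_lt, le_iff_lt_or_eq, or_iff_left]
  intro he
  have := (h.il.eq_iff.1 he).2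
  omega

theorem Presents.own_incs_ncard (h : Presents y Q v w) (o : OpId n) :
    {o' : OpId n | o'.1 = o.1 ∧ IsInc y o' ∧ Precedes y o' o}.ncard =
      {k | k < o.2 ∧ v o.1 k = CounterInv.inc}.ncard := by
  rw [← Set.ncard_image_of_injective {k | k < o.2 ∧ v o.1 k = CounterInv.inc}
    (Prod.mk_right_injective o.1)]
  congr 1
  ext ⟨i, k⟩
  constructor
  · rintro ⟨h1, h2, h3⟩
    obtain rfl : i = o.1 := h1
    refine ⟨k, ⟨?_, (h.isInc_iff _).1 h2⟩, rfl⟩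
    rw [h.precedes_iff, Sees, not_lt, (h.il.mono _).le_iff_le] at h3
    dsimp only at h3
    omega
  · rintro ⟨k', ⟨h1, h2⟩, h3⟩
    cases h3
    refine ⟨rfl, (h.isInc_iff _).2 h2, ?_⟩
    rw [h.precedes_iff, Sees, not_lt, (h.il.mono _).le_iff_le]
    dsimp only
    omega

theorem Presents.real_time_set (h : Presents y Q v w) (o : OpId n) :
    {o' : OpId n | IsInc y o' ∧ (Precedes y o' o ∨ Concurrent y o' o)} =
      {a : OpId n | v a.1 a.2 = CounterInv.inc ∧ Sees Q a o} := by
  ext a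
  simp only [Set.mem_ofPred_eq, h.isInc_iff, Concurrent, h.precedes_iff]
  refine and_congr_right fun _ => ?_
  -- an operation that precedes `o` is also seen by `o`
  have : ¬ Sees Q o a → Sees Q a o := by
    intro hn
    have h1 := h.il.mono a.1 (show 2 * a.2 < 2 * a.2 + 1 by omega)
    have h2 := h.il.mono o.1 (show 2 * o.2 < 2 * o.2 + 1 by omega)
    unfold Sees at hn ⊢
    omega
  tauto

theorem Presents.incAt_set (h : Presents y Q v w) :
    {t | IncAt y t} = (fun o : OpId n => Q o.1 (2 * o.2)) '' incs v := by
  ext t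
  constructor
  · rintro ⟨i, ht⟩
    obtain ⟨k, hk⟩ := (h.inv_iff i t).1 ⟨_, ht⟩
    refine ⟨(i, k), ?_, hk⟩
    have := h.inv i k
    rw [hk, ht] at this
    exact (Symbol.inv_eq_inv_iff.1 this).symm
  · rintro ⟨o, ho, rfl⟩
    refine ⟨o.1, ?_⟩
    rw [h.inv, show v o.1 o.2 = _ from ho]

theorem Presents.injective_inv (h : Presents y Q v w) :
    Function.Injective fun o : OpId n => Q o.1 (2 * o.2) := by
  rintro ⟨i, k⟩ ⟨i', k'⟩ he
  obtain ⟨h1, h2⟩ := h.il.eq_iff.1 he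
  rw [show i = i' from h1, show k = k' by dsimp only at h2; omega]

/-- A word is a strongly-eventual consistent history when its operations are safe, it has finitely
many increments, and almost all operations are reads that return their number. -/
theorem Presents.stronglyEventual_iff (h : Presents y Q v w) :
    StronglyEventual y ↔ (∀ o, SafeAt v w (Sees Q) o) ∧ (incs v).Finite ∧
      (unsettled v w (incs v).ncard).Finite := by
  have hfin : {t | IncAt y t}.Finite ↔ (incs v).Finite := by
    rw [h.incAt_set, Set.finite_image_iff h.injective_inv.injOn]
  have hcard : ∀ m, (∀ t, m ≤ t → ¬ IncAt y t) →
      {t | t < m ∧ IncAt y t}.ncard = (incs v).ncard := by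
    intro m hm
    rw [← Set.ncard_image_of_injective (incs v) h.injective_inv, ← h.incAt_set]
    congr 1
    ext t
    exact ⟨fun ht => ht.2, fun ht => ⟨not_le.1 fun hle => hm t hle ht, ht⟩⟩
  constructor
  · intro hs
    have hf := hfin.1 hs.finitely_many_incs
    refine ⟨fun o => ⟨fun ho => ?_, fun ho => ?_, fun c ho hc => ?_,
      fun k c d hk hm hvk hvo hwk hwo => ?_, fun c ho hc => ?_⟩, hf, ?_⟩
    · exact (h.resp_eq_iff _ _).1 (hs.inc_ack o ((h.isInc_iff o).2 ho))
    · obtain ⟨c, hc⟩ := hs.read_val o ((h.isRead_iff o).2 ho)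
      exact ⟨c, ((h.readReturns_iff o c).1 hc).2⟩
    · rw [← h.own_incs_ncard]
      exact hs.own_incs o c ((h.readReturns_iff o c).2 ⟨ho, hc⟩)
    · exact hs.monotone_reads o.1 k o.2 c d hk (fun m h1 h2 => by
        rw [h.isRead_iff]; exact hm m h1 h2) ((h.readReturns_iff _ c).2 ⟨hvk, hwk⟩)
        ((h.readReturns_iff _ d).2 ⟨hvo, hwo⟩)
    · rw [← h.real_time_set]
      exact hs.real_time o c ((h.readReturns_iff o c).2 ⟨ho, hc⟩)
    · obtain ⟨b, hb⟩ := hs.finitely_many_incs.bddAbove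
      have hm : ∀ t, b + 1 ≤ t → ¬ IncAt y t := fun t ht hi => by
        have := hb hi; omega
      obtain ⟨m', hm'⟩ := hs.convergence (b + 1) hm
      rw [hcard _ hm] at hm'
      refine Set.Finite.subset ((h.il.finite_lt m').preimage
        (f := fun o : OpId n => (o.1, 2 * o.2)) ?_) fun o ho => ?_
      · rintro ⟨i, k⟩ _ ⟨i', k'⟩ _ he
        simp only [Prod.mk.injEq] at he ⊢
        omega
      · by_contra hlt
        refine ho ((h.readReturns_iff o _).1 (hm' o ?_))
        rw [h.invPos_eq]
        exact not_lt.1 hlt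
  · rintro ⟨hs, hf, hu⟩
    refine ⟨⟨fun o ho => ?_, fun o ho => ?_, fun o c ho => ?_,
      fun i k l c d hkl hm hk hl => ?_, hfin.2 hf, fun m hm => ?_⟩, fun o c ho => ?_⟩
    · exact (h.resp_eq_iff _ _).2 ((hs o).ack ((h.isInc_iff o).1 ho))
    · obtain ⟨c, hc⟩ := (hs o).val ((h.isRead_iff o).1 ho)
      exact ⟨c, (h.readReturns_iff o c).2 ⟨(h.isRead_iff o).1 ho, hc⟩⟩
    · rw [h.own_incs_ncard]
      obtain ⟨h1, h2⟩ := (h.readReturns_iff o c).1 ho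
      exact (hs o).own c h1 h2
    · obtain ⟨h1, h2⟩ := (h.readReturns_iff _ c).1 hk
      obtain ⟨h3, h4⟩ := (h.readReturns_iff _ d).1 hl
      exact (hs (i, l)).mono k c d hkl (fun m h1 h2 => by
        have := hm m h1 h2
        rwa [h.isRead_iff] at this) h1 h3 h2 h4
    · rw [hcard m hm]
      obtain ⟨b, hb⟩ := (hu.image fun o : OpId n => Q o.1 (2 * o.2)).bddAbove
      refine ⟨b + 1, fun o ho => (h.readReturns_iff o _).2 ?_⟩
      by_contra hn
      have := hb ⟨o, hn, rfl⟩
      rw [h.invPos_eq] at ho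
      dsimp only at this
      omega
    · rw [h.real_time_set]
      obtain ⟨h1, h2⟩ := (h.readReturns_iff o c).1 ho
      exact (hs o).real c h1 h2

theorem Presents.finite_sees (h : Presents y Q v w) (o : OpId n) : {a | Sees Q a o}.Finite := by
  refine ((h.il.finite_lt (Q o.1 (2 * o.2 + 1))).preimage
    (f := fun o : OpId n => (o.1, 2 * o.2)) ?_).subset fun a ha => ha
  rintro ⟨i, k⟩ _ ⟨i', k'⟩ _ he
  simp only [Prod.mk.injEq] at he ⊢
  omega

end Presents

/-! ### The counter is not strongly decidable -/

/-- No verdict is possible for a history that has increments only: a finite part of it can be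
continued by reads that return the number of these increments, and then all words with the same
entries are in the language. -/
theorem secCount_notMem_PSD [NeZero n] : secCount n ∉ PSD n P := by
  rintro ⟨-, V, hV, hD⟩
  have hn : 0 < n := Nat.pos_of_ne_zero (NeZero.ne n)
  -- the processes take turns, each executes one operation at a time
  set Q : Fin n → ℕ → ℕ := fun i j => 2 * (n * (j / 2) + i) + j % 2 with hQ
  have hblock : ∀ (i i' : Fin n) (k k' : ℕ), k < k' → n * k + i < n * k' + i' := by
    intro i i' k k' h
    have := Nat.mul_le_mul_left n (Nat.succ_le_of_lt h)
    have := i.2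
    rw [Nat.mul_succ] at *
    omega
  have hI : Interleaving Q := by
    refine ⟨fun i => strictMono_nat_of_lt_succ fun j => ?_, fun i i' j j' h => ?_⟩
    · rcases Nat.even_or_odd' j with ⟨k, rfl | rfl⟩
      · simp only [hQ]
        rw [show (2 * k + 1) / 2 = k by omega, show 2 * k / 2 = k by omega]
        omega
      · have := hblock i i k (k + 1) (by omega)
        simp only [hQ]
        rw [show (2 * k + 1) / 2 = k by omega, show (2 * k + 1 + 1) / 2 = k + 1 by omega]
        omega
    · simp only [hQ] at h
      rcases lt_trichotomy (j / 2) (j' / 2) with hj | hj | hj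
      · have := hblock i i' _ _ hj; omega
      · rw [hj] at h; exact Fin.ext (by omega)
      · have := hblock i' i _ _ hj; omega
  have hsurj : ∀ t, ∃ i j, Q i j = t := by
    intro t
    refine ⟨⟨t / 2 % n, Nat.mod_lt _ hn⟩, 2 * (t / 2 / n) + t % 2, ?_⟩
    simp only [hQ]
    rw [show (2 * (t / 2 / n) + t % 2) / 2 = t / 2 / n by omega, Nat.div_add_mod]
    omega
  obtain ⟨y, hy⟩ := exists_presents (A := counterAlphabet n) hI hsurj
    (fun _ _ => CounterInv.inc) (fun _ _ => CounterResp.ack)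
  have hyL : y ∉ (secCount n).2 := by
    rintro ⟨-, h⟩
    have hf := (hy.stronglyEventual_iff.1 h).2.1
    refine Set.infinite_univ (α := OpId n) (hf.subset fun o _ => rfl)
  obtain ⟨N, hN⟩ := hD.exists_bound hV hy hyL
  set v : ∀ i, ℕ → (counterAlphabet n).Inv i := fun _ k =>
    if k < N + 1 then CounterInv.inc else CounterInv.read with hv
  set w : ∀ i, ℕ → (counterAlphabet n).Resp i := fun _ k =>
    if k < N + 1 then CounterResp.ack else CounterResp.val (n * (N + 1)) with hw
  have hinc : ∀ i k, v i k = CounterInv.inc ↔ k < N + 1 := by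
    intro i k
    refine ⟨fun h => ?_, fun h => if_pos h⟩
    by_contra hk
    cases (if_neg hk : v i k = CounterInv.read).symm.trans h
  have hread : ∀ i k, v i k = CounterInv.read ↔ ¬ k < N + 1 := by
    intro i k
    refine ⟨fun h hk => ?_, fun h => if_neg h⟩
    cases (if_pos hk : v i k = CounterInv.inc).symm.trans h
  have hval : ∀ i k, ¬ k < N + 1 → w i k = CounterResp.val (n * (N + 1)) :=
    fun i k h => if_neg h
  obtain ⟨y', hy'⟩ := exists_presents hI hsurj v w
  obtain ⟨z, hz, hzL⟩ := hN y' Q v w hy' (fun t _ => by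
      obtain ⟨i, j, rfl⟩ := hsurj t
      exact (hy.proc_eq i j).trans (hy'.proc_eq i j).symm)
    (fun i k hk => ((hinc i k).2 (by omega)).symm)
    (fun i k hk => (if_pos (show k < N + 1 by omega)).symm)
  obtain ⟨R, hR, hs⟩ := hz.presents
  have hset : {a : OpId n | a.2 < N + 1} = Set.univ ×ˢ Set.Iio (N + 1) := by
    ext a; simp
  have hset_fin : {a : OpId n | a.2 < N + 1}.Finite := by
    rw [hset]; exact Set.finite_univ.prod (Set.finite_Iio _)
  have hset_card : {a : OpId n | a.2 < N + 1}.ncard = n * (N + 1) := by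
    rw [hset, Set.ncard_prod, Set.ncard_univ, Nat.card_eq_fintype_card, Fintype.card_fin]
    congr 1
    rw [Set.ncard_eq_toFinset_card']
    simp
  have hincs : incs v = {a : OpId n | a.2 < N + 1} := by
    ext a; exact hinc _ _
  refine hzL ⟨hR.wellFormed, hR.stronglyEventual_iff.2 ⟨fun o => ?_, ?_, ?_⟩⟩
  · rw [hs]
    refine ⟨fun ho => ?_, fun ho => ⟨_, hval _ _ ((hread _ _).1 ho)⟩, fun c ho hc => ?_,
      fun k c d _ _ hvk hvo hwk hwo => ?_, fun c ho hc => ?_⟩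
    · exact if_pos ((hinc _ _).1 ho)
    · obtain rfl : n * (N + 1) = c :=
        CounterResp.val.inj ((hval o.1 _ ((hread _ _).1 ho)).symm.trans hc)
      have h1 : {k | k < o.2 ∧ v o.1 k = CounterInv.inc} ⊆ Set.Iio (N + 1) :=
        fun k hk => (hinc _ _).1 hk.2
      have h2 := Set.ncard_le_ncard h1 (Set.finite_Iio _)
      have h3 : (Set.Iio (N + 1)).ncard = N + 1 := by
        rw [Set.ncard_eq_toFinset_card']
        simp
      have h4 := Nat.le_mul_of_pos_left (N + 1) hn
      omega
    · have h1 := (hval o.1 _ ((hread _ _).1 hvk)).symm.trans hwk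
      have h2 := (hval o.1 _ ((hread _ _).1 hvo)).symm.trans hwo
      exact (CounterResp.val.inj h1).symm.le.trans (CounterResp.val.inj h2).le
    · obtain rfl : n * (N + 1) = c :=
        CounterResp.val.inj ((hval o.1 _ ((hread _ _).1 ho)).symm.trans hc)
      have ho := (hread _ _).1 ho
      rw [← hset_card]
      refine le_of_eq (congrArg Set.ncard ?_)
      ext a
      refine ⟨fun ha => ⟨(hinc _ _).2 ha, ?_⟩, fun ha => (hinc _ _).1 ha.1⟩
      have ha : a.2 < N + 1 := ha
      have := hblock a.1 o.1 a.2 o.2 (by omega)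
      simp only [Sees, hQ]
      rw [show 2 * a.2 / 2 = a.2 by omega, show (2 * o.2 + 1) / 2 = o.2 by omega]
      omega
  · rw [hincs]; exact hset_fin
  · rw [hincs, hset_card]
    refine hset_fin.subset fun o ho => ?_
    by_contra h
    exact ho ⟨(hread _ _).2 h, hval _ _ h⟩

/-! ### The counter is weakly decidable -/

/-- The entries `D` are not among those of any history with safe operations. -/
def Unsafe (D : Set (Entry (counterAlphabet n))) : Prop :=
  ∀ v w r, (∀ (i : Fin n) (k l : ℕ), k ≤ l → r (i, k) (i, l)) → D ⊆ entries v w r →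
    ∃ o, ¬ SafeAt v w r o

theorem Unsafe.mono {D D' : Set (Entry (counterAlphabet n))} (h : Unsafe D) (hD : D ⊆ D') :
    Unsafe D' := fun v w r hr hs => h v w r hr (hD.trans hs)

theorem SafeAt.of_entry_eq {v v' : ∀ i, ℕ → (counterAlphabet n).Inv i}
    {w w' : ∀ i, ℕ → (counterAlphabet n).Resp i} {r r' : OpId n → OpId n → Prop} {o : OpId n}
    (hr : ∀ (i : Fin n) (k l : ℕ), k ≤ l → r (i, k) (i, l))
    (he : ∀ k ≤ o.2, entry v' w' r' (o.1, k) = entry v w r (o.1, k)) (h : SafeAt v' w' r' o) :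
    SafeAt v w r o := by
  have hv : ∀ k ≤ o.2, v' o.1 k = v o.1 k := fun k hk =>
    inv_eq_of_entry_eq (he k hk) (hr o.1 k k le_rfl)
  have hw : ∀ k ≤ o.2, w' o.1 k = w o.1 k := fun k hk => resp_eq_of_entry_eq (he k hk)
  have hset : {a : OpId n | v' a.1 a.2 = CounterInv.inc ∧ r' a o} =
      {a : OpId n | v a.1 a.2 = CounterInv.inc ∧ r a o} := by
    ext a
    have h1 := rel_iff_of_entry_eq (he o.2 le_rfl) a
    constructor
    · rintro ⟨h2, h3⟩
      exact ⟨(inv_eq_of_entry_eq (he o.2 le_rfl) (h1.1 h3)).symm.trans h2, h1.1 h3⟩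
    · rintro ⟨h2, h3⟩
      exact ⟨(inv_eq_of_entry_eq (he o.2 le_rfl) h3).trans h2, h1.2 h3⟩
  obtain ⟨h1, h2, h3, h4, h5⟩ := h
  rw [hset] at h5
  rw [hv _ le_rfl, hw _ le_rfl] at *
  refine ⟨h1, h2, ?_, ?_, h5⟩
  · rwa [show {k | k < o.2 ∧ v' o.1 k = CounterInv.inc} = {k | k < o.2 ∧ v o.1 k = CounterInv.inc}
      from Set.ext fun k => and_congr_right fun hk => by rw [hv k hk.le]] at h3
  · intro k c d hk hm hvk hvo hwk hwo
    refine h4 k c d hk (fun m h6 h7 => ?_) ((hv k hk.le).trans hvk) hvo ((hw k hk.le).trans hwk) hwo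
    rw [hv m h7.le]
    exact hm m h6 h7

/-- The increments that are seen by the entries `D`. -/
def seenIncs (D : Set (Entry (counterAlphabet n))) : Set (OpId n) :=
  {o | ∃ d ∈ D, (⟨o.1, o.2, CounterInv.inc⟩ : Marked (counterAlphabet n)) ∈ d.2}

/-- The entry `d` belongs to a read that returns the number of increments seen by `D`. -/
def Settled (D : Set (Entry (counterAlphabet n))) (d : Entry (counterAlphabet n)) : Prop :=
  (⟨d.1.1, d.1.2.1, CounterInv.read⟩ : Marked (counterAlphabet n)) ∈ d.2 ∧
    d.1.2.2 = CounterResp.val (seenIncs D).ncard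

theorem seenIncs_subset {v : ∀ i, ℕ → (counterAlphabet n).Inv i}
    {w : ∀ i, ℕ → (counterAlphabet n).Resp i} {r : OpId n → OpId n → Prop}
    {D : Set (Entry (counterAlphabet n))} (hD : D ⊆ entries v w r) : seenIncs D ⊆ incs v := by
  rintro o ⟨d, hd, ho⟩
  obtain ⟨b, rfl⟩ := hD hd
  exact (mark_mem_entry.1 ho).2.symm

theorem settled_entry_iff {v : ∀ i, ℕ → (counterAlphabet n).Inv i}
    {w : ∀ i, ℕ → (counterAlphabet n).Resp i} {r : OpId n → OpId n → Prop}
    {D : Set (Entry (counterAlphabet n))} {o : OpId n} (ho : r o o) :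
    Settled D (entry v w r o) ↔ o ∉ unsettled v w (seenIncs D).ncard := by
  have h : Settled D (entry v w r o) ↔ v o.1 o.2 = CounterInv.read ∧
      w o.1 o.2 = CounterResp.val (seenIncs D).ncard := by
    refine and_congr ?_ Iff.rfl
    refine mark_mem_entry.trans ?_
    exact ⟨fun h => h.2.symm, fun h => ⟨ho, h.symm⟩⟩
  rw [h, unsettled, Set.mem_ofPred_eq, not_not]

theorem entry_injective {A : DistAlphabet n} (v : ∀ i, ℕ → A.Inv i) (w : ∀ i, ℕ → A.Resp i)
    (r : OpId n → OpId n → Prop) : Function.Injective (entry v w r) := by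
  rintro ⟨i, k⟩ ⟨i', k'⟩ h
  have h1 := congrArg Prod.fst h
  simp only [entry, Sigma.mk.injEq] at h1
  obtain ⟨rfl, h1⟩ := h1
  simp only [heq_eq_eq, Prod.mk.injEq] at h1
  rw [h1.1]

theorem infinite_setOf_new {α : Type*} {K : ℕ → Set α} (hf : ∀ m, (K m).Finite) {B : Set α}
    (hB : B.Infinite) (hs : B ⊆ ⋃ m, K m) : {m | ∃ d ∈ B, d ∈ K (m + 1) \ K m}.Infinite := by
  intro hfin
  obtain ⟨M, hM⟩ := hfin.bddAbove
  have : ∀ m, ∀ d ∈ B, d ∈ K m → ∃ m' ≤ M + 1, d ∈ K m' := by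
    intro m
    induction m with
    | zero => exact fun d _ hd => ⟨0, by omega, hd⟩
    | succ m ih =>
      intro d hdB hd
      by_cases hdm : d ∈ K m
      · exact ih d hdB hdm
      · have := hM ⟨d, hdB, hd, hdm⟩
        exact ⟨m + 1, by omega, hd⟩
  refine hB (((Set.finite_Iic (M + 1)).biUnion fun m _ => hf m).subset fun d hd => ?_)
  obtain ⟨m, hm⟩ := Set.mem_iUnion.1 (hs hd)
  obtain ⟨m', h1, h2⟩ := this m d hd hm
  exact Set.mem_biUnion h1 h2

theorem finite_setOf_new {α : Type*} {K : ℕ → Set α} (hK : Monotone K) {B : Set α}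
    (hB : B.Finite) : {m | ∃ d ∈ B, d ∈ K (m + 1) \ K m}.Finite := by
  have : {m | ∃ d ∈ B, d ∈ K (m + 1) \ K m} = ⋃ d ∈ B, {m | d ∈ K (m + 1) \ K m} := by
    ext m; simp only [Set.mem_iUnion, exists_prop]; rfl
  rw [this]
  refine hB.biUnion fun d _ => Set.Subsingleton.finite fun m hm m' hm' => ?_
  rcases lt_trichotomy m m' with h | h | h
  · exact absurd (hK (Nat.succ_le_of_lt h) hm.1) hm'.2
  · exact h
  · exact absurd (hK (Nat.succ_le_of_lt h) hm'.1) hm.2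

/-- The processes report `no` when the known entries are unsafe, and when they learn an entry that
is not that of a read returning the number of known increments. The former detects violations of
safety, the latter violations of convergence. -/
theorem secCount_mem_PWD [NeZero n] (hP : ∀ α : Type, register α ∈ P) : secCount n ∈ PWD n P := by
  classical
  refine mem_PWD_of_rule hP (fun x hx => hx.1) (fun prev known =>
    if Unsafe known ∨ ∃ d ∈ known \ prev, ¬ Settled known d then .no else .yes) ?_
  intro μ v w x Q K hμ hx hQ hK hfin hU
  have hno : ∀ m, (if Unsafe (K (m + 1)) ∨ ∃ d ∈ K (m + 1) \ K m, ¬ Settled (K (m + 1)) d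
      then Report.no else Report.yes) = .no ↔
      Unsafe (K (m + 1)) ∨ ∃ d ∈ K (m + 1) \ K m, ¬ Settled (K (m + 1)) d := by
    intro m
    split_ifs with h
    · exact iff_of_true rfl h
    · exact iff_of_false (fun h => by cases h) h
  simp only [hno]
  set r := AnnouncedFor μ with hr
  have hown : ∀ (i : Fin n) (k l : ℕ), k ≤ l → r (i, k) (i, l) := fun i k l hkl =>
    hμ.mono i (by dsimp only; omega)
  have hsub : ∀ m, K m ⊆ entries v w r := fun m => hU ▸ Set.subset_iUnion K m
  have hmem : ∀ o, entry v w r o ∈ ⋃ m, K m := fun o => by rw [hU]; exact ⟨o, rfl⟩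
  -- if there are finitely many increments, all of them are eventually known
  have hcount : (incs v).Finite → ∃ m₀, ∀ m ≥ m₀, seenIncs (K m) = incs v := by
    intro hf
    obtain ⟨m₀, hm₀⟩ := exists_subset_of_monotone hK (hf.image (entry v w r)) (by
      rintro _ ⟨o, -, rfl⟩; exact hmem o)
    refine ⟨m₀, fun m hm => (seenIncs_subset (hsub m)).antisymm fun o ho => ?_⟩
    exact ⟨_, hK hm (hm₀ ⟨o, ho, rfl⟩), mark_mem_entry.2
      ⟨hown o.1 o.2 o.2 le_rfl, (show v o.1 o.2 = _ from ho).symm⟩⟩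
  constructor
  · intro hall _
    obtain ⟨z, hz⟩ := Execution.exists_hasEntries hμ v w
    have hzL := hall z hz
    obtain ⟨R, hR, hs⟩ := hz.presents
    obtain ⟨h1, h2, h3⟩ := hR.stronglyEventual_iff.1 hzL.2
    rw [hs] at h1
    obtain ⟨m₀, hm₀⟩ := hcount h2
    refine ((Set.finite_Iio m₀).union (finite_setOf_new hK (h3.image (entry v w r)))).subset ?_
    rintro m (hm | ⟨d, hd, hn⟩)
    · obtain ⟨o, ho⟩ := hm v w r hown (hsub _)
      exact absurd (h1 o) ho
    · rcases lt_or_ge m m₀ with hlt | hge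
      · exact Or.inl hlt
      · obtain ⟨o, rfl⟩ := hsub _ hd.1
        refine Or.inr ⟨_, ⟨o, ?_, rfl⟩, hd⟩
        rw [settled_entry_iff (hown o.1 o.2 o.2 le_rfl), hm₀ (m + 1) (by omega), not_not] at hn
        exact hn
  · intro hxL
    by_cases hsafe : ∀ o, SafeAt v w r o
    · by_cases hf : (incs v).Finite
      · obtain ⟨m₀, hm₀⟩ := hcount hf
        have hu : (unsettled v w (incs v).ncard).Infinite := by
          intro hu
          refine hxL ⟨hx.wellFormed, hx.stronglyEventual_iff.2 ⟨fun o => ?_, hf, hu⟩⟩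
          obtain ⟨h1, h2, h3, h4, h5⟩ := hsafe o
          refine ⟨h1, h2, h3, h4, fun c ho hc => (h5 c ho hc).trans ?_⟩
          -- an invocation comes before its announcement, and a response after its snapshot
          refine Set.ncard_le_ncard (fun a ha => ⟨ha.1, ?_⟩)
            ((hx.finite_sees o).subset fun a ha => ha.2)
          rw [Sees, hQ, Execution.symbolTime_even, Execution.symbolTime_odd]
          exact (hμ.mono a.1 (by omega)).trans (lt_trans ha.2 (hμ.mono o.1 (by omega)))
        have hinf := infinite_setOf_new hfin
          (hu.image (entry_injective v w r).injOn) (by rintro _ ⟨o, -, rfl⟩; exact hmem o)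
        refine (hinf.sdiff (Set.finite_Iio m₀)).mono ?_
        rintro m ⟨⟨_, ⟨o, ho, rfl⟩, hd⟩, hm⟩
        refine Or.inr ⟨_, hd, ?_⟩
        rw [settled_entry_iff (hown o.1 o.2 o.2 le_rfl),
          hm₀ (m + 1) (by have : ¬ m < m₀ := hm; omega), not_not]
        exact ho
      · have hinf := infinite_setOf_new hfin
          (Set.Infinite.image (entry_injective v w r).injOn hf)
          (by rintro _ ⟨o, -, rfl⟩; exact hmem o)
        refine hinf.mono ?_
        rintro m ⟨_, ⟨o, ho, rfl⟩, hd⟩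
        refine Or.inr ⟨_, hd, ?_⟩
        rw [settled_entry_iff (hown o.1 o.2 o.2 le_rfl), not_not]
        rintro ⟨h, -⟩
        cases (show v o.1 o.2 = _ from ho).symm.trans h
    · push Not at hsafe
      obtain ⟨o, ho⟩ := hsafe
      obtain ⟨m, hm⟩ := exists_subset_of_monotone hK
        ((Set.finite_Iic o.2).image fun k => entry v w r (o.1, k))
        (by rintro _ ⟨k, -, rfl⟩; exact hmem _)
      refine (Set.Ici_infinite m).mono fun m' hm' => Or.inl ?_
      refine Unsafe.mono (fun v' w' r' _ hs => ⟨o, fun hsafe' => ho ?_⟩)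
        (hm.trans (hK (Nat.le_succ_of_le hm')))
      exact hsafe'.of_entry_eq hown fun k hk => entry_eq_of_mem_entries (hs ⟨k, hk, rfl⟩)

end SecCount

end DRV

theorem mainTheorem9 (n : ℕ) (hn : 2 ≤ n) (P : Set DRV.SharedObject)
    (hP : ∀ α : Type, DRV.register α ∈ P) :
    DRV.PSD n P ⊂ DRV.PWD n P ∧
      DRV.secCount n ∈ DRV.PWD n P ∧ DRV.secCount n ∉ DRV.PSD n P := by
  have : NeZero n := ⟨by omega⟩
  have h1 := DRV.secCount_mem_PWD (n := n) hP
  have h2 := DRV.secCount_notMem_PSD (n := n) (P := P)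
  exact ⟨⟨DRV.PSD_subset_PWD hP, fun h => h2 (h h1)⟩, h1, h2⟩
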